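/- Let $U=\{z\in\mathbb C:|z|\le 2\}$, $V=\{\xi\in\mathbb C:|\xi|\le 2\}$, glued along $W=\{z: \tfrac12\le|z|\le 2\}$ by $\xi=z^{-1}$ to form $\mathbb P^1=\mathbb P^1_{\mathbb C}$. For a closed set $S$ let $A(S)=(A^{0,\bullet}(S),\bar\partial)$ be its Dolbeault dg-algebra, the direct limit over the open neighbourhoods of $S$, let $C^\infty(S)=A^0(S)$ and let $\mathcal O(S)\subset C^\infty(S)$ be the germs of holomorphic functions. For a dg-algebra $B$ let $\mathcal P_B$ be the dg-category of cohesive $B$-modules: bounded graded finitely generated projective $B^0$-modules $\mathcal E$ with a flat $\mathbb Z$-connection on $\mathcal E\otimes_{B^0}B$; morphisms of degree $n$ are the right $B$-linear maps of degree $n$ between the modules $\mathcal E\otimes_{B^0}B$. For dg-functors $G:\mathcal B\to\mathcal D$ and $L:\mathcal C\to\mathcal D$ let $\mathcal B\times^h_{\mathcal D}\mathcal C$ be the dg-category whose objects are triples $(M,N,\phi)$ with $\phi:G(M)\to L(N)$ closed of degree $0$ and invertible in $H^0(\mathcal D)$, whose morphisms of degree $i$ from $(M_1,N_1,\phi_1)$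 to $(M_2,N_2,\phi_2)$ are the triples $(\mu,\nu,\gamma)$ in $\mathcal B^i(M_1,M_2)\oplus\mathcal C^i(N_1,N_2)\oplus\mathcal D^{i-1}(G(M_1),L(N_2))$, with $$d(\mu,\nu,\gamma)=(d\mu,\,d\nu,\,-d\gamma+\phi_2G(\mu)-L(\nu)\phi_1),$$ $$(\mu',\nu',\gamma')\circ(\mu,\nu,\gamma)=(\mu'\mu,\ \nu'\nu,\ \gamma'G(\mu)+(-1)^{|\nu'|}L(\nu')\gamma).$$ Let $\mathcal Q=\mathcal P_{A(U)}\times^h_{\mathcal P_{A(W)}}\mathcal P_{A(V)}$, formed with the pullbacks along the restrictions $A(U)\to A(W)$ and $A(V)\to A(W)$. For $j\in\mathbb Z$ let $A(j)=(A(U),A(V),z^{-j})\in\mathcal Q$, where both pullbacks to $W$ are identified with $A(W)$, and let $A=A(0)$. Trivialize $\mathcal O(n)$ over $U$ and $V$ by frames in which the coordinates of a section satisfy $s_V=z^{-n}s_U$ over $W$. In these frames the Čech complex $\check C^\bullet=\check C^\bullet(\mathcal Hom(\mathcal O(2),\mathcal O))$ of the cover $\{U,V\}$ is $$\mathcal O(U)\oplus\mathcal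 O(V)\to\mathcal O(W),\qquad (h_U,h_V)\mapsto h_V|_W-z^2h_U|_W,$$ in degrees $0$ and $1$. Then there is a quasi-isomorphism of complexes $$\Phi:\check C^\bullet\to\mathcal Q^\bullet(A(2),A)$$ with the following properties. 1. For every $\tau\in\mathcal O(W)$ there are $\mu_U\in C^\infty(U)$ and $\mu_V\in C^\infty(V)$ with $z^2\mu_U-\mu_V=\tau$ on $W$ and $\Phi(\tau)=(\bar\partial\mu_U,\bar\partial\mu_V,0)$; here $\bar\partial\mu_U$ and $\bar\partial\mu_V$ stand for the multiplications by these forms. 2. $H^1(\Phi)$ maps the class of $\tau$ to the class of $(\bar\partial\mu_U,\bar\partial\mu_V,0)$ for every pair $(\mu_U,\mu_V)\in C^\infty(U)\times C^\infty(V)$ with $z^2\mu_U-\mu_V=\tau$ on $W$; so this class does not depend on the choice of the pair. 3. There are $\mathbb C$-linear isomorphisms $$c:\check H^1(\mathcal Hom(\mathcal O(2),\mathcal O))\to \mathrm{Ext}^1_{\mathbb P^1}(\mathcal O(2),\mathcal O),\qquad e:\mathrm{Ext}^1_{\mathbb P^1}(\mathcal O(2),\mathcal O)\to H^1(\mathcal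 Q(A(2),A))$$ with $e\circ c=H^1(\Phi)$. Here $c[\tau]=x$ if and only if some extension $0\to\mathcal O\to E\to\mathcal O(2)\to0$ of class $x$ has splittings $\sigma_U$ and $\sigma_V$ over open neighbourhoods of $U$ (not containing $\infty$) and of $V$ (not containing $0$) such that $\sigma_V-\sigma_U$ is, on the intersection of these neighbourhoods, the homomorphism $\mathcal O(2)\to\mathcal O$ given by a holomorphic function with germ $\tau$ along $W$ in the frames over $V$. Moreover $\dim_{\mathbb C}\mathrm{Ext}^1_{\mathbb P^1}(\mathcal O(2),\mathcal O)=1$. 4. This class is lost by restriction to $U$ and $V$: every extension of $\mathcal O(2)$ by $\mathcal O$ on $\mathbb P^1$ splits over an open neighbourhood of $U$ and over an open neighbourhood of $V$, and for every closed $(\zeta_U,\zeta_V,\gamma)\in\mathcal Q^1(A(2),A)$ the components $\zeta_U$ and $\zeta_V$ are exact in $\mathcal P_{A(U)}$ and $\mathcal P_{A(V)}$. -/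

import Mathlib

open CategoryTheory TensorProduct

namespace Glue

/-- The sign `(-1) ^ n` for `n : ℤ`. -/
def sgn (n : ℤ) : ℤ := (n.negOnePow : ℤ)

lemma sgn_add (m n : ℤ) : sgn (m + n) = sgn m * sgn n := by
  simp [sgn, Int.negOnePow_add]

lemma sgn_one : sgn 1 = -1 := by simp [sgn]

lemma sgn_zero : sgn 0 = 1 := by simp [sgn]

lemma sgn_mul_self (n : ℤ) : sgn n * sgn n = 1 := by
  rw [← sgn_add, sgn, Int.negOnePow_even (n + n) ⟨n, rfl⟩, Units.val_one]

lemma sgn_succ {p q : ℤ} (h : p + 1 = q) : sgn q = - sgn p := by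
  rw [← h, sgn_add, sgn_one]; ring

/-- A dg-category over the field `k`: for all objects `x`, `y` a `ℤ`-graded complex
`(Hom x y •, d)` of `k`-vector spaces with differential of degree `1`, units, and an associative
bilinear composition which is a morphism of complexes.
The equations `p + q = n` between degrees are arguments, to avoid transports. -/
structure DGCat (k : Type) [Field k] where
  Obj : Type 1
  Hom : Obj → Obj → ℤ → Type
  [grp : ∀ x y n, AddCommGroup (Hom x y n)]
  [mod : ∀ x y n, Module k (Hom x y n)]
  d : ∀ {x y : Obj} {p q : ℤ}, p + 1 = q → (Hom x y p →ₗ[k] Hom x y q)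
  d_d : ∀ {x y : Obj} {p q r : ℤ} (h : p + 1 = q) (h' : q + 1 = r) (f : Hom x y p),
    d h' (d h f) = 0
  one : ∀ x : Obj, Hom x x 0
  comp : ∀ {x y z : Obj} {p q n : ℤ}, p + q = n → (Hom y z p →ₗ[k] Hom x y q →ₗ[k] Hom x z n)
  one_comp : ∀ {x y : Obj} {p : ℤ} (h : 0 + p = p) (f : Hom x y p), comp h (one y) f = f
  comp_one : ∀ {x y : Obj} {p : ℤ} (h : p + 0 = p) (f : Hom x y p), comp h f (one x) = f
  assoc : ∀ {x y z w : Obj} {p q r s t n : ℤ} (h₁ : p + q = s) (h₂ : s + r = n)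
    (h₃ : q + r = t) (h₄ : p + t = n) (f : Hom z w p) (g : Hom y z q) (e : Hom x y r),
    comp h₂ (comp h₁ f g) e = comp h₄ f (comp h₃ g e)
  d_comp : ∀ {x y z : Obj} {p q n p' q' n' : ℤ} (h : p + q = n) (hp : p + 1 = p')
    (hq : q + 1 = q') (hn : n + 1 = n') (hl : p' + q = n') (hr : p + q' = n')
    (g : Hom y z p) (f : Hom x y q),
    d hn (comp h g f) = comp hl (d hp g) f + sgn p • comp hr g (d hq f)

attribute [instance] DGCat.grp DGCat.mod

namespace DGCat

variable {k : Type} [Field k]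

/-- The identity morphisms of a dg-category are closed. -/
lemma d_one (C : DGCat k) (x : C.Obj) (h : (0 : ℤ) + 1 = 1) : C.d h (C.one x) = 0 := by
  have := C.d_comp (x := x) (y := x) (z := x) (add_zero 0) h h h (by norm_num) (by norm_num)
    (C.one x) (C.one x)
  rw [C.one_comp, C.comp_one, C.one_comp, sgn_zero, one_smul] at this
  simpa using this

/-- The complex of morphisms from `x` to `y`. -/
noncomputable def homComplex (C : DGCat k) (x y : C.Obj) : CochainComplex (ModuleCat.{0} k) ℤ :=
  CochainComplex.of (fun n => ModuleCat.of k (C.Hom x y n))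
    (fun n => ModuleCat.ofHom (C.d (rfl : n + 1 = n + 1)))
    (fun n => by ext f; exact C.d_d _ _ f)

/-- A closed degree `0` morphism is a homotopy equivalence if it becomes invertible in the
homotopy category `H⁰(C)`. -/
def IsHomotopyEquiv (C : DGCat k) {x y : C.Obj} (f : C.Hom x y 0) : Prop :=
  ∃ g : C.Hom y x 0, C.d (zero_add 1) g = 0 ∧
    (∃ h : C.Hom x x (-1), C.comp (add_zero 0) g f - C.one x = C.d (by norm_num) h) ∧
    (∃ h : C.Hom y y (-1), C.comp (add_zero 0) f g - C.one y = C.d (by norm_num) h)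

lemma isHomotopyEquiv_of_inv {C : DGCat k} {x y : C.Obj} (f : C.Hom x y 0) (g : C.Hom y x 0)
    (hg : C.d (zero_add 1) g = 0) (hgf : C.comp (add_zero 0) g f = C.one x)
    (hfg : C.comp (add_zero 0) f g = C.one y) : C.IsHomotopyEquiv f :=
  ⟨g, hg, ⟨0, by rw [hgf, map_zero, sub_self]⟩, ⟨0, by rw [hfg, map_zero, sub_self]⟩⟩

/-- A dg-functor. -/
structure Functor (B D : DGCat k) where
  obj : B.Obj → D.Obj
  map : ∀ {x y : B.Obj} {n : ℤ}, B.Hom x y n →ₗ[k] D.Hom (obj x) (obj y) n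
  map_d : ∀ {x y : B.Obj} {p q : ℤ} (h : p + 1 = q) (f : B.Hom x y p),
    map (B.d h f) = D.d h (map f)
  map_one : ∀ x : B.Obj, map (B.one x) = D.one (obj x)
  map_comp : ∀ {x y z : B.Obj} {p q n : ℤ} (h : p + q = n) (g : B.Hom y z p) (f : B.Hom x y q),
    map (B.comp h g f) = D.comp h (map g) (map f)

section HomotopyFiberProduct

variable {B C D : DGCat k} (G : Functor B D) (L : Functor C D)

/-- Objects of the homotopy fiber product `B ×ʰ_D C`: triples `(M, N, φ)` with
`φ : G M ⟶ L N` closed of degree `0` and invertible in `H⁰(D)`. -/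
structure HFPObj where
  M : B.Obj
  N : C.Obj
  φ : D.Hom (G.obj M) (L.obj N) 0
  closed : D.d (zero_add 1) φ = 0
  equiv : D.IsHomotopyEquiv φ

variable {G L}

/-- `Homⁱ((M₁, N₁, φ₁), (M₂, N₂, φ₂)) = Bⁱ(M₁, M₂) ⊕ Cⁱ(N₁, N₂) ⊕ Dⁱ⁻¹(G M₁, L N₂)`. -/
abbrev HFPHom (X Y : HFPObj G L) (i : ℤ) : Type :=
  B.Hom X.M Y.M i × C.Hom X.N Y.N i × D.Hom (G.obj X.M) (L.obj Y.N) (i - 1)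

/-- `d (μ, ν, γ) = (dμ, dν, -dγ + φ₂ G(μ) - L(ν) φ₁)`. -/
def hfpD (X Y : HFPObj G L) {p q : ℤ} (h : p + 1 = q) : HFPHom X Y p →ₗ[k] HFPHom X Y q where
  toFun a := (B.d h a.1, C.d h a.2.1,
    - D.d (by omega) a.2.2 + D.comp (by omega) Y.φ (G.map a.1)
      - D.comp (by omega) (L.map a.2.1) X.φ)
  map_add' a b := by
    refine Prod.ext (by simp) (Prod.ext (by simp) ?_)
    simp only [Prod.fst_add, Prod.snd_add, map_add, LinearMap.add_apply]
    abel
  map_smul' c a := by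
    refine Prod.ext (by simp) (Prod.ext (by simp) ?_)
    simp only [Prod.smul_fst, Prod.smul_snd, map_smul, LinearMap.smul_apply, RingHom.id_apply,
      smul_sub, smul_add, smul_neg]

/-- `(μ', ν', γ') (μ, ν, γ) = (μ' μ, ν' ν, γ' G(μ) + (-1)^p L(ν') γ)`, `p` the degree of the
left factor. -/
def hfpComp (X Y Z : HFPObj G L) {p q n : ℤ} (h : p + q = n) :
    HFPHom Y Z p →ₗ[k] HFPHom X Y q →ₗ[k] HFPHom X Z n :=
  LinearMap.mk₂ k
    (fun b a => (B.comp h b.1 a.1, C.comp h b.2.1 a.2.1,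
      D.comp (by omega) b.2.2 (G.map a.1) + sgn p • D.comp (by omega) (L.map b.2.1) a.2.2))
    (fun b b' a => by
      refine Prod.ext (by simp) (Prod.ext (by simp) ?_)
      simp only [Prod.fst_add, Prod.snd_add, map_add, LinearMap.add_apply, smul_add]
      abel)
    (fun c b a => by
      refine Prod.ext (by simp) (Prod.ext (by simp) ?_)
      simp only [Prod.smul_fst, Prod.smul_snd, map_smul, LinearMap.smul_apply, smul_add,
        smul_comm c (sgn p)])
    (fun b a a' => by
      refine Prod.ext (by simp) (Prod.ext (by simp) ?_)
      simp only [Prod.fst_add, Prod.snd_add, map_add, smul_add]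
      abel)
    (fun c b a => by
      refine Prod.ext (by simp) (Prod.ext (by simp) ?_)
      simp only [Prod.smul_fst, Prod.smul_snd, map_smul, smul_add, smul_comm c (sgn p)])

/-- The homotopy fiber product `B ×ʰ_D C` of dg-categories. -/
@[reducible] def hfp (G : Functor B D) (L : Functor C D) : DGCat k where
  Obj := HFPObj G L
  Hom := HFPHom
  d := fun h => hfpD _ _ h
  d_d := by
    intro X Y p q r h h' f
    refine Prod.ext (B.d_d _ _ _) (Prod.ext (C.d_d _ _ _) ?_)
    have h1 := D.d_comp (p := 0) (q := p) (n := q - 1) (p' := 1) (q' := q) (n' := r - 1)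
      (by omega) (by omega) (by omega) (by omega) (by omega) (by omega) Y.φ (G.map f.1)
    have h2 := D.d_comp (p := p) (q := 0) (n := q - 1) (p' := q) (q' := 1) (n' := r - 1)
      (by omega) (by omega) (by omega) (by omega) (by omega) (by omega) (L.map f.2.1) X.φ
    rw [Y.closed, sgn_zero] at h1
    rw [X.closed] at h2
    simp only [map_zero, LinearMap.zero_apply, zero_add, one_smul, smul_zero, add_zero] at h1 h2
    simp only [hfpD, LinearMap.coe_mk, AddHom.coe_mk, map_sub, map_add, map_neg, D.d_d, h1, h2,
      G.map_d, L.map_d, Prod.snd_zero]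
    abel
  one X := (B.one X.M, C.one X.N, 0)
  comp := fun h => hfpComp _ _ _ h
  one_comp := by
    intro X Y p h f
    refine Prod.ext (B.one_comp _ _) (Prod.ext (C.one_comp _ _) ?_)
    simp [hfpComp, L.map_one, D.one_comp, sgn_zero]
  comp_one := by
    intro X Y p h f
    refine Prod.ext (B.comp_one _ _) (Prod.ext (C.comp_one _ _) ?_)
    simp [hfpComp, G.map_one, D.comp_one]
  assoc := by
    intro X Y Z W p q r s t n h₁ h₂ h₃ h₄ f g e
    refine Prod.ext (B.assoc _ _ _ _ _ _ _) (Prod.ext (C.assoc _ _ _ _ _ _ _) ?_)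
    simp only [hfpComp, LinearMap.mk₂_apply, map_add, LinearMap.add_apply, map_zsmul,
      LinearMap.smul_apply, G.map_comp, L.map_comp, smul_add, ← h₁, sgn_add, mul_smul]
    rw [D.assoc (p := p - 1) (q := q) (r := r) (t := t) _ _ (by omega) (by omega),
      D.assoc (p := p) (q := q - 1) (r := r) (t := t - 1) _ _ (by omega) (by omega),
      D.assoc (p := p) (q := q) (r := r - 1) (t := t - 1) _ _ (by omega) (by omega), add_assoc]
  d_comp := by
    intro X Y Z p q n p' q' n' h hp hq hn hl hr g f
    refine Prod.ext (B.d_comp _ _ _ _ _ _ _ _) (Prod.ext (C.d_comp _ _ _ _ _ _ _ _) ?_)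
    have h1 := D.d_comp (p := p - 1) (q := q) (n := n - 1) (p' := p' - 1) (q' := q')
      (n' := n' - 1) (by omega) (by omega) (by omega) (by omega) (by omega) (by omega)
      g.2.2 (G.map f.1)
    have h2 := D.d_comp (p := p) (q := q - 1) (n := n - 1) (p' := p') (q' := q' - 1)
      (n' := n' - 1) (by omega) (by omega) (by omega) (by omega) (by omega) (by omega)
      (L.map g.2.1) f.2.2
    have h3 := D.assoc (p := 0) (q := p) (r := q) (s := p' - 1) (t := n) (n := n' - 1) (by omega)
      (by omega) (by omega) (by omega) Z.φ (G.map g.1) (G.map f.1)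
    have h4 := D.assoc (p := p) (q := q) (r := 0) (s := n) (t := q' - 1) (n := n' - 1) (by omega)
      (by omega) (by omega) (by omega) (L.map g.2.1) (L.map f.2.1) X.φ
    have h5 := D.assoc (p := p) (q := 0) (r := q) (s := p' - 1) (t := q' - 1) (n := n' - 1)
      (by omega) (by omega) (by omega) (by omega) (L.map g.2.1) Y.φ (G.map f.1)
    have e1 : sgn p' = - sgn p := sgn_succ hp
    have e2 : sgn p = - sgn (p - 1) := sgn_succ (by omega)
    have e3 := sgn_mul_self (p - 1)
    change (hfpD X Z hn (hfpComp X Y Z h g f)).2.2 =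
      (hfpComp X Y Z hl (hfpD Y Z hp g) f).2.2 + sgn p • (hfpComp X Y Z hr g (hfpD X Y hq f)).2.2
    simp only [hfpComp, hfpD, LinearMap.mk₂_apply, LinearMap.coe_mk, AddHom.coe_mk, map_add, map_sub, map_neg, LinearMap.add_apply,
      LinearMap.sub_apply, LinearMap.neg_apply, map_zsmul, h1, h2, G.map_comp, L.map_comp,
      G.map_d, L.map_d, ← h3, h4, h5, e1, e2, smul_add, smul_sub, smul_neg, neg_smul, smul_smul,
      neg_mul, e3, one_smul, neg_neg]
    abel

end HomotopyFiberProduct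

end DGCat

end Glue


noncomputable section

namespace Glue

/-- A non-negatively graded dg-algebra `(A = ⨁ᵢ Aⁱ, d)` over `k` (a curved dg-algebra with zero
curvature) whose degree zero part `R = A⁰` is commutative and central, as is the case for Dolbeault
algebras; so right and left `A⁰`-modules are the same. -/
structure DGAlgebra (k : Type) [Field k] where
  R : Type
  A : Type
  [ringR : CommRing R]
  [ringA : Ring A]
  [algkR : Algebra k R]
  [algkA : Algebra k A]
  [algRA : Algebra R A]
  [tower : IsScalarTower k R A]
  /-- `deg i` is the component `Aⁱ`. -/
  deg : ℤ → Submodule R A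
  internal : DirectSum.IsInternal deg
  deg_neg : ∀ i < 0, deg i = ⊥
  algebraMap_injective : Function.Injective (algebraMap R A)
  deg_zero : ∀ a, a ∈ deg 0 ↔ ∃ r, algebraMap R A r = a
  mul_mem : ∀ {i j : ℤ} {a b : A}, a ∈ deg i → b ∈ deg j → a * b ∈ deg (i + j)
  d : A →ₗ[k] A
  d_mem : ∀ {i : ℤ} {a : A}, a ∈ deg i → d a ∈ deg (i + 1)
  leibniz : ∀ {i : ℤ} {a : A} (b : A), a ∈ deg i → d (a * b) = d a * b + sgn i • (a * d b)
  d_d : ∀ a, d (d a) = 0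

attribute [instance] DGAlgebra.ringR DGAlgebra.ringA DGAlgebra.algkR DGAlgebra.algkA
  DGAlgebra.algRA DGAlgebra.tower

variable {k : Type} [Field k]

namespace DGAlgebra

lemma one_mem (A : DGAlgebra k) : (1 : A.A) ∈ A.deg 0 := (A.deg_zero 1).2 ⟨1, map_one _⟩

lemma map_mem (A : DGAlgebra k) (r : A.R) : algebraMap A.R A.A r ∈ A.deg 0 :=
  (A.deg_zero _).2 ⟨r, rfl⟩

lemma d_one (A : DGAlgebra k) : A.d 1 = 0 := by
  have := A.leibniz 1 A.one_mem
  simpa [sgn_zero] using this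

/-- A morphism of (uncurved) dg-algebras; `f₀` is its restriction to the degree zero parts. -/
structure Hom (A B : DGAlgebra k) where
  f₀ : A.R →ₐ[k] B.R
  f : A.A →ₐ[k] B.A
  compat : ∀ r : A.R, f (algebraMap A.R A.A r) = algebraMap B.R B.A (f₀ r)
  map_deg : ∀ {i : ℤ} {a : A.A}, a ∈ A.deg i → f a ∈ B.deg i
  map_d : ∀ a, f (A.d a) = B.d (f a)

lemma Hom.map_smul {A B : DGAlgebra k} (f : Hom A B) (r : A.R) (a : A.A) :
    f.f (r • a) = f.f₀ r • f.f a := by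
  rw [Algebra.smul_def, map_mul, f.compat, ← Algebra.smul_def]

end DGAlgebra

/-- The total module `𝓔 ⊗_{A⁰} A` of a `ℤ`-graded `A⁰`-module `𝓔 = ⨁ₙ Eₙ`. -/
def Tot (A : DGAlgebra k) (E : ℤ → Type) [∀ n, AddCommGroup (E n)]
    [∀ n, Module A.R (E n)] : Type :=
  DirectSum ℤ fun n => E n ⊗[A.R] A.A

namespace Tot

section

variable (A : DGAlgebra k) (E : ℤ → Type) [∀ n, AddCommGroup (E n)] [∀ n, Module A.R (E n)]

instance : AddCommGroup (Tot A E) :=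
  inferInstanceAs (AddCommGroup (DirectSum ℤ fun n => E n ⊗[A.R] A.A))

instance : Module A.R (Tot A E) :=
  inferInstanceAs (Module A.R (DirectSum ℤ fun n => E n ⊗[A.R] A.A))

instance : Module k (Tot A E) := Module.compHom _ (algebraMap k A.R)

lemma smul_eq (c : k) (x : Tot A E) : c • x = algebraMap k A.R c • x := rfl

variable {A E}

/-- The inclusion of the `n`-th summand `Eₙ ⊗ A`. -/
def of (n : ℤ) : E n ⊗[A.R] A.A →+ Tot A E := DirectSum.of (fun n => E n ⊗[A.R] A.A) n

/-- The pure tensor `e ⊗ a`, `e ∈ Eₙ`. -/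
def el (n : ℤ) (e : E n) (a : A.A) : Tot A E := of n (e ⊗ₜ a)

lemma el_add (n : ℤ) (e : E n) (a b : A.A) : el n e (a + b) = el n e a + el n e b := by
  rw [el, TensorProduct.tmul_add, map_add]; rfl

lemma add_el (n : ℤ) (e e' : E n) (a : A.A) : el n (e + e') a = el n e a + el n e' a := by
  rw [el, TensorProduct.add_tmul, map_add]; rfl

lemma el_zero (n : ℤ) (e : E n) : el n e (0 : A.A) = 0 := by
  rw [el, TensorProduct.tmul_zero, map_zero]

lemma zero_el (n : ℤ) (a : A.A) : el n (0 : E n) a = 0 := by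
  rw [el, TensorProduct.zero_tmul, map_zero]

lemma el_zsmul (n : ℤ) (e : E n) (m : ℤ) (a : A.A) : el n e (m • a) = m • el n e a :=
  map_zsmul (AddMonoidHom.mk' (el n e) (el_add n e)) m a

lemma smul_el (n : ℤ) (r : A.R) (e : E n) (a : A.A) : el n (r • e) a = el n e (r • a) := by
  rw [el, TensorProduct.smul_tmul]; rfl

lemma el_smul (n : ℤ) (r : A.R) (e : E n) (a : A.A) : r • el n e a = el n e (r • a) := by
  rw [el, el, TensorProduct.tmul_smul]
  exact ((DirectSum.lof A.R ℤ (fun n => E n ⊗[A.R] A.A) n).map_smul r _).symm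

lemma addHom_ext {G : Type*} [AddCommGroup G] {f g : Tot A E →+ G}
    (h : ∀ n e a, f (el n e a) = g (el n e a)) : f = g := by
  refine DirectSum.addHom_ext (β := fun n => E n ⊗[A.R] A.A) fun n x => ?_
  change f (of n x) = g (of n x)
  induction x using TensorProduct.induction_on with
  | zero => simp
  | tmul e a => exact h n e a
  | add x y hx hy => simp only [map_add, hx, hy]

/-- Extension of biadditive `A⁰`-balanced maps from pure tensors. -/
def lift {G : Type*} [AddCommGroup G] (g : ∀ n, E n →+ A.A →+ G)
    (hg : ∀ n (r : A.R) e a, g n (r • e) a = g n e (r • a)) : Tot A E →+ G :=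
  DirectSum.toAddMonoid fun n => TensorProduct.liftAddHom (g n) (hg n)

@[simp] lemma lift_el {G : Type*} [AddCommGroup G] (g : ∀ n, E n →+ A.A →+ G)
    (hg : ∀ n (r : A.R) e a, g n (r • e) a = g n e (r • a)) (n : ℤ) (e : E n) (a : A.A) :
    lift g hg (el n e a) = g n e a := by
  refine (DirectSum.toAddMonoid_of (β := fun n => E n ⊗[A.R] A.A) _ n (e ⊗ₜ a)).trans ?_
  rw [TensorProduct.liftAddHom_tmul]

/-- Right multiplication `x ↦ x · b` by `b ∈ A`. -/
def rmul (b : A.A) : Tot A E →+ Tot A E :=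
  lift (fun n => AddMonoidHom.mk' (fun e => AddMonoidHom.mk' (fun a => el n e (a * b))
      (fun a a' => by rw [add_mul, el_add]))
      (fun e e' => AddMonoidHom.ext fun a => add_el n e e' (a * b)))
    (fun n r e a => by simp [smul_el])

@[simp] lemma rmul_el (b : A.A) (n : ℤ) (e : E n) (a : A.A) :
    rmul b (el n e a) = el n e (a * b) := by simp [rmul]

lemma rmul_add (b c : A.A) (x : Tot A E) : rmul (b + c) x = rmul b x + rmul c x := by
  have : rmul (b + c) = rmul b + (rmul c : Tot A E →+ Tot A E) :=
    addHom_ext fun n e a => by simp [mul_add, el_add]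
  rw [this]; rfl

lemma rmul_zero (x : Tot A E) : rmul (0 : A.A) x = 0 := by
  have : rmul (0 : A.A) = (0 : Tot A E →+ Tot A E) :=
    addHom_ext fun n e a => by simp [el_zero]
  rw [this]; rfl

lemma rmul_one (x : Tot A E) : rmul (1 : A.A) x = x := by
  have : rmul (1 : A.A) = AddMonoidHom.id (Tot A E) := addHom_ext fun n e a => by simp
  rw [this]; rfl

lemma rmul_rmul (b c : A.A) (x : Tot A E) : rmul c (rmul b x) = rmul (b * c) x := by
  have : (rmul c).comp (rmul b) = (rmul (b * c) : Tot A E →+ Tot A E) :=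
    addHom_ext fun n e a => by simp [mul_assoc]
  exact DFunLike.congr_fun this x

lemma rmul_zsmul (m : ℤ) (b : A.A) (x : Tot A E) : rmul (m • b) x = m • rmul b x :=
  map_zsmul (AddMonoidHom.mk' (fun b => rmul b x) (fun b c => rmul_add b c x)) m b

lemma smul_eq_rmul (r : A.R) (x : Tot A E) : r • x = rmul (algebraMap A.R A.A r) x := by
  have : DistribSMul.toAddMonoidHom (Tot A E) r = rmul (algebraMap A.R A.A r) :=
    addHom_ext fun n e a => by
      rw [rmul_el, DistribSMul.toAddMonoidHom_apply, el_smul, Algebra.smul_def, Algebra.commutes]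
  exact DFunLike.congr_fun this x

lemma csmul_eq_rmul (c : k) (x : Tot A E) : c • x = rmul (algebraMap k A.A c) x := by
  rw [smul_eq, smul_eq_rmul, ← IsScalarTower.algebraMap_apply]

variable (A E) in
/-- The homogeneous elements of total degree `m`: sums of `e ⊗ a`, `e ∈ Eₙ`, `a ∈ Aⁱ`,
`n + i = m`. -/
def deg (m : ℤ) : AddSubgroup (Tot A E) :=
  AddSubgroup.closure {x | ∃ (n i : ℤ) (e : E n) (a : A.A), a ∈ A.deg i ∧ n + i = m ∧ x = el n e a}

lemma el_mem {n i m : ℤ} (e : E n) {a : A.A} (ha : a ∈ A.deg i) (h : n + i = m) :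
    el n e a ∈ deg A E m :=
  AddSubgroup.subset_closure ⟨n, i, e, a, ha, h, rfl⟩

/-- To map `deg m` into a subgroup it suffices to map its generators into it. -/
lemma map_deg_le {G : Type*} [AddCommGroup G] (f : Tot A E →+ G) (K : AddSubgroup G) (m : ℤ)
    (h : ∀ (n i : ℤ) (e : E n) (a : A.A), a ∈ A.deg i → n + i = m → f (el n e a) ∈ K)
    {x : Tot A E} (hx : x ∈ deg A E m) : f x ∈ K := by
  have : deg A E m ≤ K.comap f := by
    rw [deg, AddSubgroup.closure_le]
    rintro _ ⟨n, i, e, a, ha, hm, rfl⟩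
    exact h n i e a ha hm
  exact this hx

lemma rmul_mem {m i m' : ℤ} {b : A.A} (hb : b ∈ A.deg i) (h : m + i = m') {x : Tot A E}
    (hx : x ∈ deg A E m) : rmul b x ∈ deg A E m' := by
  refine map_deg_le (rmul b) _ m (fun n j e a ha hm => ?_) hx
  rw [rmul_el]
  exact el_mem e (A.mul_mem ha hb) (by omega)

/-- The homogeneous elements span. -/
lemma el_induction {p : A.A → Prop} (h0 : p 0) (hadd : ∀ a b, p a → p b → p (a + b))
    (hom : ∀ i, ∀ a ∈ A.deg i, p a) (a : A.A) : p a := by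
  have h : a ∈ ⨆ i, A.deg i := by
    rw [A.internal.submodule_iSup_eq_top]; trivial
  exact Submodule.iSup_induction A.deg (motive := p) h hom h0 hadd

end

section

variable {A : DGAlgebra k} {E : ℤ → Type} [∀ n, AddCommGroup (E n)] [∀ n, Module A.R (E n)]

/-- The Leibniz condition `𝔼(e ⊗ ω) = 𝔼(e ⊗ 1) ω + (-1)^|e| e ⊗ dω` for `e` homogeneous. -/
def IsLeibniz (D : Tot A E → Tot A E) : Prop :=
  ∀ (n : ℤ) (e : E n) (a : A.A), D (el n e a) = rmul a (D (el n e 1)) + sgn n • el n e (A.d a)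

lemma IsLeibniz.rmul {D : Tot A E →+ Tot A E} (hD : IsLeibniz D) {m : ℤ} {x : Tot A E}
    (hx : x ∈ deg A E m) (a : A.A) :
    D (rmul a x) = Tot.rmul a (D x) + sgn m • Tot.rmul (A.d a) x := by
  have := map_deg_le (D.comp (Tot.rmul a) - (Tot.rmul a).comp D - sgn m • Tot.rmul (A.d a)) ⊥ m
    (fun n i e b hb hm => ?_) hx
  · rw [AddSubgroup.mem_bot] at this
    rw [← sub_eq_zero, ← this]
    simp [sub_sub]
  · rw [AddSubgroup.mem_bot]
    simp only [AddMonoidHom.sub_apply, AddMonoidHom.comp_apply, rmul_el, AddMonoidHom.smul_apply]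
    rw [hD n e (b * a), hD n e b, A.leibniz a hb, ← hm, sgn_add]
    simp only [el_add, el_zsmul, map_add, map_zsmul, rmul_el, rmul_rmul, smul_add, mul_smul]
    abel

lemma IsLeibniz.map_smul {D : Tot A E →+ Tot A E} (hD : IsLeibniz D) (c : k) (x : Tot A E) :
    D (c • x) = c • D x := by
  have : D.comp (Tot.rmul (algebraMap k A.A c)) = (Tot.rmul (algebraMap k A.A c)).comp D :=
    addHom_ext fun n e a => by
      have h1 : a * algebraMap k A.A c = c • a := by rw [Algebra.smul_def, Algebra.commutes]
      have h2 : ∀ b : A.A, b * algebraMap k A.A c = c • b := fun b => by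
        rw [Algebra.smul_def, Algebra.commutes]
      simp only [AddMonoidHom.comp_apply, rmul_el]
      rw [hD n e (a * algebraMap k A.A c), hD n e a, h1, _root_.map_smul, map_add, map_zsmul,
        rmul_el, h2, rmul_rmul, h2]
  rw [csmul_eq_rmul, csmul_eq_rmul]
  exact DFunLike.congr_fun this x

end

end Tot

open Tot

/-- A cohesive module over the dg-algebra `A`: a bounded `ℤ`-graded finitely generated projective
`A⁰`-module `𝓔` with a flat `ℤ`-connection `𝔼` on `𝓔 ⊗_{A⁰} A`. -/
structure CohMod (A : DGAlgebra k) where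
  E : ℤ → Type
  [grp : ∀ n, AddCommGroup (E n)]
  [mod : ∀ n, Module A.R (E n)]
  bounded : ∃ N : ℤ, ∀ n, N < |n| → Subsingleton (E n)
  finite : ∀ n, Module.Finite A.R (E n)
  projective : ∀ n, Module.Projective A.R (E n)
  conn : Tot A E →ₗ[k] Tot A E
  conn_mem : ∀ {m : ℤ} {x : Tot A E}, x ∈ Tot.deg A E m → conn x ∈ Tot.deg A E (m + 1)
  leibniz : IsLeibniz conn
  flat : ∀ x, conn (conn x) = 0

attribute [instance] CohMod.grp CohMod.mod CohMod.finite CohMod.projective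

namespace CohMod

variable {A : DGAlgebra k}

/-- `𝓔 ⊗_{A⁰} A`. -/
abbrev T (X : CohMod A) : Type := Tot A X.E

lemma leib (X : CohMod A) {m : ℤ} {x : X.T} (hx : x ∈ Tot.deg A X.E m) (a : A.A) :
    X.conn (rmul a x) = rmul a (X.conn x) + sgn m • rmul (A.d a) x :=
  IsLeibniz.rmul (D := X.conn.toAddMonoidHom) X.leibniz hx a

/-- Morphisms of degree `n`: right `A`-linear maps `𝓔₁ ⊗ A → 𝓔₂ ⊗ A` raising the total degree
by `n`. -/
def hom (X Y : CohMod A) (n : ℤ) : Submodule k (X.T →ₗ[k] Y.T) where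
  carrier := {φ | (∀ a x, φ (rmul a x) = rmul a (φ x)) ∧
    ∀ m x, x ∈ Tot.deg A X.E m → φ x ∈ Tot.deg A Y.E (m + n)}
  zero_mem' := ⟨by simp, fun _ _ _ => by simp [zero_mem]⟩
  add_mem' hf hg := ⟨fun a x => by simp [hf.1, hg.1],
    fun m x hx => by simpa using add_mem (hf.2 m x hx) (hg.2 m x hx)⟩
  smul_mem' c f hf := by
    refine ⟨fun a x => ?_, fun m x hx => ?_⟩
    · simp only [LinearMap.smul_apply, hf.1, csmul_eq_rmul, rmul_rmul, Algebra.commutes]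
    · rw [LinearMap.smul_apply, smul_eq, smul_eq_rmul]
      exact rmul_mem (A.map_mem _) (add_zero _) (hf.2 m x hx)

lemma hom_ext {X Y : CohMod A} {n : ℤ} {f g : hom X Y n}
    (h : ∀ m e, f.1 (el m e 1) = g.1 (el m e 1)) : f = g := by
  apply Subtype.ext
  apply LinearMap.toAddMonoidHom_injective
  refine addHom_ext fun m e a => ?_
  have := rmul_el (1 : A.A) m e (A := A) (E := X.E)
  have h1 : el m e a = rmul a (el m e (1 : A.A)) := by rw [rmul_el, one_mul]
  simp only [LinearMap.toAddMonoidHom_coe]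
  rw [h1, f.2.1, g.2.1, h]

/-- `dφ = 𝔼₂ ∘ φ - (-1)^|φ| φ ∘ 𝔼₁`. -/
def dHom (X Y : CohMod A) {p q : ℤ} (h : p + 1 = q) : hom X Y p →ₗ[k] hom X Y q where
  toFun φ := ⟨Y.conn ∘ₗ φ.1 - sgn p • (φ.1 ∘ₗ X.conn), by
    have hlin : ∀ (m : ℤ) (e : X.E m) (a : A.A),
        (Y.conn ∘ₗ φ.1 - sgn p • (φ.1 ∘ₗ X.conn)) (rmul a (el m e 1)) =
          rmul a ((Y.conn ∘ₗ φ.1 - sgn p • (φ.1 ∘ₗ X.conn)) (el m e 1)) := by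
      intro m e a
      have he : el m e (1 : A.A) ∈ Tot.deg A X.E m := el_mem e A.one_mem (add_zero m)
      simp only [LinearMap.sub_apply, LinearMap.comp_apply, LinearMap.smul_apply, φ.2.1,
        X.leib he, Y.leib (φ.2.2 m _ he), map_add, map_sub, map_zsmul, sgn_add, smul_add, smul_smul,
        mul_comm (sgn p)]
      abel
    refine ⟨fun a x => ?_, fun m x hx => ?_⟩
    · have : (Y.conn ∘ₗ φ.1 - sgn p • (φ.1 ∘ₗ X.conn)).toAddMonoidHom.comp (rmul a) =
          (rmul a).comp (Y.conn ∘ₗ φ.1 - sgn p • (φ.1 ∘ₗ X.conn)).toAddMonoidHom :=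
        addHom_ext fun m e b => by
          have h1 : el m e b = rmul b (el m e (1 : A.A)) := by rw [rmul_el, one_mul]
          simp only [AddMonoidHom.comp_apply, LinearMap.toAddMonoidHom_coe]
          rw [h1, rmul_rmul, hlin, hlin, rmul_rmul]
      exact DFunLike.congr_fun this x
    · rw [LinearMap.sub_apply, LinearMap.smul_apply, LinearMap.comp_apply, LinearMap.comp_apply]
      refine sub_mem ?_ (AddSubgroup.zsmul_mem _ ?_ _)
      · have := Y.conn_mem (φ.2.2 m x hx)
        rwa [add_assoc, h] at this
      · have := φ.2.2 _ _ (X.conn_mem hx)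
        rwa [add_assoc, add_comm 1, h] at this⟩
  map_add' f g := by
    refine Subtype.ext (LinearMap.ext fun x => ?_)
    simp only [Submodule.coe_add, LinearMap.add_apply, LinearMap.sub_apply, LinearMap.comp_apply,
      LinearMap.smul_apply, map_add, smul_add]
    abel
  map_smul' c f := by
    refine Subtype.ext (LinearMap.ext fun x => ?_)
    simp only [SetLike.val_smul, LinearMap.sub_apply, LinearMap.comp_apply,
      LinearMap.smul_apply, map_smul, RingHom.id_apply, smul_sub, smul_comm c (sgn p)]

lemma dHom_apply {X Y : CohMod A} {p q : ℤ} (h : p + 1 = q) (f : hom X Y p) (x : X.T) :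
    (dHom X Y h f).1 x = Y.conn (f.1 x) - sgn p • f.1 (X.conn x) := rfl

/-- Composition of morphisms. -/
def compHom (X Y Z : CohMod A) {p q n : ℤ} (h : p + q = n) :
    hom Y Z p →ₗ[k] hom X Y q →ₗ[k] hom X Z n :=
  LinearMap.mk₂ k
    (fun g f => ⟨g.1 ∘ₗ f.1, fun a x => by simp [f.2.1, g.2.1], fun m x hx => by
      have := g.2.2 _ _ (f.2.2 m x hx)
      rwa [add_assoc, add_comm q, h] at this⟩)
    (fun g g' f => by ext1; exact LinearMap.add_comp _ _ _)
    (fun c g f => by ext1; exact LinearMap.smul_comp _ _ _)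
    (fun g f f' => by ext1; exact LinearMap.comp_add _ _ _)
    (fun c g f => by ext1; exact LinearMap.comp_smul _ _ _)

lemma compHom_apply {X Y Z : CohMod A} {p q n : ℤ} (h : p + q = n) (g : hom Y Z p)
    (f : hom X Y q) (x : X.T) : (compHom X Y Z h g f).1 x = g.1 (f.1 x) := rfl

end CohMod

/-- The dg-category `𝒫_A` of cohesive modules over `A`. -/
@[reducible] def cohCat (A : DGAlgebra k) : DGCat k where
  Obj := CohMod A
  Hom X Y n := CohMod.hom X Y n
  d := fun h => CohMod.dHom _ _ h
  d_d := by
    intro X Y p q r h h' f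
    ext1
    refine LinearMap.ext fun x => ?_
    simp only [CohMod.dHom_apply, map_sub, map_zsmul, X.flat, Y.flat, map_zero,
      sgn_succ h, neg_smul, smul_zero, ZeroMemClass.coe_zero, LinearMap.zero_apply, zero_sub,
      sub_zero, sub_neg_eq_add, neg_add_cancel]
  one X := ⟨LinearMap.id, fun _ _ => rfl, fun m x hx => by simpa using hx⟩
  comp := fun h => CohMod.compHom _ _ _ h
  one_comp := fun _ _ => rfl
  comp_one := fun _ _ => rfl
  assoc := fun _ _ _ _ _ _ _ => rfl
  d_comp := by
    intro X Y Z p q n p' q' n' h hp hq hn hl hr g f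
    ext1
    refine LinearMap.ext fun x => ?_
    change (CohMod.dHom X Z hn (CohMod.compHom X Y Z h g f)).1 x =
      (CohMod.compHom X Y Z hl (CohMod.dHom Y Z hp g) f).1 x +
        sgn p • (CohMod.compHom X Y Z hr g (CohMod.dHom X Y hq f)).1 x
    simp only [CohMod.dHom_apply, CohMod.compHom_apply, map_sub, map_zsmul, ← h, sgn_add, smul_sub,
      mul_smul]
    abel

/-! ### Pullback of cohesive modules along a morphism of dg-algebras -/

/-- The ring `S`, regarded as an `R`-algebra via `f : R → S`. -/
def Via {R S : Type} [CommRing R] [CommRing S] (_ : R →+* S) : Type := S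

instance {R S : Type} [CommRing R] [CommRing S] (f : R →+* S) : CommRing (Via f) :=
  inferInstanceAs (CommRing S)

instance {R S : Type} [CommRing R] [CommRing S] (f : R →+* S) : Algebra R (Via f) := f.toAlgebra

/-- Extension of scalars `S ⊗_R M` along a ring homomorphism `f : R → S`. -/
def ExtS {R S : Type} [CommRing R] [CommRing S] (f : R →+* S) (M : Type) [AddCommGroup M]
    [Module R M] : Type :=
  Via f ⊗[R] M

namespace ExtS

variable {R S : Type} [CommRing R] [CommRing S] (f : R →+* S) (M : Type) [AddCommGroup M]
  [Module R M]

instance : AddCommGroup (ExtS f M) := inferInstanceAs (AddCommGroup (Via f ⊗[R] M))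

instance : Module S (ExtS f M) := inferInstanceAs (Module (Via f) (Via f ⊗[R] M))

instance [Module.Finite R M] : Module.Finite S (ExtS f M) :=
  inferInstanceAs (Module.Finite (Via f) (Via f ⊗[R] M))

instance [Module.Projective R M] : Module.Projective S (ExtS f M) :=
  inferInstanceAs (Module.Projective (Via f) (Via f ⊗[R] M))

instance [Subsingleton M] : Subsingleton (ExtS f M) :=
  inferInstanceAs (Subsingleton (Via f ⊗[R] M))

variable {M}

/-- The pure tensor `s ⊗ m`. -/
def tm (s : S) (m : M) : ExtS f M := TensorProduct.tmul R (M := Via f) s m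

lemma add_tm (s s' : S) (m : M) : tm f (s + s') m = tm f s m + tm f s' m :=
  TensorProduct.add_tmul (M := Via f) s s' m

lemma tm_add (s : S) (m m' : M) : tm f s (m + m') = tm f s m + tm f s m' :=
  TensorProduct.tmul_add (M := Via f) s m m'

lemma smul_tm (t s : S) (m : M) : t • tm f s m = tm f (t * s) m :=
  TensorProduct.smul_tmul' (R' := Via f) (M := Via f) t s m

lemma tm_smul (s : S) (r : R) (m : M) : tm f s (r • m) = tm f (s * f r) m := by
  refine (TensorProduct.smul_tmul (M := Via f) r s m).symm.trans ?_
  have : r • (show Via f from s) = (s * f r : S) :=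
    (Algebra.smul_def r (show Via f from s)).trans (mul_comm (f r) s)
  exact congrArg (fun t : Via f => TensorProduct.tmul R t m) this

lemma addHom_ext {G : Type*} [AddCommGroup G] {g h : ExtS f M →+ G}
    (H : ∀ s m, g (tm f s m) = h (tm f s m)) : g = h :=
  AddMonoidHom.ext fun x => by
    induction x using TensorProduct.induction_on with
    | zero => exact (map_zero g).trans (map_zero h).symm
    | tmul s m => exact H s m
    | add x y hx hy =>
      exact (map_add g x y).trans ((congrArg₂ (· + ·) hx hy).trans (map_add h x y).symm)

/-- Extension of biadditive balanced maps from pure tensors. -/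
def lift {G : Type*} [AddCommGroup G] (g : S →+ M →+ G)
    (hg : ∀ r s m, g (s * f r) m = g s (r • m)) : ExtS f M →+ G :=
  TensorProduct.liftAddHom (R := R) (M := Via f) g (fun r s m =>
    (congrArg (fun t => g t m) ((Algebra.smul_def r s).trans (mul_comm (f r) s))).trans (hg r s m))

@[simp] lemma lift_tm {G : Type*} [AddCommGroup G] (g : S →+ M →+ G)
    (hg : ∀ r s m, g (s * f r) m = g s (r • m)) (s : S) (m : M) :
    lift f g hg (tm f s m) = g s m := rfl

end ExtS

namespace DGAlgebra.Hom

open ExtS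

variable {A B : DGAlgebra k} (f : Hom A B) {E E' : ℤ → Type} [∀ n, AddCommGroup (E n)]
  [∀ n, Module A.R (E n)] [∀ n, AddCommGroup (E' n)] [∀ n, Module A.R (E' n)]

variable (E) in
/-- The graded module `𝓔 ⊗_{A⁰} B⁰`. -/
abbrev pullE (n : ℤ) : Type := ExtS (f.f₀ : A.R →+* B.R) (E n)

/-- `1 ⊗ e`. -/
def inc {n : ℤ} (e : E n) : f.pullE E n := tm (f.f₀ : A.R →+* B.R) 1 e

lemma tm_eq {n : ℤ} (s : B.R) (e : E n) : (tm (f.f₀ : A.R →+* B.R) s e : f.pullE E n) = s • f.inc e := by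
  rw [inc, smul_tm, mul_one]

lemma inc_smul {n : ℤ} (r : A.R) (e : E n) : f.inc (r • e) = f.f₀ r • f.inc e := by
  rw [← tm_eq, inc, tm_smul, one_mul]; rfl

lemma inc_add {n : ℤ} (e e' : E n) : f.inc (e + e') = f.inc e + f.inc e' := tm_add _ _ _ _

lemma el_tm {n : ℤ} (s : B.R) (e : E n) (b : B.A) :
    (el n (tm (f.f₀ : A.R →+* B.R) s e) b : Tot B (f.pullE E)) = el n (f.inc e) (s • b) := by
  rw [tm_eq, smul_el]

lemma pull_ext {G : Type*} [AddCommGroup G] {g h : Tot B (f.pullE E) →+ G}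
    (H : ∀ n e b, g (el n (f.inc e) b) = h (el n (f.inc e) b)) : g = h := by
  refine Tot.addHom_ext fun n x b => ?_
  have : g.comp (AddMonoidHom.mk' (fun x => el n x b) (fun x y => add_el n x y b)) =
      h.comp (AddMonoidHom.mk' (fun x => el n x b) (fun x y => add_el n x y b)) := by
    refine ExtS.addHom_ext _ fun s e => ?_
    simp only [AddMonoidHom.comp_apply, AddMonoidHom.mk'_apply, el_tm]
    exact H n e _
  exact DFunLike.congr_fun this x

/-- Auxiliary to `pullLift`. -/
def pullLiftAux {G : Type*} [AddCommGroup G] {n : ℤ} (g : E n →+ B.A →+ G)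
    (hg : ∀ (r : A.R) e b, g (r • e) b = g e (f.f₀ r • b)) : f.pullE E n →+ B.A →+ G :=
  ExtS.lift _
    (AddMonoidHom.mk' (fun s : B.R => AddMonoidHom.mk'
        (fun e => (g e).comp (DistribSMul.toAddMonoidHom B.A s))
        (fun e e' => AddMonoidHom.ext fun b => by simp))
      (fun s s' => AddMonoidHom.ext fun e => AddMonoidHom.ext fun b => by simp [add_smul]))
    (fun r s e => AddMonoidHom.ext fun b => by simp [hg, smul_smul, mul_comm s])

lemma pullLiftAux_tm {G : Type*} [AddCommGroup G] {n : ℤ} (g : E n →+ B.A →+ G)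
    (hg : ∀ (r : A.R) e b, g (r • e) b = g e (f.f₀ r • b)) (s : B.R) (e : E n) (b : B.A) :
    f.pullLiftAux g hg (tm _ s e) b = g e (s • b) := rfl

lemma pullLiftAux_smul {G : Type*} [AddCommGroup G] {n : ℤ} (g : E n →+ B.A →+ G)
    (hg : ∀ (r : A.R) e b, g (r • e) b = g e (f.f₀ r • b)) (t : B.R) (x : f.pullE E n) (b : B.A) :
    f.pullLiftAux g hg (t • x) b = f.pullLiftAux g hg x (t • b) := by
  have : (((AddMonoidHom.eval b).comp (f.pullLiftAux g hg)).comp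
        (DistribSMul.toAddMonoidHom _ t)) =
      (AddMonoidHom.eval (t • b)).comp (f.pullLiftAux g hg) := by
    refine ExtS.addHom_ext _ fun s e => ?_
    simp only [AddMonoidHom.comp_apply, DistribSMul.toAddMonoidHom_apply, smul_tm,
      AddMonoidHom.eval_apply_apply, pullLiftAux_tm, smul_smul, mul_comm t]
  exact DFunLike.congr_fun this x

/-- Extension of biadditive maps from the elements `(1 ⊗ e) ⊗ b`. -/
def pullLift {G : Type*} [AddCommGroup G] (g : ∀ n, E n →+ B.A →+ G)
    (hg : ∀ n (r : A.R) e b, g n (r • e) b = g n e (f.f₀ r • b)) : Tot B (f.pullE E) →+ G :=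
  Tot.lift (fun n => f.pullLiftAux (g n) (hg n)) (fun n => f.pullLiftAux_smul (g n) (hg n))

@[simp] lemma pullLift_el {G : Type*} [AddCommGroup G] (g : ∀ n, E n →+ B.A →+ G)
    (hg : ∀ n (r : A.R) e b, g n (r • e) b = g n e (f.f₀ r • b)) (n : ℤ) (e : E n) (b : B.A) :
    f.pullLift g hg (el n (f.inc e) b) = g n e b := by
  refine (lift_el _ _ n _ b).trans ?_
  rw [inc, pullLiftAux_tm, one_smul]

/-- The map `𝓔 ⊗_{A⁰} A → (𝓔 ⊗_{A⁰} B⁰) ⊗_{B⁰} B`, `e ⊗ a ↦ (1 ⊗ e) ⊗ f(a)`. -/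
def j : Tot A E →+ Tot B (f.pullE E) :=
  Tot.lift (fun n => AddMonoidHom.mk' (fun e => AddMonoidHom.mk'
      (fun a => el n (f.inc e) (f.f a))
      (fun a b => by rw [map_add, el_add]))
      (fun e e' => AddMonoidHom.ext fun a => by simp [inc_add, add_el]))
    (fun n r e a => by simp [inc_smul, smul_el, f.map_smul])

@[simp] lemma j_el (n : ℤ) (e : E n) (a : A.A) : f.j (el n e a) = el n (f.inc e) (f.f a) := by
  simp [j]

lemma j_rmul (a : A.A) (x : Tot A E) : f.j (rmul a x) = rmul (f.f a) (f.j x) := by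
  have : f.j.comp (rmul a) = (rmul (f.f a)).comp (f.j (E := E)) :=
    Tot.addHom_ext fun n e b => by simp
  exact DFunLike.congr_fun this x

lemma j_mem {m : ℤ} {x : Tot A E} (hx : x ∈ Tot.deg A E m) :
    f.j x ∈ Tot.deg B (f.pullE E) m :=
  map_deg_le f.j _ m (fun n i e a ha hm => by rw [j_el]; exact el_mem _ (f.map_deg ha) hm) hx

lemma j_smul (c : k) (x : Tot A E) : f.j (c • x) = c • f.j x := by
  rw [csmul_eq_rmul, csmul_eq_rmul, j_rmul, AlgHom.commutes]

/-- The pullback of a `ℤ`-connection, determined by `1 ⊗ e ↦ 𝔼(e)` and the Leibniz rule. -/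
def pullConn (D : Tot A E →ₗ[k] Tot A E) (hD : IsLeibniz D) :
    Tot B (f.pullE E) →+ Tot B (f.pullE E) :=
  f.pullLift (fun n => AddMonoidHom.mk' (fun e => AddMonoidHom.mk'
      (fun b => rmul b (f.j (D (el n e 1))) + sgn n • el n (f.inc e) (B.d b))
      (fun b b' => by rw [rmul_add, map_add, el_add, smul_add]; abel))
      (fun e e' => AddMonoidHom.ext fun b => by
        simp only [AddMonoidHom.mk'_apply, AddMonoidHom.add_apply, add_el, inc_add, map_add,
          smul_add]
        abel))
    (fun n r e b => by
      have h1 : (f.f₀ r) • b = f.f (r • (1 : A.A)) * b := by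
        rw [f.map_smul, map_one, smul_mul_assoc, one_mul]
      have h2 : r • (1 : A.A) ∈ A.deg 0 := (A.deg 0).smul_mem r A.one_mem
      have h3 := B.leibniz b (f.map_deg h2)
      simp only [AddMonoidHom.mk'_apply, smul_el, inc_smul]
      rw [hD n e (r • 1), map_add, j_rmul, map_add, rmul_rmul, map_zsmul, map_zsmul, j_el, rmul_el,
        h1, h3, el_add, sgn_zero, one_smul, smul_add, f.map_d, f.map_smul, map_one, smul_mul_assoc,
        one_mul, smul_mul_assoc, one_mul, add_assoc])

@[simp] lemma pullConn_el (D : Tot A E →ₗ[k] Tot A E) (hD : IsLeibniz D) (n : ℤ) (e : E n) (b : B.A) :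
    f.pullConn D hD (el n (f.inc e) b) =
      rmul b (f.j (D (el n e 1))) + sgn n • el n (f.inc e) (B.d b) := by
  simp [pullConn]

lemma pullConn_leibniz (D : Tot A E →ₗ[k] Tot A E) (hD : IsLeibniz D) :
    IsLeibniz (f.pullConn D hD) := by
  intro n x b
  have : (f.pullConn D hD).comp (AddMonoidHom.mk' (fun x => el n x b)
        (fun x y => add_el n x y b)) =
      AddMonoidHom.mk' (fun x => rmul b (f.pullConn D hD (el n x 1)) + sgn n • el n x (B.d b))
        (fun x y => by simp only [add_el, map_add, smul_add]; abel) := by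
    refine ExtS.addHom_ext _ fun s e => ?_
    have h1 : s • b = (s • (1 : B.A)) * b := by rw [smul_mul_assoc, one_mul]
    have h2 : s • (1 : B.A) ∈ B.deg 0 := (B.deg 0).smul_mem s B.one_mem
    simp only [AddMonoidHom.comp_apply, AddMonoidHom.mk'_apply, el_tm, pullConn_el]
    rw [h1, B.leibniz b h2, map_add, rmul_rmul, map_zsmul, rmul_el, el_add, smul_add, sgn_zero,
      one_smul, smul_mul_assoc, one_mul, smul_mul_assoc, one_mul, add_assoc]
  exact DFunLike.congr_fun this x

lemma pullConn_j (D : Tot A E →ₗ[k] Tot A E) (hD : IsLeibniz D) (x : Tot A E) :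
    f.pullConn D hD (f.j x) = f.j (D x) := by
  have : (f.pullConn D hD).comp f.j = f.j.comp D.toAddMonoidHom := Tot.addHom_ext fun n e a => by
    simp only [AddMonoidHom.comp_apply, j_el, pullConn_el, LinearMap.toAddMonoidHom_coe]
    rw [hD n e a, map_add, j_rmul, map_zsmul, j_el, f.map_d]
  exact DFunLike.congr_fun this x

/-- To check that `x ⊗ b` is mapped into a subgroup it suffices to consider `x = s ⊗ e`. -/
lemma mem_of_tm {G : Type*} [AddCommGroup G] (g : Tot B (f.pullE E) →+ G) {n : ℤ} (b : B.A)
    (K : AddSubgroup G) (h : ∀ s (e : E n), g (el n (tm (f.f₀ : A.R →+* B.R) s e) b) ∈ K)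
    (y : f.pullE E n) : g (el n y b) ∈ K := by
  have : ((QuotientAddGroup.mk' K).comp
      (AddMonoidHom.mk' (fun x => g (el n x b)) (fun x y => by simp only [add_el, map_add]))) =
        (0 : f.pullE E n →+ _) := by
    refine ExtS.addHom_ext _ fun s e => ?_
    exact (QuotientAddGroup.eq_zero_iff _).2 (h s e)
  exact (QuotientAddGroup.eq_zero_iff _).1 (DFunLike.congr_fun this y)

lemma pullConn_mem (D : Tot A E →ₗ[k] Tot A E) (hD : IsLeibniz D)
    (h : ∀ {m x}, x ∈ Tot.deg A E m → D x ∈ Tot.deg A E (m + 1)) {m : ℤ}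
    {x : Tot B (f.pullE E)} (hx : x ∈ Tot.deg B (f.pullE E) m) :
    f.pullConn D hD x ∈ Tot.deg B (f.pullE E) (m + 1) := by
  refine map_deg_le _ _ m (fun n i y b hb hm => ?_) hx
  refine f.mem_of_tm (f.pullConn D hD) b _ (fun s e => ?_) y
  have hb' : s • b ∈ B.deg i := (B.deg i).smul_mem s hb
  rw [el_tm, pullConn_el]
  exact add_mem (rmul_mem hb' (by omega) (f.j_mem (h (el_mem e A.one_mem (add_zero n)))))
    (AddSubgroup.zsmul_mem _ (el_mem _ (B.d_mem hb') (by omega)) _)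

/-- The `B`-linear extension of `1 ⊗ e ↦ φ(e)`. -/
def pullMap (φ : Tot A E →ₗ[k] Tot A E') (hφ : ∀ a x, φ (rmul a x) = rmul a (φ x)) :
    Tot B (f.pullE E) →+ Tot B (f.pullE E') :=
  f.pullLift (fun n => AddMonoidHom.mk' (fun e => AddMonoidHom.mk'
      (fun b => rmul b (f.j (φ (el n e 1))))
      (fun b b' => by rw [rmul_add]))
      (fun e e' => AddMonoidHom.ext fun b => by
        simp only [AddMonoidHom.mk'_apply, AddMonoidHom.add_apply, add_el, map_add]))
    (fun n r e b => by
      have h : el n (r • e) (1 : A.A) = rmul (r • (1 : A.A)) (el n e 1) := by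
        rw [smul_el, rmul_el, one_mul]
      simp only [AddMonoidHom.mk'_apply]
      rw [h, hφ, j_rmul, rmul_rmul, f.map_smul, map_one, smul_mul_assoc, one_mul])

section

variable (φ : Tot A E →ₗ[k] Tot A E') (hφ : ∀ a x, φ (rmul a x) = rmul a (φ x))

lemma pullMap_el (n : ℤ) (e : E n) (b : B.A) :
    f.pullMap φ hφ (el n (f.inc e) b) = rmul b (f.j (φ (el n e 1))) := by
  simp [pullMap]

lemma pullMap_j (x : Tot A E) : f.pullMap φ hφ (f.j x) = f.j (φ x) := by
  have : (f.pullMap φ hφ).comp f.j = f.j.comp φ.toAddMonoidHom := Tot.addHom_ext fun n e a => by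
    have h : el n e a = rmul a (el n e (1 : A.A)) := by rw [rmul_el, one_mul]
    simp only [AddMonoidHom.comp_apply, LinearMap.toAddMonoidHom_coe]
    rw [j_el, pullMap_el, h, hφ, j_rmul]
  exact DFunLike.congr_fun this x

lemma pullMap_rmul (b : B.A) (x : Tot B (f.pullE E)) :
    f.pullMap φ hφ (rmul b x) = rmul b (f.pullMap φ hφ x) := by
  have : (f.pullMap φ hφ).comp (rmul b) = (rmul b).comp (f.pullMap φ hφ) :=
    f.pull_ext fun n e c => by
      simp only [AddMonoidHom.comp_apply, rmul_el, pullMap_el, rmul_rmul]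
  exact DFunLike.congr_fun this x

lemma pullMap_mem {p : ℤ} (hd : ∀ m x, x ∈ Tot.deg A E m → φ x ∈ Tot.deg A E' (m + p)) {m : ℤ}
    {x : Tot B (f.pullE E)} (hx : x ∈ Tot.deg B (f.pullE E) m) :
    f.pullMap φ hφ x ∈ Tot.deg B (f.pullE E') (m + p) := by
  refine map_deg_le _ _ m (fun n i y b hb hm => ?_) hx
  refine f.mem_of_tm (f.pullMap φ hφ) b _ (fun s e => ?_) y
  rw [el_tm, pullMap_el]
  exact rmul_mem ((B.deg i).smul_mem s hb) (by omega)
    (f.j_mem (hd n _ (el_mem e A.one_mem (add_zero n))))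

/-- The pullback of a right linear map, as a `k`-linear map. -/
def pullLin : Tot B (f.pullE E) →ₗ[k] Tot B (f.pullE E') where
  toFun := f.pullMap φ hφ
  map_add' := map_add _
  map_smul' c x := by rw [csmul_eq_rmul, pullMap_rmul, ← csmul_eq_rmul, RingHom.id_apply]

lemma lin_ext {φ ψ : Tot B (f.pullE E) →ₗ[k] Tot B (f.pullE E')}
    (hφ : ∀ a x, φ (rmul a x) = rmul a (φ x)) (hψ : ∀ a x, ψ (rmul a x) = rmul a (ψ x))
    (h : ∀ m e, φ (f.j (el m e 1)) = ψ (f.j (el m e 1))) : φ = ψ := by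
  apply LinearMap.toAddMonoidHom_injective
  refine f.pull_ext fun m e b => ?_
  have h1 : el m (f.inc e) b = rmul b (f.j (el m e 1)) := by
    rw [j_el, map_one, rmul_el, one_mul]
  simp only [LinearMap.toAddMonoidHom_coe]
  rw [h1, hφ, hψ, h]

end

end DGAlgebra.Hom

open DGAlgebra.Hom

/-- The pullback `f^* (𝓔, 𝔼) = (𝓔 ⊗_{A⁰} B⁰, 𝔼_B)`. -/
@[reducible] def CohMod.pull {A B : DGAlgebra k} (f : DGAlgebra.Hom A B) (X : CohMod A) : CohMod B where
  E := f.pullE X.E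
  bounded := by
    obtain ⟨N, hN⟩ := X.bounded
    exact ⟨N, fun n hn => by have := hN n hn; infer_instance⟩
  finite n := inferInstance
  projective n := inferInstance
  conn :=
    { toFun := f.pullConn X.conn X.leibniz
      map_add' := map_add _
      map_smul' := (f.pullConn_leibniz _ X.leibniz).map_smul }
  conn_mem := f.pullConn_mem _ X.leibniz X.conn_mem
  leibniz := f.pullConn_leibniz _ X.leibniz
  flat x := by
    have : (f.pullConn X.conn X.leibniz).comp
        (f.pullConn X.conn X.leibniz) = 0 := by
      refine f.pull_ext fun n e b => ?_
      have hx : el n e (1 : A.A) ∈ Tot.deg A X.E n := el_mem e A.one_mem (add_zero n)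
      have h1 : el n (f.inc e) b = rmul b (f.j (el n e 1)) := by
        rw [j_el, map_one, rmul_el, one_mul]
      have hL := f.pullConn_leibniz _ X.leibniz
      have h2 : X.conn (X.conn (el n e 1)) = 0 := X.flat _
      simp only [AddMonoidHom.comp_apply, AddMonoidHom.zero_apply, h1]
      rw [hL.rmul (f.j_mem hx), map_add, map_zsmul, pullConn_j,
        hL.rmul (f.j_mem (X.conn_mem hx)), hL.rmul (f.j_mem hx), pullConn_j, pullConn_j, B.d_d,
        rmul_zero, h2, map_zero, map_zero, smul_zero, add_zero, zero_add, sgn_succ rfl, neg_smul]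
      exact neg_add_cancel _
    exact DFunLike.congr_fun this x

namespace CohMod

open DGAlgebra.Hom

variable {A B : DGAlgebra k} (f : DGAlgebra.Hom A B)

lemma pull_conn_j (X : CohMod A) (x : X.T) : (X.pull f).conn (f.j x) = f.j (X.conn x) :=
  f.pullConn_j _ X.leibniz x

lemma pull_hom_ext {X Y : CohMod A} {n : ℤ} {φ ψ : hom (X.pull f) (Y.pull f) n}
    (h : ∀ m e, φ.1 (f.j (el m e 1)) = ψ.1 (f.j (el m e 1))) : φ = ψ :=
  Subtype.ext (f.lin_ext φ.2.1 ψ.2.1 h)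

/-- The pullback `f^* φ` of a morphism. -/
def pullHom {X Y : CohMod A} {n : ℤ} : hom X Y n →ₗ[k] hom (X.pull f) (Y.pull f) n where
  toFun φ := ⟨f.pullLin φ.1 φ.2.1, f.pullMap_rmul φ.1 φ.2.1, fun _ _ hx =>
    f.pullMap_mem φ.1 φ.2.1 φ.2.2 hx⟩
  map_add' φ ψ := pull_hom_ext f fun _ _ =>
    (f.pullMap_j _ (φ + ψ).2.1 _).trans ((map_add f.j _ _).trans
      (congrArg₂ (· + ·) (f.pullMap_j φ.1 φ.2.1 _).symm (f.pullMap_j ψ.1 ψ.2.1 _).symm))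
  map_smul' c φ := pull_hom_ext f fun _ _ =>
    (f.pullMap_j _ (c • φ).2.1 _).trans ((f.j_smul c _).trans
      (congrArg (c • ·) (f.pullMap_j φ.1 φ.2.1 _).symm))

lemma pullHom_j {X Y : CohMod A} {n : ℤ} (φ : hom X Y n) (x : X.T) :
    (pullHom f φ).1 (f.j x) = f.j (φ.1 x) := f.pullMap_j φ.1 φ.2.1 x

lemma pullHom_d {X Y : CohMod A} {p q : ℤ} (h : p + 1 = q) (φ : hom X Y p) :
    pullHom f (dHom X Y h φ) = dHom (X.pull f) (Y.pull f) h (pullHom f φ) :=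
  pull_hom_ext f fun m e => by
    rw [pullHom_j, dHom_apply, dHom_apply, pullHom_j, pull_conn_j, pull_conn_j, pullHom_j, map_sub,
      map_zsmul]

lemma pullHom_comp {X Y Z : CohMod A} {p q n : ℤ} (h : p + q = n) (ψ : hom Y Z p)
    (φ : hom X Y q) :
    pullHom f (compHom X Y Z h ψ φ) =
      compHom (X.pull f) (Y.pull f) (Z.pull f) h (pullHom f ψ) (pullHom f φ) :=
  pull_hom_ext f fun m e => by
    rw [pullHom_j, compHom_apply, compHom_apply, pullHom_j, pullHom_j]

lemma pullHom_one (X : CohMod A) :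
    pullHom f (show hom X X 0 from (cohCat A).one X) = (cohCat B).one (X.pull f) :=
  pull_hom_ext f fun _ _ => pullHom_j f (show hom X X 0 from (cohCat A).one X) _

/-- The dg-functor `f^* : 𝒫_A → 𝒫_B`. -/
@[reducible] def pullFunctor : DGCat.Functor (cohCat A) (cohCat B) where
  obj := CohMod.pull f
  map := pullHom f
  map_d := pullHom_d f
  map_one := pullHom_one f
  map_comp := pullHom_comp f

end CohMod


/-! ### Cohesive modules of rank one -/

/-- A trivialization of a cohesive module: an isomorphism of `𝓔 ⊗_{A⁰} A` with the right dg-module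
`A`. -/
structure CohMod.Triv {A : DGAlgebra k} (X : CohMod A) where
  val : X.T ≃ₗ[k] A.A
  val_rmul : ∀ a x, val (rmul a x) = val x * a
  val_mem : ∀ {m : ℤ} {x : X.T}, x ∈ Tot.deg A X.E m → val x ∈ A.deg m
  symm_mem : ∀ {m : ℤ} {a : A.A}, a ∈ A.deg m → val.symm a ∈ Tot.deg A X.E m
  val_conn : ∀ x, val (X.conn x) = A.d (val x)

namespace CohMod.Triv

variable {A : DGAlgebra k} {X Y Z : CohMod A}

lemma symm_rmul (s : X.Triv) (a b : A.A) : rmul b (s.val.symm a) = s.val.symm (a * b) := by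
  apply s.val.injective
  rw [s.val_rmul, LinearEquiv.apply_symm_apply, LinearEquiv.apply_symm_apply]

lemma symm_conn (s : X.Triv) (a : A.A) : X.conn (s.val.symm a) = s.val.symm (A.d a) := by
  apply s.val.injective
  rw [s.val_conn, LinearEquiv.apply_symm_apply, LinearEquiv.apply_symm_apply]

/-- Left multiplication by `a ∈ Aⁿ`, as a morphism of degree `n` between trivialized cohesive
modules. -/
def mul (s : X.Triv) (t : Y.Triv) (n : ℤ) : A.deg n →ₗ[k] hom X Y n where
  toFun a := ⟨t.val.symm.toLinearMap ∘ₗ LinearMap.mulLeft k a.1 ∘ₗ s.val.toLinearMap,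
    fun b x => by simp [s.val_rmul, symm_rmul, mul_assoc],
    fun m x hx => by
      have h := A.mul_mem a.2 (s.val_mem hx)
      rw [add_comm] at h
      exact t.symm_mem h⟩
  map_add' a b := by
    refine Subtype.ext (LinearMap.ext fun x => ?_)
    simp [add_mul]
  map_smul' c a := by
    refine Subtype.ext (LinearMap.ext fun x => ?_)
    simp

lemma mul_apply (s : X.Triv) (t : Y.Triv) (n : ℤ) (a : A.deg n) (x : X.T) :
    (mul s t n a).1 x = t.val.symm (a.1 * s.val x) := rfl

lemma tot_ext {G : Type*} [AddCommGroup G] {f g : X.T →+ G}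
    (h : ∀ m x, x ∈ Tot.deg A X.E m → f x = g x) : f = g :=
  Tot.addHom_ext fun n e a => by
    refine Tot.el_induction (A := A) (p := fun a => f (el n e a) = g (el n e a)) ?_ ?_ ?_ a
    · rw [el_zero, map_zero, map_zero]
    · intro a b ha hb
      rw [el_add, map_add, map_add, ha, hb]
    · intro i a ha
      exact h (n + i) _ (el_mem e ha rfl)

lemma mul_d (s : X.Triv) (t : Y.Triv) {p q : ℤ} (h : p + 1 = q) (a : A.deg p) (b : A.deg q)
    (hab : A.d a.1 = b.1) : dHom X Y h (mul s t p a) = mul s t q b := by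
  refine Subtype.ext (LinearMap.ext fun x => ?_)
  rw [dHom_apply, mul_apply, mul_apply, mul_apply, symm_conn, A.leibniz _ a.2, s.val_conn, hab,
    map_add, map_zsmul, add_sub_cancel_right]

lemma mul_comp (s : X.Triv) (t : Y.Triv) (u : Z.Triv) {p q n : ℤ} (h : p + q = n)
    (a : A.deg p) (b : A.deg q) (c : A.deg n) (hc : a.1 * b.1 = c.1) :
    compHom X Y Z h (mul t u p a) (mul s t q b) = mul s u n c := by
  refine Subtype.ext (LinearMap.ext fun x => ?_)
  rw [compHom_apply, mul_apply, mul_apply, mul_apply, LinearEquiv.apply_symm_apply, ← hc, mul_assoc]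

lemma mul_one (s : X.Triv) (c : A.deg 0) (hc : c.1 = 1) : mul s s 0 c = (cohCat A).one X := by
  refine Subtype.ext (LinearMap.ext fun x => ?_)
  rw [mul_apply, hc, _root_.one_mul, LinearEquiv.symm_apply_apply]
  rfl

/-- Multiplication by a closed invertible element of `A⁰` with closed inverse is a homotopy
equivalence. -/
lemma mul_isHomotopyEquiv (s : X.Triv) (t : Y.Triv) (a b : A.deg 0) (hb : A.d b.1 = 0)
    (hab : a.1 * b.1 = 1) (hba : b.1 * a.1 = 1) :
    (cohCat A).IsHomotopyEquiv (x := X) (y := Y) (mul s t 0 a) := by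
  have h1 : (1 : A.A) ∈ A.deg 0 := A.one_mem
  have h2 : dHom Y X (zero_add 1) (mul t s 0 b) = 0 :=
    (mul_d t s (zero_add 1) b 0 (by simpa using hb)).trans (map_zero (mul t s 1))
  exact DGCat.isHomotopyEquiv_of_inv (C := cohCat A) (x := X) (y := Y) (mul s t 0 a)
    (mul t s 0 b) h2
    ((mul_comp s t s (add_zero 0) b a ⟨1, h1⟩ hba).trans (mul_one s _ rfl))
    ((mul_comp t s t (add_zero 0) a b ⟨1, h1⟩ hab).trans (mul_one t _ rfl))

section Pull

variable {B : DGAlgebra k} (f : DGAlgebra.Hom A B) (s : X.Triv)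

/-- Auxiliary to `pull`: `(1 ⊗ e) ⊗ b ↦ f(s(e)) b`. -/
def pullVal : Tot B (f.pullE X.E) →+ B.A :=
  f.pullLift (fun n => AddMonoidHom.mk' (fun e => AddMonoidHom.mk'
      (fun b => f.f (s.val (el n e 1)) * b) (fun b b' => mul_add _ b b'))
      (fun e e' => AddMonoidHom.ext fun b => by
        simp only [AddMonoidHom.mk'_apply, AddMonoidHom.add_apply, add_el, map_add, add_mul]))
    (fun n r e b => by
      have h : el n (r • e) (1 : A.A) = rmul (r • (1 : A.A)) (el n e 1) := by
        rw [smul_el, rmul_el, _root_.one_mul]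
      simp only [AddMonoidHom.mk'_apply]
      rw [h, s.val_rmul, map_mul, f.map_smul, map_one, mul_assoc, smul_mul_assoc, _root_.one_mul])

lemma pullVal_el (n : ℤ) (e : X.E n) (b : B.A) :
    s.pullVal f (el n (f.inc e) b) = f.f (s.val (el n e 1)) * b := by simp [pullVal]

lemma pullVal_rmul (b : B.A) (x : Tot B (f.pullE X.E)) :
    s.pullVal f (rmul b x) = s.pullVal f x * b := by
  have : (s.pullVal f).comp (rmul b) = (AddMonoidHom.mulRight b).comp (s.pullVal f) :=
    f.pull_ext fun n e c => by simp [pullVal_el, mul_assoc]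
  exact DFunLike.congr_fun this x

lemma pullVal_j (x : X.T) : s.pullVal f (f.j x) = f.f (s.val x) := by
  have : (s.pullVal f).comp f.j = (f.f.toLinearMap ∘ₗ s.val.toLinearMap).toAddMonoidHom :=
    Tot.addHom_ext fun n e a => by
      have h : el n e a = rmul a (el n e (1 : A.A)) := by rw [rmul_el, _root_.one_mul]
      simp only [AddMonoidHom.comp_apply, LinearMap.toAddMonoidHom_coe, LinearMap.comp_apply]
      rw [j_el, pullVal_el, h, LinearEquiv.coe_coe, s.val_rmul]
      exact (map_mul f.f _ _).symm
  exact DFunLike.congr_fun this x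

/-- The trivialization of the pullback. -/
def pull : (X.pull f).Triv where
  val :=
    { toFun := s.pullVal f
      map_add' := map_add _
      map_smul' := fun c x => by
        rw [csmul_eq_rmul, pullVal_rmul, RingHom.id_apply, Algebra.smul_def, Algebra.commutes]
      invFun := fun b => rmul b (f.j (s.val.symm 1))
      left_inv := fun x => by
        have : (AddMonoidHom.mk' (fun b : B.A => rmul b (f.j (s.val.symm 1)))
            (fun b c => rmul_add b c _)).comp (s.pullVal f) = AddMonoidHom.id _ :=
          f.pull_ext fun n e b => by
            simp only [AddMonoidHom.comp_apply, AddMonoidHom.mk'_apply, pullVal_el,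
              AddMonoidHom.id_apply]
            rw [← rmul_rmul, ← f.j_rmul, symm_rmul, _root_.one_mul, LinearEquiv.symm_apply_apply,
              j_el, map_one, rmul_el, _root_.one_mul]
        exact DFunLike.congr_fun this x
      right_inv := fun b => by
        rw [pullVal_rmul, pullVal_j, LinearEquiv.apply_symm_apply, map_one, _root_.one_mul] }
  val_rmul := s.pullVal_rmul f
  val_mem := fun {m x} hx => by
    refine map_deg_le (s.pullVal f) (B.deg m).toAddSubgroup m (fun n i y b hb hm => ?_) hx
    refine f.mem_of_tm (s.pullVal f) b _ (fun r e => ?_) y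
    rw [el_tm, pullVal_el]
    have := B.mul_mem (f.map_deg (s.val_mem (el_mem e A.one_mem (add_zero n))))
      ((B.deg i).smul_mem r hb)
    rwa [hm] at this
  symm_mem := fun {m b} hb =>
    rmul_mem hb (zero_add m) (f.j_mem (s.symm_mem A.one_mem))
  val_conn := fun x => by
    have : (s.pullVal f).comp (X.pull f).conn.toAddMonoidHom =
        B.d.toAddMonoidHom.comp (s.pullVal f) := f.pull_ext fun n e b => by
      have h := f.map_deg (s.val_mem (el_mem e A.one_mem (add_zero n)))
      have h2 : (X.pull f).conn (el n (f.inc e) b) = _ := f.pullConn_el X.conn X.leibniz n e b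
      simp only [AddMonoidHom.comp_apply, LinearMap.toAddMonoidHom_coe]
      rw [h2, map_add, map_zsmul, pullVal_rmul, pullVal_el, pullVal_j, pullVal_el, B.leibniz b h,
        s.val_conn, f.map_d]
    exact DFunLike.congr_fun this x

end Pull

end CohMod.Triv

section Unit

variable (A : DGAlgebra k)

/-- The graded module with `A⁰` in degree `0`. -/
abbrev unitE (n : ℤ) : Type := PLift (n = 0) → A.R

/-- Auxiliary to `unitVal`. -/
def unitValAux (n : ℤ) : unitE A n →+ A.A →+ A.A :=
  if h : n = 0 then
    AddMonoidHom.mk' (fun e => DistribSMul.toAddMonoidHom A.A (e ⟨h⟩))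
      (fun e e' => AddMonoidHom.ext fun a => add_smul (e ⟨h⟩) (e' ⟨h⟩) a)
  else 0

lemma unitValAux_zero (e : unitE A 0) (a : A.A) : unitValAux A 0 e a = e ⟨rfl⟩ • a := by
  simp [unitValAux]

lemma unitE_zero {n : ℤ} (h : n ≠ 0) (e : unitE A n) : e = 0 := funext fun i => (h i.down).elim

/-- `e ⊗ a ↦ e • a`. -/
def unitVal : Tot A (unitE A) →+ A.A :=
  Tot.lift (unitValAux A) (fun n r e a => by
    by_cases h : n = 0
    · subst h
      rw [unitValAux_zero, unitValAux_zero, Pi.smul_apply, smul_eq_mul, mul_comm, mul_smul]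
    · rw [unitE_zero A h e, smul_zero, map_zero]; rfl)

lemma unitVal_el (e : unitE A 0) (a : A.A) : unitVal A (el 0 e a) = e ⟨rfl⟩ • a := by
  rw [unitVal, lift_el, unitValAux_zero]

lemma unit_ext {G : Type*} [AddCommGroup G] {f g : Tot A (unitE A) →+ G}
    (h : ∀ a : A.A, f (el 0 1 a) = g (el 0 1 a)) : f = g :=
  Tot.addHom_ext fun n e a => by
    by_cases hn : n = 0
    · subst hn
      have : e = e ⟨rfl⟩ • (1 : unitE A 0) := funext fun i => by simp
      rw [this, smul_el]
      exact h _
    · rw [unitE_zero A hn e, zero_el, map_zero, map_zero]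

/-- `a ↦ 1 ⊗ a`. -/
def unitElt : A.A →+ Tot A (unitE A) := AddMonoidHom.mk' (el 0 1) (el_add 0 1)

lemma unitVal_elt (a : A.A) : unitVal A (unitElt A a) = a :=
  (unitVal_el A _ a).trans (by simp)

lemma unitElt_val (x : Tot A (unitE A)) : unitElt A (unitVal A x) = x := by
  have : (unitElt A).comp (unitVal A) = AddMonoidHom.id _ := unit_ext A fun a =>
    congrArg (unitElt A) (unitVal_elt A a)
  exact DFunLike.congr_fun this x

lemma unitVal_rmul (b : A.A) (x : Tot A (unitE A)) : unitVal A (rmul b x) = unitVal A x * b := by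
  have : (unitVal A).comp (rmul b) = (AddMonoidHom.mulRight b).comp (unitVal A) :=
    unit_ext A fun a => by simp [unitVal_el]
  exact DFunLike.congr_fun this x

lemma unitVal_mem {m : ℤ} {x : Tot A (unitE A)} (hx : x ∈ Tot.deg A (unitE A) m) :
    unitVal A x ∈ A.deg m := by
  refine map_deg_le (unitVal A) (A.deg m).toAddSubgroup m (fun n i e a ha hm => ?_) hx
  by_cases h : n = 0
  · subst h
    rw [unitVal_el, ← hm, zero_add]
    exact (A.deg i).smul_mem _ ha
  · rw [unitE_zero A h e, zero_el, map_zero]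
    exact zero_mem _

/-- The free cohesive module `(A⁰, d)` of rank one in degree `0`; its total module is `A` with the
differential `d`. -/
@[reducible] def unitMod : CohMod A where
  E := unitE A
  bounded := ⟨0, fun n hn => ⟨fun e e' => by
    rw [unitE_zero A (abs_pos.1 hn) e, unitE_zero A (abs_pos.1 hn) e']⟩⟩
  finite n := inferInstance
  projective n := inferInstance
  conn :=
    { toFun := fun x => unitElt A (A.d (unitVal A x))
      map_add' := fun x y => by simp only [map_add]
      map_smul' := fun c x => by
        have h : ∀ y : A.A, y * algebraMap k A.A c = c • y := fun y => by
          rw [Algebra.smul_def, Algebra.commutes]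
        rw [csmul_eq_rmul, csmul_eq_rmul, unitVal_rmul, h, _root_.map_smul, RingHom.id_apply]
        conv_rhs => rw [← unitElt_val A (rmul _ _), unitVal_rmul, unitVal_elt, h] }
  conn_mem := fun {m x} hx =>
    el_mem _ (A.d_mem (unitVal_mem A hx)) (zero_add _)
  leibniz := fun n e a => by
    change unitElt A (A.d (unitVal A (el n e a))) =
      rmul a (unitElt A (A.d (unitVal A (el n e 1)))) + sgn n • el n e (A.d a)
    by_cases h : n = 0
    · subst h
      have h1 : e ⟨rfl⟩ • a = (e ⟨rfl⟩ • (1 : A.A)) * a := by rw [smul_mul_assoc, _root_.one_mul]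
      have h2 : e ⟨rfl⟩ • (1 : A.A) ∈ A.deg 0 := (A.deg 0).smul_mem _ A.one_mem
      have h3 : e = e ⟨rfl⟩ • (1 : unitE A 0) := funext fun i => by simp
      rw [unitVal_el, unitVal_el, h1, A.leibniz a h2, map_add]
      conv_rhs => rw [h3, smul_el]
      simp [unitElt, sgn_zero]
    · rw [unitE_zero A h e]
      simp [zero_el]
  flat x := by
    change unitElt A (A.d (unitVal A (unitElt A (A.d (unitVal A x))))) = 0
    rw [unitVal_elt, A.d_d, map_zero]

/-- The tautological trivialization of `(A⁰, d)`. -/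
def unitTriv : (unitMod A).Triv where
  val :=
    { toFun := unitVal A
      map_add' := map_add _
      map_smul' := fun c x => by
        rw [csmul_eq_rmul, unitVal_rmul, RingHom.id_apply, Algebra.smul_def, Algebra.commutes]
      invFun := unitElt A
      left_inv := unitElt_val A
      right_inv := unitVal_elt A }
  val_rmul := unitVal_rmul A
  val_mem := unitVal_mem A
  symm_mem := fun ha => el_mem _ ha (zero_add _)
  val_conn := fun x => unitVal_elt A _

end Unit


/-! ### Germs of smooth functions and the Dolbeault algebra of a closed set -/

open Filter Topology
open scoped ContDiff ComplexConjugate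

/-- The functions which are smooth (as functions of two real variables) on a neighbourhood
of `S`. -/
def smoothNear (S : Set ℂ) : Subalgebra ℂ (ℂ → ℂ) where
  carrier := {f | ∀ᶠ z in 𝓝ˢ S, ContDiffAt ℝ ∞ f z}
  mul_mem' {f g} hf hg := by
    have h1 : ∀ᶠ z in 𝓝ˢ S, ContDiffAt ℝ ∞ f z := hf
    have h2 : ∀ᶠ z in 𝓝ˢ S, ContDiffAt ℝ ∞ g z := hg
    exact (h1.and h2).mono fun _ h => h.1.mul h.2
  add_mem' {f g} hf hg := by
    have h1 : ∀ᶠ z in 𝓝ˢ S, ContDiffAt ℝ ∞ f z := hf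
    have h2 : ∀ᶠ z in 𝓝ˢ S, ContDiffAt ℝ ∞ g z := hg
    exact (h1.and h2).mono fun _ h => h.1.add h.2
  algebraMap_mem' c := by
    have h : ∀ᶠ z in 𝓝ˢ S, ContDiffAt ℝ ∞ (fun _ : ℂ => c) z :=
      Eventually.of_forall fun _ => contDiffAt_const
    exact h

lemma mem_smoothNear {S : Set ℂ} {f : ℂ → ℂ} :
    f ∈ smoothNear S ↔ ∀ᶠ z in 𝓝ˢ S, ContDiffAt ℝ ∞ f z := Iff.rfl

/-- The functions which vanish on a neighbourhood of `S`. -/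
def nullNear (S : Set ℂ) : Ideal (smoothNear S) where
  carrier := {f | ∀ᶠ z in 𝓝ˢ S, f.1 z = 0}
  add_mem' {f g} hf hg := by
    have h1 : ∀ᶠ z in 𝓝ˢ S, f.1 z = 0 := hf
    have h2 : ∀ᶠ z in 𝓝ˢ S, g.1 z = 0 := hg
    have h3 : ∀ᶠ z in 𝓝ˢ S, f.1 z + g.1 z = 0 :=
      (h1.and h2).mono fun z h => by rw [h.1, h.2, add_zero]
    exact h3
  zero_mem' := by
    have h : ∀ᶠ z in 𝓝ˢ S, (0 : ℂ → ℂ) z = 0 := Eventually.of_forall fun _ => rfl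
    exact h
  smul_mem' c f hf := by
    have h1 : ∀ᶠ z in 𝓝ˢ S, f.1 z = 0 := hf
    have h2 : ∀ᶠ z in 𝓝ˢ S, c.1 z * f.1 z = 0 := h1.mono fun z h => by rw [h, mul_zero]
    exact h2

/-- `C^∞(S)`, the direct limit of the rings of smooth functions on the open neighbourhoods
of `S`. -/
def SmoothGerm (S : Set ℂ) : Type := smoothNear S ⧸ nullNear S

instance (S : Set ℂ) : CommRing (SmoothGerm S) :=
  inferInstanceAs (CommRing (smoothNear S ⧸ nullNear S))

instance (S : Set ℂ) : Algebra ℂ (SmoothGerm S) :=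
  inferInstanceAs (Algebra ℂ (smoothNear S ⧸ nullNear S))

/-- The germ along `S` of a function which is smooth near `S`. -/
def germ {S : Set ℂ} (f : ℂ → ℂ) (hf : f ∈ smoothNear S) : SmoothGerm S :=
  Ideal.Quotient.mk (nullNear S) (⟨f, hf⟩ : smoothNear S)

lemma germ_eq {S : Set ℂ} {f g : ℂ → ℂ} {hf : f ∈ smoothNear S} {hg : g ∈ smoothNear S} :
    germ f hf = germ g hg ↔ f =ᶠ[𝓝ˢ S] g := by
  refine Ideal.Quotient.eq.trans ⟨fun h => ?_, fun h => ?_⟩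
  · exact Filter.Eventually.mono h fun z hz => sub_eq_zero.1 hz
  · exact Filter.Eventually.mono h fun z hz => sub_eq_zero.2 hz

lemma germ_surj {S : Set ℂ} (x : SmoothGerm S) : ∃ f hf, germ f hf = x := by
  obtain ⟨⟨f, hf⟩, rfl⟩ := Ideal.Quotient.mk_surjective (I := nullNear S) x
  exact ⟨f, hf, rfl⟩

/-- `∂f/∂z̄ = (∂f/∂x + i ∂f/∂y) / 2`. -/
def dbarFun (f : ℂ → ℂ) (z : ℂ) : ℂ := (fderiv ℝ f z 1 + Complex.I * fderiv ℝ f z Complex.I) / 2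

lemma dbarFun_congr {f g : ℂ → ℂ} {z : ℂ} (h : f =ᶠ[𝓝 z] g) : dbarFun f z = dbarFun g z := by
  rw [dbarFun, dbarFun, h.fderiv_eq]

lemma dbarFun_congr_nhdsSet {S : Set ℂ} {f g : ℂ → ℂ} (h : f =ᶠ[𝓝ˢ S] g) :
    dbarFun f =ᶠ[𝓝ˢ S] dbarFun g := by
  filter_upwards [h.eventually_nhdsSet] with z hz using dbarFun_congr hz

lemma dbarFun_mem {S : Set ℂ} {f : ℂ → ℂ} (hf : f ∈ smoothNear S) : dbarFun f ∈ smoothNear S := by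
  refine (mem_smoothNear.1 hf).mono fun z hz => ?_
  have h : ContDiffAt ℝ ∞ (fderiv ℝ f) z := hz.fderiv_right (by simp)
  exact ((h.clm_apply contDiffAt_const).add
    (contDiffAt_const.mul (h.clm_apply contDiffAt_const))).div_const 2

lemma dbarFun_add {S : Set ℂ} {f g : ℂ → ℂ} (hf : f ∈ smoothNear S) (hg : g ∈ smoothNear S) :
    dbarFun (f + g) =ᶠ[𝓝ˢ S] dbarFun f + dbarFun g := by
  filter_upwards [hf, hg] with z h1 h2
  simp only [dbarFun, Pi.add_apply,
    fderiv_add (h1.differentiableAt (by simp)) (h2.differentiableAt (by simp)),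
    add_apply]
  ring

lemma dbarFun_mul {S : Set ℂ} {f g : ℂ → ℂ} (hf : f ∈ smoothNear S) (hg : g ∈ smoothNear S) :
    dbarFun (f * g) =ᶠ[𝓝ˢ S] dbarFun f * g + f * dbarFun g := by
  filter_upwards [hf, hg] with z h1 h2
  simp only [dbarFun, Pi.add_apply, Pi.mul_apply,
    fderiv_mul (h1.differentiableAt (by simp)) (h2.differentiableAt (by simp)),
    add_apply, smul_apply, smul_eq_mul]
  ring

lemma dbarFun_const (c : ℂ) : dbarFun (fun _ => c) = 0 := by
  funext z
  simp [dbarFun]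

/-- The derivation `∂/∂z̄` of the ring of germs of smooth functions. -/
def dbar (S : Set ℂ) : Derivation ℂ (SmoothGerm S) (SmoothGerm S) :=
  Derivation.mk'
    { toFun := Quotient.lift (fun f : smoothNear S => germ (dbarFun f.1) (dbarFun_mem f.2))
        (fun f g h => germ_eq.2 (dbarFun_congr_nhdsSet (germ_eq.1 (Quotient.sound h))))
      map_add' := fun x y => by
        obtain ⟨f, hf, rfl⟩ := germ_surj x
        obtain ⟨g, hg, rfl⟩ := germ_surj y
        exact germ_eq.2 (dbarFun_add hf hg)
      map_smul' := fun c x => by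
        obtain ⟨f, hf, rfl⟩ := germ_surj x
        have h := dbarFun_mul ((smoothNear S).algebraMap_mem c) hf
        rw [← Algebra.smul_def, show algebraMap ℂ (ℂ → ℂ) c = fun _ => c from rfl, dbarFun_const,
          zero_mul, zero_add] at h
        exact germ_eq.2 h }
    (fun x y => by
      obtain ⟨f, hf, rfl⟩ := germ_surj x
      obtain ⟨g, hg, rfl⟩ := germ_surj y
      have h := dbarFun_mul hf hg
      rw [add_comm, mul_comm (dbarFun f)] at h
      exact germ_eq.2 h)

lemma dbar_germ {S : Set ℂ} (f : ℂ → ℂ) (hf : f ∈ smoothNear S) :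
    dbar S (germ f hf) = germ (dbarFun f) (dbarFun_mem hf) := rfl

section Forms

variable (R : Type) [CommRing R]

/-- The grading of `R ⊕ R dz̄` by the degree of forms. -/
def formDeg (i : ℤ) : Submodule R (TrivSqZeroExt R R) where
  carrier := {x | (i ≠ 0 → x.fst = 0) ∧ (i ≠ 1 → x.snd = 0)}
  add_mem' ha hb := ⟨fun h => by simp [ha.1 h, hb.1 h], fun h => by simp [ha.2 h, hb.2 h]⟩
  zero_mem' := ⟨fun _ => rfl, fun _ => rfl⟩
  smul_mem' c x hx := ⟨fun h => by simp [hx.1 h], fun h => by simp [hx.2 h]⟩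

lemma inl_mem (r : R) : TrivSqZeroExt.inl r ∈ formDeg R 0 := ⟨fun h => (h rfl).elim, fun _ => rfl⟩

lemma inr_mem (r : R) : TrivSqZeroExt.inr r ∈ formDeg R 1 := ⟨fun _ => rfl, fun h => (h rfl).elim⟩

lemma formDeg_internal : DirectSum.IsInternal (formDeg R) := by
  let D : TrivSqZeroExt R R →+ DirectSum ℤ fun i => formDeg R i :=
    AddMonoidHom.mk' (fun x => DirectSum.of (fun i => formDeg R i) 0 ⟨_, inl_mem R x.fst⟩ +
      DirectSum.of (fun i => formDeg R i) 1 ⟨_, inr_mem R x.snd⟩) (fun x y => by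
        have h1 : (⟨_, inl_mem R (x + y).fst⟩ : formDeg R 0) =
          ⟨_, inl_mem R x.fst⟩ + ⟨_, inl_mem R y.fst⟩ := Subtype.ext (by simp)
        have h2 : (⟨_, inr_mem R (x + y).snd⟩ : formDeg R 1) =
          ⟨_, inr_mem R x.snd⟩ + ⟨_, inr_mem R y.snd⟩ :=
            Subtype.ext (TrivSqZeroExt.inr_add R x.snd y.snd)
        rw [h1, h2, map_add, map_add]
        abel)
  have hD : ∀ x, D x = DirectSum.of (fun i => formDeg R i) 0 ⟨_, inl_mem R x.fst⟩ +
      DirectSum.of (fun i => formDeg R i) 1 ⟨_, inr_mem R x.snd⟩ := fun x => rfl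
  refine @DirectSum.Decomposition.isInternal _ _ _ _ _ _ _ (formDeg R)
    (DirectSum.Decomposition.ofAddHom (formDeg R) D ?_ ?_)
  · ext x
    · simp [hD]
    · simp [hD]
  · refine DirectSum.addHom_ext fun i y => ?_
    have hy := y.2
    simp only [AddMonoidHom.comp_apply, DirectSum.coeAddMonoidHom_of, AddMonoidHom.id_apply]
    rw [hD]
    by_cases h0 : i = 0
    · subst h0
      have h1 : (⟨_, inl_mem R y.1.fst⟩ : formDeg R 0) = y :=
        Subtype.ext (TrivSqZeroExt.ext rfl (hy.2 (by norm_num)).symm)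
      have h2 : (⟨_, inr_mem R y.1.snd⟩ : formDeg R 1) = 0 :=
        Subtype.ext (by rw [hy.2 (by norm_num)]; rfl)
      rw [h1, h2, map_zero, add_zero]
    · by_cases h1 : i = 1
      · subst h1
        have h1 : (⟨_, inr_mem R y.1.snd⟩ : formDeg R 1) = y :=
          Subtype.ext (TrivSqZeroExt.ext (hy.1 (by norm_num)).symm rfl)
        have h2 : (⟨_, inl_mem R y.1.fst⟩ : formDeg R 0) = 0 :=
          Subtype.ext (by rw [hy.1 (by norm_num)]; rfl)
        rw [h1, h2, map_zero, zero_add]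
      · have h2 : (⟨_, inr_mem R y.1.snd⟩ : formDeg R 1) = 0 :=
          Subtype.ext (by rw [hy.2 h1]; rfl)
        have h3 : (⟨_, inl_mem R y.1.fst⟩ : formDeg R 0) = 0 :=
          Subtype.ext (by rw [hy.1 h0]; rfl)
        have h4 : y = 0 := Subtype.ext (TrivSqZeroExt.ext (hy.1 h0) (hy.2 h1))
        rw [h2, h3, h4]
        simp

variable {R} in
/-- The dg-algebra `R ⊕ R ε`, `ε` of degree `1`, `ε² = 0`, with the differential
`f + g ε ↦ D(f) ε`. -/
@[reducible] def formAlgebra [Algebra k R] (D : Derivation k R R) : DGAlgebra k where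
  R := R
  A := TrivSqZeroExt R R
  deg := formDeg R
  internal := formDeg_internal _
  deg_neg i hi := by
    rw [eq_bot_iff]
    intro x hx
    exact TrivSqZeroExt.ext (hx.1 (by omega)) (hx.2 (by omega))
  algebraMap_injective := TrivSqZeroExt.inl_injective
  deg_zero a := by
    constructor
    · intro h
      exact ⟨a.fst, TrivSqZeroExt.ext rfl (h.2 (by norm_num)).symm⟩
    · rintro ⟨r, rfl⟩
      exact inl_mem _ r
  mul_mem {i j a b} ha hb := by
    constructor
    · intro h
      rw [TrivSqZeroExt.fst_mul]
      by_cases hi : i = 0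
      · rw [hb.1 (by omega), mul_zero]
      · rw [ha.1 hi, zero_mul]
    · intro h
      rw [TrivSqZeroExt.snd_mul]
      have h1 : a.fst = 0 ∨ b.snd = 0 := by
        by_cases hi : i = 0
        · exact Or.inr (hb.2 (by omega))
        · exact Or.inl (ha.1 hi)
      have h2 : b.fst = 0 ∨ a.snd = 0 := by
        by_cases hi : j = 0
        · exact Or.inr (ha.2 (by omega))
        · exact Or.inl (hb.1 hi)
      rcases h1 with h1 | h1 <;> rcases h2 with h2 | h2 <;> simp [h1, h2]
  d :=
    { toFun := fun a => TrivSqZeroExt.inr (D a.fst)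
      map_add' := fun a b => by
        rw [TrivSqZeroExt.fst_add, map_add, TrivSqZeroExt.inr_add]
      map_smul' := fun c a => by
        rw [TrivSqZeroExt.fst_smul, D.map_smul, TrivSqZeroExt.inr_smul, RingHom.id_apply] }
  d_mem {i a} ha := by
    by_cases hi : i = 0
    · subst hi
      exact inr_mem _ _
    · change TrivSqZeroExt.inr (D a.fst) ∈ _
      rw [ha.1 hi, map_zero, TrivSqZeroExt.inr_zero]
      exact zero_mem _
  leibniz {i a} b ha := by
    change TrivSqZeroExt.inr (D (a * b).fst) =
      TrivSqZeroExt.inr (D a.fst) * b + sgn i • (a * TrivSqZeroExt.inr (D b.fst))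
    by_cases hi : i = 0
    · subst hi
      refine TrivSqZeroExt.ext ?_ ?_
      · simp [sgn_zero]
      · simp only [sgn_zero, one_smul, TrivSqZeroExt.snd_inr, TrivSqZeroExt.snd_add,
          TrivSqZeroExt.snd_mul, TrivSqZeroExt.fst_inr, TrivSqZeroExt.fst_mul, D.leibniz]
        simp only [smul_eq_mul, MulOpposite.smul_eq_mul_unop, MulOpposite.unop_op, zero_mul]
        ring
    · have h0 : a.fst = 0 := ha.1 hi
      refine TrivSqZeroExt.ext ?_ ?_
      · simp
      · simp [h0]
  d_d a := by
    change TrivSqZeroExt.inr (D (TrivSqZeroExt.inr (D a.fst) : TrivSqZeroExt R R).fst) =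
      (0 : TrivSqZeroExt R R)
    rw [TrivSqZeroExt.fst_inr, map_zero, TrivSqZeroExt.inr_zero]

end Forms

/-- The Dolbeault algebra `A(S)` of a subset `S` of the complex line, the direct limit of the
algebras `(A^{0,•}(Ω), ∂̄)` over the open neighbourhoods `Ω` of `S`: the form `f + g dz̄` is the
element `(f, g)` of `C^∞(S) ⊕ C^∞(S) dz̄`, `dz̄ dz̄ = 0`, and `∂̄ (f + g dz̄) = (∂f/∂z̄) dz̄`. -/
abbrev Dolb (S : Set ℂ) : DGAlgebra ℂ := formAlgebra (dbar S)

/-- A map which is holomorphic near `S` and maps `S` into `S'`. -/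
structure HolMap (S S' : Set ℂ) where
  fn : ℂ → ℂ
  analytic : ∀ z ∈ S, AnalyticAt ℂ fn z
  mapsTo : Set.MapsTo fn S S'

namespace HolMap

variable {S S' : Set ℂ} (h : HolMap S S')

lemma tendsto : Tendsto h.fn (𝓝ˢ S) (𝓝ˢ S') := by
  intro s hs
  rw [mem_nhdsSet_iff_forall] at hs
  rw [Filter.mem_map, mem_nhdsSet_iff_forall]
  intro z hz
  exact (h.analytic z hz).continuousAt (hs _ (h.mapsTo hz))

lemma eventually : ∀ᶠ z in 𝓝ˢ S, AnalyticAt ℂ h.fn z := by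
  rw [eventually_nhdsSet_iff_forall]
  intro z hz
  exact (h.analytic z hz).eventually_analyticAt

lemma comp_mem {f : ℂ → ℂ} (hf : f ∈ smoothNear S') : f ∘ h.fn ∈ smoothNear S := by
  refine ((h.tendsto.eventually hf).and h.eventually).mono fun z ⟨h1, h2⟩ => ?_
  exact h1.comp z (h2.contDiffAt.restrict_scalars ℝ)

lemma conj_deriv_mem : (fun z => conj (deriv h.fn z)) ∈ smoothNear S := by
  refine h.eventually.mono fun z hz => ?_
  exact Complex.conjCLE.contDiff.contDiffAt.comp z (hz.deriv.contDiffAt.restrict_scalars ℝ)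

/-- `f ↦ f ∘ h`. -/
def pullGerm : SmoothGerm S' →ₐ[ℂ] SmoothGerm S :=
  Ideal.Quotient.liftₐ (nullNear S')
    ({ toFun := fun f => germ (f.1 ∘ h.fn) (h.comp_mem f.2)
       map_one' := rfl
       map_mul' := fun _ _ => rfl
       map_zero' := rfl
       map_add' := fun _ _ => rfl
       commutes' := fun _ => rfl } : smoothNear S' →ₐ[ℂ] SmoothGerm S)
    (fun f hf => germ_eq.2 (h.tendsto.eventually (show ∀ᶠ z in 𝓝ˢ S', f.1 z = 0 from hf)))

lemma pullGerm_germ (f : ℂ → ℂ) (hf : f ∈ smoothNear S') :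
    h.pullGerm (germ f hf) = germ (f ∘ h.fn) (h.comp_mem hf) := rfl

/-- The germ of the complex conjugate of `h'`. -/
def conjDeriv : SmoothGerm S := germ _ h.conj_deriv_mem

lemma dbar_pull (x : SmoothGerm S') :
    dbar S (h.pullGerm x) = h.pullGerm (dbar S' x) * h.conjDeriv := by
  obtain ⟨f, hf, rfl⟩ := germ_surj x
  refine germ_eq.2 ?_
  filter_upwards [h.tendsto.eventually hf, h.eventually] with z h1 h2
  have h3 : HasFDerivAt h.fn (ContinuousLinearMap.restrictScalars ℝ (fderiv ℂ h.fn z)) z :=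
    h2.differentiableAt.hasFDerivAt.restrictScalars ℝ
  have h4 : ∀ v : ℂ, fderiv ℂ h.fn z v = v * deriv h.fn z := fun v => by
    rw [← fderiv_apply_one_eq_deriv, ← smul_eq_mul v, ← _root_.map_smul, smul_eq_mul, mul_one]
  have h5 : fderiv ℝ (f ∘ h.fn) z = _ :=
    ((h1.differentiableAt (by simp)).hasFDerivAt.comp z h3).fderiv
  have h6 : ∀ c : ℂ, fderiv ℝ f (h.fn z) c =
      c.re * fderiv ℝ f (h.fn z) 1 + c.im * fderiv ℝ f (h.fn z) Complex.I := fun c => by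
    conv_lhs => rw [← Complex.re_add_im c, map_add]
    rw [show ((c.re : ℂ)) = c.re • (1 : ℂ) by simp, show (c.im : ℂ) * Complex.I = c.im • Complex.I by
      simp, _root_.map_smul, _root_.map_smul]
    simp
  change dbarFun (f ∘ h.fn) z = dbarFun f (h.fn z) * conj (deriv h.fn z)
  rw [dbarFun, dbarFun, h5]
  simp only [ContinuousLinearMap.comp_apply, ContinuousLinearMap.coe_restrictScalars', h4, one_mul]
  rw [h6 (deriv h.fn z), h6 (Complex.I * deriv h.fn z)]
  have h7 : conj (deriv h.fn z) = ((deriv h.fn z).re : ℂ) - (deriv h.fn z).im * Complex.I := by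
    apply Complex.ext <;> simp
  rw [h7]
  simp only [Complex.mul_re, Complex.mul_im, Complex.I_re, Complex.I_im]
  push_cast
  linear_combination ((1 : ℂ) / 2 * ((deriv h.fn z).im * fderiv ℝ f (h.fn z) Complex.I)) *
    Complex.I_mul_I

/-- The pullback of forms, `f + g dz̄ ↦ f ∘ h + (g ∘ h) h̄' dz̄`. -/
def pullForm : DGAlgebra.Hom (Dolb S') (Dolb S) where
  f₀ := h.pullGerm
  f := AlgHom.ofLinearMap
    { toFun := fun x => TrivSqZeroExt.inl (h.pullGerm x.fst) +
        TrivSqZeroExt.inr (h.pullGerm x.snd * h.conjDeriv)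
      map_add' := fun x y => by
        ext <;> simp [add_mul]
      map_smul' := fun c x => by
        ext <;> simp }
    (by ext <;> simp)
    (fun x y => by
      ext
      · simp
      · simp
        ring)
  compat r := by
    change TrivSqZeroExt.inl (h.pullGerm r) + TrivSqZeroExt.inr (h.pullGerm 0 * h.conjDeriv) =
      TrivSqZeroExt.inl (h.pullGerm r)
    rw [map_zero, zero_mul, TrivSqZeroExt.inr_zero, add_zero]
  map_deg ha := ⟨fun hi => by simp [ha.1 hi], fun hi => by simp [ha.2 hi]⟩
  map_d a := by
    ext
    · simp
    · simp [dbar_pull]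

end HolMap


/-! ### The two disks, the annulus and the dg-category `𝒬` -/

/-- The closed disk `{|z| ≤ 2}`; it occurs as the disk `U` with coordinate `z` and as the disk `V`
with coordinate `ξ`. -/
def disk : Set ℂ := {z | ‖z‖ ≤ 2}

/-- The annulus `W = {1/2 ≤ |z| ≤ 2}`. -/
def annulus : Set ℂ := {z | 1 / 2 ≤ ‖z‖ ∧ ‖z‖ ≤ 2}

lemma ne_zero_of_mem {z : ℂ} (h : z ∈ annulus) : z ≠ 0 := by
  rintro rfl
  have := h.1
  norm_num at this

/-- The inclusion of `W` into `U`. -/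
def inclU : HolMap annulus disk where
  fn := id
  analytic _ _ := analyticAt_id
  mapsTo _ h := h.2

/-- The map `z ↦ ξ = z⁻¹` of `W` into `V`. -/
def inclV : HolMap annulus disk where
  fn z := z⁻¹
  analytic _ hz := analyticAt_inv (ne_zero_of_mem hz)
  mapsTo z hz := by
    have h : 0 < ‖z‖ := norm_pos_iff.2 (ne_zero_of_mem hz)
    change ‖z⁻¹‖ ≤ 2
    rw [norm_inv, inv_le_comm₀ h (by norm_num)]
    simpa using hz.1

/-- The Dolbeault algebra of `U`, in the coordinate `z`. -/
abbrev AU : DGAlgebra ℂ := Dolb disk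

/-- The Dolbeault algebra of `V`, in the coordinate `ξ`. -/
abbrev AV : DGAlgebra ℂ := Dolb disk

/-- The Dolbeault algebra of `W`, in the coordinate `z`. -/
abbrev AW : DGAlgebra ℂ := Dolb annulus

/-- The restriction `g : A(U) → A(W)`. -/
abbrev resU : DGAlgebra.Hom AU AW := inclU.pullForm

/-- The restriction `l : A(V) → A(W)`. -/
abbrev resV : DGAlgebra.Hom AV AW := inclV.pullForm

/-- `𝒬 = 𝒫_{A(U)} ×ʰ_{𝒫_{A(W)}} 𝒫_{A(V)}`. -/
abbrev Q : DGCat ℂ := DGCat.hfp (CohMod.pullFunctor resU) (CohMod.pullFunctor resV)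

lemma analytic_mem {S : Set ℂ} {f : ℂ → ℂ} (hf : ∀ z ∈ S, AnalyticAt ℂ f z) : f ∈ smoothNear S :=
  eventually_nhdsSet_iff_forall.2 fun z hz =>
    (hf z hz).eventually_analyticAt.mono fun _ h => h.contDiffAt.restrict_scalars ℝ

lemma dbar_analytic {S : Set ℂ} {f : ℂ → ℂ} (hf : ∀ z ∈ S, AnalyticAt ℂ f z) :
    dbar S (germ f (analytic_mem hf)) = 0 := by
  refine germ_eq.2 (eventually_nhdsSet_iff_forall.2 fun z hz => ?_)
  refine (hf z hz).eventually_analyticAt.mono fun w h => ?_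
  have h1 : fderiv ℝ f w = (fderiv ℂ f w).restrictScalars ℝ :=
    (h.differentiableAt.hasFDerivAt.restrictScalars ℝ).fderiv
  have h2 : fderiv ℂ f w Complex.I = Complex.I * fderiv ℂ f w 1 := by
    rw [← smul_eq_mul, ← _root_.map_smul, smul_eq_mul, mul_one]
  change (fderiv ℝ f w 1 + Complex.I * fderiv ℝ f w Complex.I) / 2 = 0
  rw [h1, ContinuousLinearMap.coe_restrictScalars', h2, ← mul_assoc, Complex.I_mul_I]
  ring

/-- `𝒪(S)`: germs along `S` of holomorphic functions defined near `S`. -/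
def Hol (S : Set ℂ) : Submodule ℂ (SmoothGerm S) where
  carrier := {x | ∃ (f : ℂ → ℂ) (hf : ∀ z ∈ S, AnalyticAt ℂ f z), germ f (analytic_mem hf) = x}
  zero_mem' := ⟨fun _ => 0, fun _ _ => analyticAt_const, rfl⟩
  add_mem' := by
    rintro _ _ ⟨f, hf, rfl⟩ ⟨g, hg, rfl⟩
    exact ⟨f + g, fun z hz => (hf z hz).add (hg z hz), rfl⟩
  smul_mem' := by
    rintro c _ ⟨f, hf, rfl⟩
    exact ⟨c • f, fun z hz => (hf z hz).const_smul, rfl⟩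

/-- The germ of `z ^ j` along `W`. -/
def zp (j : ℤ) : SmoothGerm annulus :=
  germ (fun z => z ^ j) (analytic_mem fun _ hz => analyticAt_id.zpow (ne_zero_of_mem hz))

lemma dbar_zp (j : ℤ) : dbar annulus (zp j) = 0 :=
  dbar_analytic fun _ hz => analyticAt_id.zpow (ne_zero_of_mem hz)

lemma zp_mul_zp (i j : ℤ) (h : i + j = 0) : zp i * zp j = 1 := by
  have h0 : ∀ᶠ z in 𝓝ˢ annulus, z ≠ (0 : ℂ) :=
    eventually_nhdsSet_iff_forall.2 fun z hz => isOpen_ne.mem_nhds (ne_zero_of_mem hz)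
  refine germ_eq.2 (h0.mono fun z hz => ?_)
  change z ^ i * z ^ j = 1
  rw [← zpow_add₀ hz, h, zpow_zero]

lemma pull_hol {S S' : Set ℂ} (h : HolMap S S') {x : SmoothGerm S'} (hx : x ∈ Hol S') :
    h.pullGerm x ∈ Hol S := by
  obtain ⟨f, hf, rfl⟩ := hx
  exact ⟨f ∘ h.fn, fun z hz => (hf _ (h.mapsTo hz)).comp (h.analytic z hz), rfl⟩

lemma zp_mul_hol (j : ℤ) {x : SmoothGerm annulus} (hx : x ∈ Hol annulus) :
    zp j * x ∈ Hol annulus := by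
  obtain ⟨f, hf, rfl⟩ := hx
  exact ⟨fun z => z ^ j * f z,
    fun z hz => (analyticAt_id.zpow (ne_zero_of_mem hz)).mul (hf z hz), rfl⟩

/-- A germ of a smooth function, as a form of degree `0`. -/
def form0 {S : Set ℂ} (x : SmoothGerm S) : (Dolb S).deg 0 := ⟨_, inl_mem _ x⟩

/-- The form `x dz̄`. -/
def form1 {S : Set ℂ} (x : SmoothGerm S) : (Dolb S).deg 1 := ⟨_, inr_mem _ x⟩

/-- Multiplication by `z ^ (-j)`, as a morphism `g^* A(U) → l^* A(V)`; both are identified with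
`A(W)`. -/
def glue (j : ℤ) : CohMod.hom ((unitMod AU).pull resU) ((unitMod AV).pull resV) 0 :=
  CohMod.Triv.mul ((unitTriv AU).pull resU) ((unitTriv AV).pull resV) 0 (form0 (zp (-j)))

/-- The object `A(j) = (A(U), A(V), z ^ (-j))` of `𝒬`. -/
def objA (j : ℤ) : Q.Obj where
  M := unitMod AU
  N := unitMod AV
  φ := glue j
  closed := by
    refine (CohMod.Triv.mul_d _ _ (zero_add 1) (form0 (zp (-j))) 0 ?_).trans (map_zero _)
    change TrivSqZeroExt.inr (dbar annulus (zp (-j))) = 0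
    rw [dbar_zp, TrivSqZeroExt.inr_zero]
  equiv := by
    refine CohMod.Triv.mul_isHomotopyEquiv _ _ (form0 (zp (-j))) (form0 (zp j)) ?_ ?_ ?_
    · change TrivSqZeroExt.inr (dbar annulus (zp j)) = 0
      rw [dbar_zp, TrivSqZeroExt.inr_zero]
    · change TrivSqZeroExt.inl (zp (-j)) * TrivSqZeroExt.inl (zp j) = 1
      rw [← TrivSqZeroExt.inl_mul, zp_mul_zp _ _ (neg_add_cancel j), TrivSqZeroExt.inl_one]
    · change TrivSqZeroExt.inl (zp j) * TrivSqZeroExt.inl (zp (-j)) = 1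
      rw [← TrivSqZeroExt.inl_mul, zp_mul_zp _ _ (add_neg_cancel j), TrivSqZeroExt.inl_one]

/-- The degree `1` morphism `(α, β, 0) : A(i) → A(j)` of `𝒬`: the multiplications by the
`(0,1)`-forms `α = a dz̄` on `U` and `β = b dξ̄` on `V`, and the trivial homotopy. -/
def pairHom (i j : ℤ) (a b : SmoothGerm disk) : Q.Hom (objA i) (objA j) 1 :=
  (CohMod.Triv.mul (unitTriv AU) (unitTriv AU) 1 (form1 a),
    CohMod.Triv.mul (unitTriv AV) (unitTriv AV) 1 (form1 b), 0)

/-! ### The Čech complex -/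

/-- The Čech differential of `ℋom(𝒪(i), 𝒪(j))` for the cover `{U, V}`. The frames `e_U`, `e_V` of
`𝒪(n)` satisfy `s_V = z ^ (-n) s_U` for the coordinates of a section over `W`. A homomorphism
`𝒪(i) → 𝒪(j)` over `U` or `V` is multiplication by a holomorphic function `h_U` or `h_V` in these
frames; over `W` one has `h_V = z ^ (i - j) h_U`, and homomorphisms over `W` are written in the
frames `e_V`. So the differential is `(h_U, h_V) ↦ h_V - z ^ (i - j) h_U`. -/
def cechD (i j : ℤ) : Hol disk × Hol disk →ₗ[ℂ] Hol annulus where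
  toFun h := ⟨inclV.pullGerm h.2 - zp (i - j) * inclU.pullGerm h.1,
    sub_mem (pull_hol _ h.2.2) (zp_mul_hol _ (pull_hol _ h.1.2))⟩
  map_add' a b := Subtype.ext (by
    simp only [Prod.snd_add, Prod.fst_add, Submodule.coe_add, map_add, mul_add]
    ring)
  map_smul' c a := Subtype.ext (by
    simp only [Prod.smul_fst, Prod.smul_snd, Submodule.coe_smul, _root_.map_smul, RingHom.id_apply,
      mul_smul_comm, smul_sub])

/-- The terms of the Čech complex. -/
def cechX : ℤ → ModuleCat.{0} ℂ
  | 0 => ModuleCat.of ℂ (Hol disk × Hol disk)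
  | 1 => ModuleCat.of ℂ (Hol annulus)
  | _ => ModuleCat.of ℂ PUnit

/-- The differentials of the Čech complex. -/
def cechDiff (i j : ℤ) : ∀ n : ℤ, cechX n ⟶ cechX (n + 1)
  | 0 => ModuleCat.ofHom (cechD i j)
  | Int.ofNat (_ + 1) => 0
  | Int.negSucc _ => 0

lemma cechDiff_comp (i j : ℤ) : ∀ n : ℤ, cechDiff i j n ≫ cechDiff i j (n + 1) = 0
  | 0 => Limits.comp_zero
  | Int.ofNat (_ + 1) => Limits.zero_comp
  | Int.negSucc _ => Limits.zero_comp

/-- The Čech complex of `ℋom(𝒪(i), 𝒪(j))` for the cover of `ℙ¹` by `U` and `V`. -/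
def cech (i j : ℤ) : CochainComplex (ModuleCat.{0} ℂ) ℤ :=
  CochainComplex.of cechX (cechDiff i j) (cechDiff_comp i j)

/-- The cohomology class `h ∈ Hⁿ(K)` is the class of the cocycle `z ∈ Kⁿ`. -/
def IsClass (K : CochainComplex (ModuleCat.{0} ℂ) ℤ) (n : ℤ) (z : K.X n) (h : K.homology n) : Prop :=
  ∃ c : K.cycles n, (K.iCycles n).hom c = z ∧ (K.homologyπ n).hom c = h


/-! ### The projective line and the sheaves `𝒪(n)` -/

open TopologicalSpace Opposite

/-- The space `ℙ¹ = ℂ ∪ {∞}`, with the coordinate `z` on `ℂ` and the coordinate `ξ = z⁻¹`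
around `∞`. -/
abbrev PLine : TopCat.{0} := TopCat.of (OnePoint ℂ)

open Classical in
/-- Extension of a function by zero. -/
def extZero {Ω : Opens PLine} (f : Ω → ℂ) (x : OnePoint ℂ) : ℂ := if h : x ∈ Ω then f ⟨x, h⟩ else 0

/-- The passage from the frame `e_U` to the frame `e_V` of `𝒪(n)` around `∞`. Sections `s` of `𝒪(n)`
are recorded by functions `F`: the value `F z` at `z ≠ ∞` is the coordinate of `s` in the frame
`e_U`, and the value at `∞` is its coordinate in the frame `e_V`. So the coordinate in the
frame `e_V` at the point `ξ` is `z ^ (-n) F z` with `z = ξ⁻¹` if `ξ ≠ 0`. -/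
def coordV (n : ℤ) (F : OnePoint ℂ → ℂ) (ξ : ℂ) : ℂ :=
  if ξ = 0 then F OnePoint.infty else ξ ^ n * F ((ξ⁻¹ : ℂ) : OnePoint ℂ)

/-- `f` describes a section of `𝒪(n)` over the open set `Ω`: it is holomorphic in the frame `e_U` at
the points `z ∈ Ω`, and in the frame `e_V` at `∞` if `∞ ∈ Ω`. -/
def IsSec (n : ℤ) {Ω : Opens PLine} (f : Ω → ℂ) : Prop :=
  (∀ z : ℂ, (z : OnePoint ℂ) ∈ Ω → AnalyticAt ℂ (fun w : ℂ => extZero f (w : OnePoint ℂ)) z) ∧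
    (OnePoint.infty ∈ Ω → AnalyticAt ℂ (coordV n (extZero f)) 0)

lemma eventually_coe {Ω : Opens PLine} {z : ℂ} (hz : (z : OnePoint ℂ) ∈ Ω) :
    ∀ᶠ w : ℂ in 𝓝 z, (w : OnePoint ℂ) ∈ Ω :=
  OnePoint.continuous_coe.continuousAt.eventually (Ω.isOpen.mem_nhds hz)

lemma eventually_inv {Ω : Opens PLine} (h : OnePoint.infty ∈ Ω) :
    ∀ᶠ ξ : ℂ in 𝓝 0, ξ ≠ 0 → ((ξ⁻¹ : ℂ) : OnePoint ℂ) ∈ Ω := by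
  have h1 : Tendsto (fun ξ : ℂ => ξ⁻¹) (𝓝[≠] 0) (coclosedCompact ℂ) := by
    rw [coclosedCompact_eq_cocompact, ← Metric.cobounded_eq_cocompact]
    exact tendsto_inv₀_nhdsNE_zero
  exact eventually_nhdsWithin_iff.1
    ((OnePoint.tendsto_coe_infty.comp h1).eventually (Ω.isOpen.mem_nhds h))

lemma sec_congr_coe {Ω : Opens PLine} {F G : OnePoint ℂ → ℂ} (h : ∀ x ∈ Ω, F x = G x) {z : ℂ}
    (hz : (z : OnePoint ℂ) ∈ Ω) :
    (fun w : ℂ => F (w : OnePoint ℂ)) =ᶠ[𝓝 z] fun w : ℂ => G (w : OnePoint ℂ) :=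
  (eventually_coe hz).mono fun _ hw => h _ hw

lemma sec_congr_infty (n : ℤ) {Ω : Opens PLine} {F G : OnePoint ℂ → ℂ} (h : ∀ x ∈ Ω, F x = G x)
    (hz : OnePoint.infty ∈ Ω) : coordV n F =ᶠ[𝓝 0] coordV n G :=
  (eventually_inv hz).mono fun ξ hξ => by
    by_cases h0 : ξ = 0
    · simp only [coordV, h0, if_true, h _ hz]
    · simp only [coordV, h0, if_false, h _ (hξ h0)]

lemma extZero_of_mem {Ω : Opens PLine} (f : Ω → ℂ) {x : OnePoint ℂ} (hx : x ∈ Ω) :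
    extZero f x = f ⟨x, hx⟩ := dif_pos hx

/-- The local predicate of sections of `𝒪(n)`. -/
def secPred (n : ℤ) : TopCat.LocalPredicate (fun _ : PLine => ℂ) where
  pred f := IsSec n f
  res {Ω Ω'} i f hf := by
    have h : ∀ x ∈ Ω, extZero f x = extZero (fun x : Ω => f ⟨x.1, i.le x.2⟩) x := fun x hx => by
      rw [extZero_of_mem _ hx, extZero_of_mem _ (i.le hx)]
    exact ⟨fun z hz => (hf.1 z (i.le hz)).congr (sec_congr_coe h hz),
      fun hz => (hf.2 (i.le hz)).congr (sec_congr_infty n h hz)⟩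
  locality {Ω} f hf := by
    have h : ∀ (Ω' : Opens PLine) (i : Ω' ⟶ Ω), ∀ x ∈ Ω',
        extZero (fun x : Ω' => f ⟨x.1, i.le x.2⟩) x = extZero f x := fun Ω' i x hx => by
      rw [extZero_of_mem _ hx, extZero_of_mem _ (i.le hx)]
    refine ⟨fun z hz => ?_, fun hz => ?_⟩
    · obtain ⟨Ω', hm, i, h'⟩ := hf ⟨_, hz⟩
      exact (h'.1 z hm).congr (sec_congr_coe (h Ω' i) hm)
    · obtain ⟨Ω', hm, i, h'⟩ := hf ⟨_, hz⟩
      exact (h'.2 hm).congr (sec_congr_infty n (h Ω' i) hm)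

lemma extZero_add {Ω : Opens PLine} (f g : Ω → ℂ) : extZero (f + g) = extZero f + extZero g := by
  funext x
  by_cases h : x ∈ Ω <;> simp [extZero, h]

lemma extZero_neg {Ω : Opens PLine} (f : Ω → ℂ) : extZero (-f) = -extZero f := by
  funext x
  by_cases h : x ∈ Ω <;> simp [extZero, h]

lemma extZero_zero {Ω : Opens PLine} : extZero (0 : Ω → ℂ) = 0 := by
  funext x
  by_cases h : x ∈ Ω <;> simp [extZero, h]

lemma extZero_mul {Ω : Opens PLine} (f g : Ω → ℂ) : extZero (f * g) = extZero f * extZero g := by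
  funext x
  by_cases h : x ∈ Ω <;> simp [extZero, h]

lemma coordV_add (n : ℤ) (F G : OnePoint ℂ → ℂ) : coordV n (F + G) = coordV n F + coordV n G := by
  funext ξ
  by_cases h : ξ = 0 <;> simp [coordV, h, mul_add]

lemma coordV_neg (n : ℤ) (F : OnePoint ℂ → ℂ) : coordV n (-F) = -coordV n F := by
  funext ξ
  by_cases h : ξ = 0 <;> simp [coordV, h]

lemma coordV_zero (n : ℤ) : coordV n 0 = 0 := by
  funext ξ
  by_cases h : ξ = 0 <;> simp [coordV, h]

lemma coordV_mul (n : ℤ) (F G : OnePoint ℂ → ℂ) :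
    coordV n (F * G) = coordV 0 F * coordV n G := by
  funext ξ
  by_cases h : ξ = 0
  · simp [coordV, h]
  · simp only [coordV, h, if_false, Pi.mul_apply, zpow_zero]
    ring

lemma IsSec.mul {n : ℤ} {Ω : Opens PLine} {f g : Ω → ℂ} (hf : IsSec 0 f) (hg : IsSec n g) :
    IsSec n (f * g) := by
  rw [IsSec, extZero_mul, coordV_mul]
  exact ⟨fun z hz => (hf.1 z hz).mul (hg.1 z hz), fun hz => (hf.2 hz).mul (hg.2 hz)⟩

lemma IsSec.add {n : ℤ} {Ω : Opens PLine} {f g : Ω → ℂ} (hf : IsSec n f) (hg : IsSec n g) :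
    IsSec n (f + g) := by
  rw [IsSec, extZero_add, coordV_add]
  exact ⟨fun z hz => (hf.1 z hz).add (hg.1 z hz), fun hz => (hf.2 hz).add (hg.2 hz)⟩

lemma IsSec.neg {n : ℤ} {Ω : Opens PLine} {f : Ω → ℂ} (hf : IsSec n f) : IsSec n (-f) := by
  rw [IsSec, extZero_neg, coordV_neg]
  exact ⟨fun z hz => (hf.1 z hz).neg, fun hz => (hf.2 hz).neg⟩

lemma isSec_zero (n : ℤ) {Ω : Opens PLine} : IsSec n (0 : Ω → ℂ) := by
  rw [IsSec, extZero_zero, coordV_zero]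
  exact ⟨fun _ _ => analyticAt_const, fun _ => analyticAt_const⟩

lemma isSec_const (c : ℂ) {Ω : Opens PLine} : IsSec 0 (fun _ : Ω => c) := by
  have h : ∀ x ∈ Ω, (fun _ : OnePoint ℂ => c) x = extZero (fun _ : Ω => c) x := fun x hx => by
    rw [extZero_of_mem _ hx]
  have h0 : coordV 0 (fun _ => c) = fun _ => c := by
    funext ξ
    simp [coordV]
  exact ⟨fun z hz => analyticAt_const.congr (sec_congr_coe h hz), fun hz => by
    have := sec_congr_infty 0 h hz
    rw [h0] at this
    exact analyticAt_const.congr this⟩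

/-- The ring `𝒪(Ω)` of holomorphic functions on `Ω`. -/
def secRing (Ω : Opens PLine) : Subring (Ω → ℂ) where
  carrier := {f | IsSec 0 f}
  mul_mem' hf hg := IsSec.mul hf hg
  one_mem' := isSec_const 1
  add_mem' hf hg := IsSec.add hf hg
  zero_mem' := isSec_zero 0
  neg_mem' hf := IsSec.neg hf

/-- The group `𝒪(n)(Ω)`. -/
def secGroup (n : ℤ) (Ω : Opens PLine) : AddSubgroup (Ω → ℂ) where
  carrier := {f | IsSec n f}
  add_mem' hf hg := IsSec.add hf hg
  zero_mem' := isSec_zero n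
  neg_mem' hf := IsSec.neg hf

instance (n : ℤ) (Ω : Opens PLine) : Module (secRing Ω) (secGroup n Ω) where
  smul g f := ⟨g.1 * f.1, IsSec.mul g.2 f.2⟩
  one_smul f := Subtype.ext (one_mul f.1)
  mul_smul g h f := Subtype.ext (mul_assoc g.1 h.1 f.1)
  smul_zero g := Subtype.ext (mul_zero g.1)
  smul_add g f f' := Subtype.ext (mul_add g.1 f.1 f'.1)
  add_smul g h f := Subtype.ext (add_mul g.1 h.1 f.1)
  zero_smul f := Subtype.ext (zero_mul f.1)

/-- The presheaf of rings of holomorphic functions. -/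
def structPresheaf : (Opens PLine)ᵒᵖ ⥤ RingCat.{0} where
  obj Ω := RingCat.of (secRing Ω.unop)
  map i := RingCat.ofHom
    { toFun := fun f => ⟨fun x => f.1 ⟨x.1, i.unop.le x.2⟩, (secPred 0).res i.unop f.1 f.2⟩
      map_one' := rfl
      map_mul' := fun _ _ => rfl
      map_zero' := rfl
      map_add' := fun _ _ => rfl }

/-- The structure sheaf `𝒪` of `ℙ¹`. -/
def structSheaf : Sheaf (Opens.grothendieckTopology PLine) RingCat.{0} where
  obj := structPresheaf
  property := by
    rw [Presheaf.isSheaf_iff_isSheaf_forget _ _ (forget RingCat)]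
    exact TopCat.subpresheafToTypes.isSheaf (secPred 0)

/-- The presheaf of abelian groups `𝒪(n)`. -/
def linePresheaf (n : ℤ) : (Opens PLine)ᵒᵖ ⥤ Ab.{0} where
  obj Ω := AddCommGrpCat.of (secGroup n Ω.unop)
  map i := AddCommGrpCat.ofHom
    { toFun := fun f => ⟨fun x => f.1 ⟨x.1, i.unop.le x.2⟩, (secPred n).res i.unop f.1 f.2⟩
      map_zero' := rfl
      map_add' := fun _ _ => rfl }

instance (n : ℤ) (Ω : (Opens PLine)ᵒᵖ) :
    Module (structPresheaf.obj Ω) ((linePresheaf n).obj Ω) :=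
  inferInstanceAs (Module (secRing Ω.unop) (secGroup n Ω.unop))

/-- The sheaf of `𝒪`-modules `𝒪(n)`. -/
def lineSheaf (n : ℤ) : SheafOfModules.{0} structSheaf where
  val := PresheafOfModules.ofPresheaf (R := structPresheaf) (linePresheaf n) (fun _ _ _ _ _ => rfl)
  isSheaf := by
    change Presheaf.IsSheaf _ (linePresheaf n)
    rw [Presheaf.isSheaf_iff_isSheaf_forget _ _ (forget Ab)]
    exact TopCat.subpresheafToTypes.isSheaf (secPred n)

instance : HasExt.{1} (SheafOfModules.{0} structSheaf) := HasExt.standard _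


/-- The constant function `c`, as a section of `𝒪`. -/
def constSec (c : ℂ) (Ω : (Opens PLine)ᵒᵖ) : structSheaf.obj.obj Ω :=
  (⟨fun _ => c, isSec_const c⟩ : secRing Ω.unop)

lemma sec_comm (Ω : (Opens PLine)ᵒᵖ) (f g : structSheaf.obj.obj Ω) : f * g = g * f :=
  Subtype.ext (mul_comm (show secRing Ω.unop from f).1 (show secRing Ω.unop from g).1)

/-- Multiplication by the constant `c` on a sheaf of `𝒪`-modules. -/
def scal (c : ℂ) (M : SheafOfModules.{0} structSheaf) : M ⟶ M where
  val :=
    { app := fun Ω => ModuleCat.ofHom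
        { toFun := fun m => constSec c Ω • m
          map_add' := fun m m' => smul_add _ m m'
          map_smul' := fun r m => by
            rw [RingHom.id_apply, smul_smul, smul_smul]
            exact congrArg (· • m) (sec_comm Ω _ _) }
      naturality := fun {Ω Ω'} i => by
        ext m
        exact (PresheafOfModules.map_smul M.val i (constSec c Ω) m).symm }

lemma sheafHom_ext {M N : SheafOfModules.{0} structSheaf} {f g : M ⟶ N}
    (h : ∀ Ω m, (f.val.app Ω).hom m = (g.val.app Ω).hom m) : f = g := by
  ext Ω m
  exact h Ω m

/-- The `ℂ`-linear structure of the category of `𝒪`-modules. -/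
instance : Linear ℂ (SheafOfModules.{0} structSheaf) :=
  Linear.ofRingMorphism
    { toFun := fun c =>
        { app := fun M => scal c M
          naturality := fun _ _ f => sheafHom_ext fun Ω m =>
            (_root_.map_smul (f.val.app Ω).hom (constSec c Ω) m).symm }
      map_one' := NatTrans.ext (funext fun _ => sheafHom_ext fun Ω m => 
        one_smul (structSheaf.obj.obj Ω) m)
      map_mul' := fun a b => NatTrans.ext (funext fun _ => sheafHom_ext fun Ω m =>
        mul_smul (constSec a Ω) (constSec b Ω) m)
      map_zero' := NatTrans.ext (funext fun _ => sheafHom_ext fun Ω m => 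
        zero_smul (structSheaf.obj.obj Ω) m)
      map_add' := fun a b => NatTrans.ext (funext fun _ => sheafHom_ext fun Ω m =>
        add_smul (constSec a Ω) (constSec b Ω) m) }

/-! ### Extensions and Čech cocycles -/

/-- An extension `0 → N → E → M → 0` of `𝒪`-modules. -/
structure Extn (M N : SheafOfModules.{0} structSheaf) where
  E : SheafOfModules.{0} structSheaf
  f : N ⟶ E
  g : E ⟶ M
  w : f ≫ g = 0
  exact : (ShortComplex.mk f g w).ShortExact

/-- The class of an extension in `Ext¹(M, N)`. -/
def Extn.cls {M N : SheafOfModules.{0} structSheaf} (S : Extn M N) : Abelian.Ext M N 1 :=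
  S.exact.extClass

/-- A splitting of `g : E → M` over the open set `D`: a morphism of sheaves `σ : M|_D → E|_D`, linear
over `𝒪|_D`, with `g σ = id`. -/
structure LocalSplitting {E M : SheafOfModules.{0} structSheaf} (g : E ⟶ M) (D : Opens PLine) where
  σ : ∀ Ω : Opens PLine, Ω ≤ D →
    (M.val.obj (op Ω) →ₗ[structSheaf.obj.obj (op Ω)] E.val.obj (op Ω))
  naturality : ∀ {Ω Ω' : Opens PLine} (h : Ω ≤ D) (h' : Ω' ≤ D) (i : Ω' ⟶ Ω)
    (s : M.val.obj (op Ω)),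
    E.val.presheaf.map i.op (σ Ω h s) = σ Ω' h' (M.val.presheaf.map i.op s)
  split : ∀ (Ω : Opens PLine) (h : Ω ≤ D) (s : M.val.obj (op Ω)), g.val.app (op Ω) (σ Ω h s) = s

/-- `D` is an open neighbourhood of the disk `U = {|z| ≤ 2}` in `ℙ¹ ∖ {∞}`. -/
def IsNhdU (D : Opens PLine) : Prop :=
  (∀ z : ℂ, z ∈ disk → (z : OnePoint ℂ) ∈ D) ∧ OnePoint.infty ∉ D

/-- `D` is an open neighbourhood of the disk `V = {|ξ| ≤ 2}`, `ξ = z⁻¹`, in `ℙ¹ ∖ {0}`. -/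
def IsNhdV (D : Opens PLine) : Prop :=
  OnePoint.infty ∈ D ∧ (∀ ξ : ℂ, ξ ≠ 0 → ξ ∈ disk → ((ξ⁻¹ : ℂ) : OnePoint ℂ) ∈ D) ∧
    ((0 : ℂ) : OnePoint ℂ) ∉ D

/-- A section of `𝒪(n)` over `Ω`, as an element of the module of sections of the sheaf. -/
def toSec {n : ℤ} {Ω : Opens PLine} (s : secGroup n Ω) : (lineSheaf n).val.obj (op Ω) := s

/-- The extension class `x ∈ Ext¹(𝒪(i), 𝒪(j))` is described by the Čech cocycle `τ ∈ 𝒪(W)`: there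
are an extension `0 → 𝒪(j) → E → 𝒪(i) → 0` of class `x` and splittings `σ_U`, `σ_V` over
neighbourhoods of `U` and `V` such that `σ_V - σ_U` is, on the intersection, the
homomorphism `𝒪(i) → 𝒪(j)` given by `τ`. In the frames `e_V` this is the multiplication by `τ`, so in
the frames `e_U` it is the multiplication by `z ^ (j - i) τ`. -/
def CechExt (i j : ℤ) (τ : Hol annulus) (x : Abelian.Ext (lineSheaf i) (lineSheaf j) 1) : Prop :=
  ∃ S : Extn (lineSheaf i) (lineSheaf j), S.cls = x ∧
    ∃ (D D' : Opens PLine) (_ : IsNhdU D) (_ : IsNhdV D')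
      (σU : LocalSplitting S.g D) (σV : LocalSplitting S.g D')
      (t : ℂ → ℂ) (ht : ∀ z ∈ annulus, AnalyticAt ℂ t z), germ t (analytic_mem ht) = τ.1 ∧
      ∀ (Ω : Opens PLine) (h : Ω ≤ D) (h' : Ω ≤ D') (s : secGroup i Ω), ∃ r : secGroup j Ω,
        (∀ (z : ℂ) (hz : (z : OnePoint ℂ) ∈ Ω),
          r.1 ⟨z, hz⟩ = z ^ (j - i) * t z * s.1 ⟨z, hz⟩) ∧
        σV.σ Ω h' (toSec s) - σU.σ Ω h (toSec s) = S.f.val.app (op Ω) (toSec r)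

/-! ### The comparison -/

/-- The complex `𝒬(A(2), A)`, where `A = A(0)`. -/
abbrev QC : CochainComplex (ModuleCat.{0} ℂ) ℤ := Q.homComplex (objA 2) (objA 0)

/-- A morphism of degree `1` of `𝒬`, as an element of the complex `𝒬(A(2), A)`. -/
def toQC (f : Q.Hom (objA 2) (objA 0) 1) : QC.X 1 := f

/-- An element of `𝒪(W)`, as a Čech cochain of degree `1`. -/
def toCech (τ : Hol annulus) : (cech 2 0).X 1 := τ

/-- `z² μ_U - μ_V = τ` on `W`. -/
def IsSplit (τ : Hol annulus) (μU μV : SmoothGerm disk) : Prop :=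
  zp 2 * inclU.pullGerm μU - inclV.pullGerm μV = τ.1

/-- The triple `(∂̄μ_U, ∂̄μ_V, 0)`. -/
def dbarTriple (μU μV : SmoothGerm disk) : Q.Hom (objA 2) (objA 0) 1 :=
  pairHom 2 0 (dbar disk μU) (dbar disk μV)

end Glue

end

noncomputable section

namespace Glue

open Filter Topology
open scoped ContDiff ComplexConjugate

/-! ### The inhomogeneous Cauchy–Riemann equation on the plane. -/

section CauchyTransform

open MeasureTheory

/-! The bridge between holomorphic and smooth data is the equation `∂̄u = f`. Convolution with the
Cauchy kernel solves it for compactly supported `f`, so after a cutoff it is solvable near every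
compact set. Hence `∂̄` is surjective on germs along the disks and the annulus (`dbar_surjective`),
and its kernel consists of the holomorphic germs (`mem_Hol_iff`).

The objects `A(j)` have rank one, so morphisms `A(2) → A` are multiplications by forms. The complex
`𝒬(A(2), A)` thus becomes the Čech–Dolbeault complex of `𝒪(-2)`: pairs of functions on the disks in
degree 0, pairs of `(0,1)`-forms on the disks and a function on `W` in degree 1, forms on `W` in
degree 2 (`d_hom₀`, `d_hom₁`). A fixed cutoff function splits every `τ` on `W` smoothly and linearly
as `z² μ_U - μ_V`. In degree 1 the map `Φ` sends `τ` to `(∂̄μ_U, ∂̄μ_V, 0)`; in degree 0 it adds to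
a pair `(h_U, h_V)` the splitting of its coboundary, which makes the two functions agree on `W`. Two
smooth splittings of the same `τ` differ by a pair of functions that agree on `W`, so the resulting
triples differ by a coboundary (`d_eq_dbarTriple_sub`). Solvability of `∂̄` on the three closed sets
makes `Φ` a quasi-isomorphism (`quasiIso_compare`).

On the sheaf side, Čech `H¹` and `Ext¹` are compared through generators. A Laurent decomposition
reduces every cocycle to a multiple of `z` modulo coboundaries (`exists_cechD_eq`), and Liouville's
theorem shows that `z` is not a coboundary (`zp_one_ne_cechD`). So classes are measured by one
linear functional, `coeffL`. Every element of `Ext¹` comes from an actual extension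
(`exists_extClass_eq`), by completing it to a triangle in the derived category. By the first Cousin
problem an extension of `𝒪(n)` by `𝒪` splits over the disks of both charts (`exists_splitting`), and
the difference of two splittings is a cocycle. If the cocycle is `c z`, the splittings glue to a
morphism from the Koszul extension `0 → 𝒪 → 𝒪(1) ⊕ 𝒪(1) → 𝒪(2) → 0` which is `c` on `𝒪` and the
identity on `𝒪(2)`, so the class is `c` times the Koszul class. The Koszul class does not vanish,
since a global splitting would make `z` a coboundary. Therefore `τ` describes `x` exactly when `x =
coeffL τ • koszul.cls` (`cechExt_iff_eq`). This yields the isomorphism `c` and the dimension; `e` is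
then `H¹(Φ) ∘ c⁻¹`. The loss of the class on each disk is the Cousin argument for sheaves and the
surjectivity of `∂̄` for cohesive modules. -/

lemma polar_continuous {g : ℂ → ℂ} (hg : ContDiff ℝ ∞ g) (c : ℂ) :
    Continuous fun p : ℝ × ℝ => fderiv ℝ g (p.1 * Complex.exp (p.2 * Complex.I))
      (c * Complex.exp (p.2 * Complex.I)) := by
  have h1 : Continuous (fderiv ℝ g) := hg.continuous_fderiv (by simp)
  exact (h1.comp (by fun_prop)).clm_apply (by fun_prop)

/-- The integrand is continuous, and it vanishes beyond the radius of a disk containing the support,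
so only a compact rectangle contributes. Integrability is what permits Fubini below. -/
lemma polar_integrableOn {g : ℂ → ℂ} (hg : ContDiff ℝ ∞ g) (hc : HasCompactSupport g) (c : ℂ) :
    IntegrableOn (fun p : ℝ × ℝ => fderiv ℝ g (p.1 * Complex.exp (p.2 * Complex.I))
      (c * Complex.exp (p.2 * Complex.I))) (Set.Ioi 0 ×ˢ Set.Ioo (-Real.pi) Real.pi) := by
  obtain ⟨R, hR⟩ := (hc.fderiv ℝ).isCompact.isBounded.exists_norm_le
  have h1 : IntegrableOn (fun p : ℝ × ℝ => fderiv ℝ g (p.1 * Complex.exp (p.2 * Complex.I))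
      (c * Complex.exp (p.2 * Complex.I))) (Set.Icc (-R) R ×ˢ Set.Icc (-Real.pi) Real.pi) :=
    (polar_continuous hg c).continuousOn.integrableOn_compact (isCompact_Icc.prod isCompact_Icc)
  refine h1.of_forall_sdiff_eq_zero (measurableSet_Ioi.prod measurableSet_Ioo) ?_
  rintro ⟨r, θ⟩ ⟨⟨hr, hθ⟩, hn⟩
  have hr' : R < r := by
    by_contra! h
    have hr0 : 0 < r := hr
    exact hn ⟨⟨by linarith, h⟩, ⟨hθ.1.le, hθ.2.le⟩⟩
  have h2 : (r : ℂ) * Complex.exp (θ * Complex.I) ∉ tsupport (fderiv ℝ g) := fun h => by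
    have := hR _ h
    rw [norm_mul, Complex.norm_exp_ofReal_mul_I, mul_one, Complex.norm_real, Real.norm_eq_abs] at this
    exact absurd ((le_abs_self r).trans this) (not_le.2 hr')
  simp only [image_eq_zero_of_notMem_tsupport h2, zero_apply]

/-- The integrand is the derivative of `g` along the ray of direction `e^{iθ}`, and compact support
removes the boundary term at infinity. -/
lemma integral_radial {g : ℂ → ℂ} (hg : ContDiff ℝ ∞ g) (hc : HasCompactSupport g) (θ : ℝ) :
    ∫ r in Set.Ioi (0 : ℝ), fderiv ℝ g (r * Complex.exp (θ * Complex.I))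
      (1 * Complex.exp (θ * Complex.I)) = - g 0 := by
  set e := Complex.exp (θ * Complex.I) with he
  have hn : ‖e‖ = 1 := Complex.norm_exp_ofReal_mul_I θ
  have hd : ∀ r : ℝ, HasDerivAt (fun r : ℝ => g (r * e)) (fderiv ℝ g (r * e) (1 * e)) r := fun r => by
    have h1 : HasDerivAt (fun r : ℝ => (r : ℂ) * e) (1 * e) r :=
      (Complex.ofRealCLM.hasDerivAt (x := r)).mul_const e
    exact ((hg.differentiable (by simp)) _).hasFDerivAt.comp_hasDerivAt r h1
  have hC : ContDiff ℝ 1 (fun r : ℝ => g (r * e)) :=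
    (hg.of_le (by simp)).comp (Complex.ofRealCLM.contDiff.mul contDiff_const)
  -- The parametrized line is an isometric embedding of `ℝ`, so compact support is inherited.
  have hs : HasCompactSupport (fun r : ℝ => g (r * e)) := by
    refine hc.comp_isClosedEmbedding (f := g) (g := fun r : ℝ => (r : ℂ) * e) ?_
    refine Isometry.isClosedEmbedding (Isometry.of_dist_eq fun a b => ?_)
    rw [dist_eq_norm, dist_eq_norm, ← sub_mul, norm_mul, hn, mul_one, ← Complex.ofReal_sub,
      Complex.norm_real]
  have := HasCompactSupport.integral_Ioi_deriv_eq hC hs 0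
  simp only [Complex.ofReal_zero, zero_mul] at this
  rw [← this]
  exact integral_congr_ae (Eventually.of_forall fun r => (hd r).deriv.symm)

/-- The integrand is the `θ`-derivative of `r⁻¹ g(r e^{iθ})`, which has the same value at `-π` and
`π`. -/
lemma integral_angular {g : ℂ → ℂ} (hg : ContDiff ℝ ∞ g) {r : ℝ} (hr : 0 < r) :
    ∫ θ in Set.Ioo (-Real.pi) Real.pi, fderiv ℝ g (r * Complex.exp (θ * Complex.I))
      (Complex.I * Complex.exp (θ * Complex.I)) = 0 := by
  have hd : ∀ θ : ℝ, HasDerivAt (fun θ : ℝ => (1 / (r : ℂ)) * g (r * Complex.exp (θ * Complex.I)))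
      (fderiv ℝ g (r * Complex.exp (θ * Complex.I)) (Complex.I * Complex.exp (θ * Complex.I))) θ := by
    intro θ
    have h0 : HasDerivAt (fun θ : ℝ => (θ : ℂ) * Complex.I) (1 * Complex.I) θ :=
      (Complex.ofRealCLM.hasDerivAt (x := θ)).mul_const _
    have h1 : HasDerivAt (fun θ : ℝ => (r : ℂ) * Complex.exp (θ * Complex.I))
        (r * (Complex.exp (θ * Complex.I) * (1 * Complex.I))) θ := h0.cexp.const_mul _
    have h2 := (((hg.differentiable (by simp)) _).hasFDerivAt.comp_hasDerivAt θ h1).const_mul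
      (1 / (r : ℂ))
    refine h2.congr_deriv ?_
    have h3 : (r : ℂ) * (Complex.exp (θ * Complex.I) * (1 * Complex.I)) =
      r • (Complex.I * Complex.exp (θ * Complex.I)) := by rw [Complex.real_smul]; ring
    have h4 : (r : ℂ) ≠ 0 := by exact_mod_cast hr.ne'
    rw [h3, _root_.map_smul, Complex.real_smul, ← mul_assoc, one_div, inv_mul_cancel₀ h4, one_mul]
  rw [← integral_Ioc_eq_integral_Ioo, ← intervalIntegral.integral_of_le (by linarith [Real.pi_pos]),
    intervalIntegral.integral_eq_sub_of_hasDerivAt (fun θ _ => hd θ)]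
  · have h1 : ((-Real.pi : ℝ) : ℂ) * Complex.I = -(Real.pi * Complex.I) := by push_cast; ring
    have h2 : Complex.exp (-(Real.pi * Complex.I)) = -1 := by
      rw [Complex.exp_neg, Complex.exp_pi_mul_I]; norm_num
    rw [h1, h2, Complex.exp_pi_mul_I, sub_self]
  · exact ((polar_continuous hg Complex.I).comp (Continuous.prodMk_right r)).intervalIntegrable _ _

/-- The Cauchy–Pompeiu formula for compactly supported functions, at the origin. -/
lemma integral_inv_mul_dbarFun {g : ℂ → ℂ} (hg : ContDiff ℝ ∞ g) (hc : HasCompactSupport g) :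
    ∫ t : ℂ, t⁻¹ * dbarFun g t = -Real.pi * g 0 := by
  have hP := polar_integrableOn hg hc 1
  have hQ := polar_integrableOn hg hc Complex.I
  rw [← Complex.integral_comp_polarCoord_symm]
  -- In polar coordinates `∂/∂z̄ = (e^{iθ}/2) (∂_r + (i/r) ∂_θ)`. The Jacobian `r` cancels the pole
  -- of `t⁻¹`, so no small disk has to be removed.
  have h1 : ∫ p in polarCoord.target, p.1 • ((Complex.polarCoord.symm p)⁻¹ *
        dbarFun g (Complex.polarCoord.symm p)) =
      ∫ p in Set.Ioi (0 : ℝ) ×ˢ Set.Ioo (-Real.pi) Real.pi,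
        ((1 / 2 : ℂ) * fderiv ℝ g (p.1 * Complex.exp (p.2 * Complex.I))
            (1 * Complex.exp (p.2 * Complex.I)) +
          (Complex.I / 2) * fderiv ℝ g (p.1 * Complex.exp (p.2 * Complex.I))
            (Complex.I * Complex.exp (p.2 * Complex.I))) := by
    rw [polarCoord_target]
    refine setIntegral_congr_fun (measurableSet_Ioi.prod measurableSet_Ioo) ?_
    rintro ⟨r, θ⟩ ⟨hr, -⟩
    have hr0 : (r : ℂ) ≠ 0 := by exact_mod_cast (show (0 : ℝ) < r from hr).ne'
    have hz : Complex.polarCoord.symm (r, θ) = r * Complex.exp (θ * Complex.I) := by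
      rw [Complex.polarCoord_symm_apply, Complex.exp_mul_I, Complex.ofReal_cos, Complex.ofReal_sin]
    simp only [hz]
    set L := fderiv ℝ g (r * Complex.exp (θ * Complex.I)) with hL
    have hlin : ∀ v : ℂ, L v = v.re * L 1 + v.im * L Complex.I := fun v => by
      conv_lhs => rw [← Complex.re_add_im v, map_add]
      rw [show ((v.re : ℂ)) = v.re • (1 : ℂ) by simp,
        show (v.im : ℂ) * Complex.I = v.im • Complex.I by simp, _root_.map_smul, _root_.map_smul]
      simp
    rw [hlin (1 * _), hlin (Complex.I * _), dbarFun, ← hL]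
    have e1 : Complex.exp (θ * Complex.I) ≠ 0 := Complex.exp_ne_zero _
    have e2 : (Complex.exp (θ * Complex.I))⁻¹ = Real.cos θ - Real.sin θ * Complex.I := by
      rw [← Complex.exp_neg, ← neg_mul, Complex.exp_mul_I]
      simp [sub_eq_add_neg]
    rw [mul_inv, e2, Complex.real_smul]
    simp only [one_mul, Complex.mul_re, Complex.mul_im, Complex.exp_ofReal_mul_I_re,
      Complex.exp_ofReal_mul_I_im, Complex.I_re, Complex.I_im]
    push_cast
    field_simp
    ring_nf
    simp only [Complex.I_sq]
    ring
  rw [h1, integral_add (hP.const_mul _) (hQ.const_mul _), integral_const_mul, integral_const_mul]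
  -- Fubini is used in both orders: the angular term is integrated over `θ` first and vanishes, the
  -- radial term over `r` first and gives `-g 0` for each direction. The factors `1/2` and `2π`
  -- combine to `π`.
  have h3 := setIntegral_prod _ hQ
  rw [Measure.volume_eq_prod, h3]
  rw [IntegrableOn, Measure.volume_eq_prod, ← Measure.prod_restrict] at hP
  rw [← Measure.prod_restrict, integral_prod_symm _ hP]
  simp only [integral_radial hg hc]
  rw [setIntegral_congr_fun measurableSet_Ioi (g := fun _ => (0 : ℂ))
    (fun r hr => integral_angular hg hr)]
  simp only [integral_zero, mul_zero, add_zero, setIntegral_const, Real.volume_real_Ioo_of_le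
    (show -Real.pi ≤ Real.pi by linarith [Real.pi_pos]), Complex.real_smul]
  push_cast
  ring

/-- The singularity has order 1, which is less than the real dimension 2. -/
lemma locallyIntegrable_inv : LocallyIntegrable (fun z : ℂ => z⁻¹) := by
  refine locallyIntegrable_of_norm_le_rpow (C := 1) (α := 1) ?_ ?_ ?_ ?_
  · simp
  · simp
  · refine Eventually.of_forall fun z => ?_
    rw [one_mul, norm_inv, Real.rpow_neg (norm_nonneg z), Real.rpow_one]
  · exact measurable_inv.aestronglyMeasurable

/-- The inhomogeneous Cauchy–Riemann equation with compactly supported right hand side has a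
bounded solution. -/
lemma exists_dbarFun_eq {f : ℂ → ℂ} (hf : ContDiff ℝ ∞ f) (hc : HasCompactSupport f) :
    ∃ u : ℂ → ℂ, ContDiff ℝ ∞ u ∧ (∀ z, dbarFun u z = f z) ∧ ∃ C R : ℝ, ∀ z, R ≤ ‖z‖ → ‖u z‖ ≤ C := by
  let L := ContinuousLinearMap.mul ℝ ℂ
  have hk := locallyIntegrable_inv
  -- Up to the factor `π` this is the solution: differentiation falls on `f`, and the Cauchy–Pompeiu
  -- formula evaluates the resulting integral.
  let v := convolution (fun z : ℂ => z⁻¹) f L volume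
  have hv : ContDiff ℝ ∞ v := hc.contDiff_convolution_right L hk hf
  have hdv : ∀ z, dbarFun v z = Real.pi * f z := fun z => by
    have h1 := (hc.hasFDerivAt_convolution_right L hk (hf.of_le (by simp)) z).fderiv
    have h2 : ∀ c : ℂ, fderiv ℝ v z c = ∫ t : ℂ, t⁻¹ * fderiv ℝ f (z - t) c := fun c => by
      rw [show v = convolution (fun z : ℂ => z⁻¹) f L volume from rfl, h1,
        convolution_precompR_apply L hk (hc.fderiv ℝ) (hf.continuous_fderiv (by simp))]
      rfl
    have hint : ∀ c : ℂ, Integrable fun t : ℂ => t⁻¹ * fderiv ℝ f (z - t) c := fun c =>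
      (HasCompactSupport.convolutionExists_right L (f := fun z : ℂ => z⁻¹)
        (g := fun w => fderiv ℝ f w c) ((hc.fderiv_apply ℝ c)) hk
        ((hf.continuous_fderiv (by simp)).clm_apply continuous_const)) z
    -- The reflection changes the sign of the derivative, which absorbs the sign of `-π g(0)`.
    let g := fun t => f (z - t)
    have hg : ContDiff ℝ ∞ g := hf.comp (contDiff_const.sub contDiff_id)
    have hgc : HasCompactSupport g := hc.comp_homeomorph (Homeomorph.subLeft z)
    have hdg : ∀ t c, fderiv ℝ g t c = - fderiv ℝ f (z - t) c := fun t c => by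
      have := ((hf.differentiable (by simp)) (z - t)).hasFDerivAt.comp t
        ((hasFDerivAt_const z t).sub (hasFDerivAt_id t))
      rw [show g = f ∘ (fun t => z - t) from rfl]
      erw [this.fderiv]
      simp
    have h3 := integral_inv_mul_dbarFun hg hgc
    simp only [dbarFun, hdg] at h3
    rw [show g 0 = f z by simp [g]] at h3
    rw [dbarFun, h2, h2, ← integral_const_mul, ← integral_add (hint _) ((hint _).const_mul _),
      ← integral_div]
    rw [← neg_inj, ← integral_neg, ← neg_mul, ← h3]
    refine integral_congr_ae (Eventually.of_forall fun t => ?_)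
    simp only
    ring
  refine ⟨fun z => (Real.pi : ℂ)⁻¹ * v z, contDiff_const.mul hv, fun z => ?_, ?_⟩
  · have h1 := (hv.differentiable (by simp)) z
    have h2 : (Real.pi : ℂ) ≠ 0 := by exact_mod_cast Real.pi_ne_zero
    have h3 := hdv z
    rw [dbarFun] at h3 ⊢
    rw [fderiv_const_mul h1]
    simp only [smul_apply, smul_eq_mul]
    field_simp
    linear_combination 2 * h3
  · obtain ⟨R, hR⟩ := hc.isCompact.isBounded.exists_norm_le
    -- At radius `R + 1` and beyond, the support is at distance at least 1, so the kernel has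
    -- absolute value at most 1 on it.
    refine ⟨‖(Real.pi : ℂ)⁻¹‖ * ∫ t, ‖f t‖, R + 1, fun z hz => ?_⟩
    rw [norm_mul]
    refine mul_le_mul_of_nonneg_left ?_ (norm_nonneg _)
    have hfi : Integrable f := hf.continuous.integrable_of_hasCompactSupport hc
    rw [show v z = ∫ t, (z - t)⁻¹ * f t from convolution_eq_swap L]
    refine norm_integral_le_of_norm_le hfi.norm (Eventually.of_forall fun t => ?_)
    by_cases ht : t ∈ tsupport f
    · have h1 := hR t ht
      have h2 : 1 ≤ ‖z - t‖ := by linarith [norm_sub_norm_le z t]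
      rw [norm_mul, norm_inv]
      exact mul_le_of_le_one_left (norm_nonneg _) (inv_le_one_of_one_le₀ h2)
    · rw [image_eq_zero_of_notMem_tsupport ht, mul_zero]

end CauchyTransform

/-! ### Germs along disk and annulus, and Čech cohomology of `𝒪(-2)`. -/

section Germs

/-- A smooth compactly supported cutoff function. -/
lemma exists_cutoff {S O : Set ℂ} (hS : IsCompact S) (hO : IsOpen O) (h : S ⊆ O) :
    ∃ χ : ℂ → ℂ, ContDiff ℝ ∞ χ ∧ HasCompactSupport χ ∧ tsupport χ ⊆ O ∧
      ∀ᶠ z in 𝓝ˢ S, χ z = 1 := by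
  obtain ⟨K, hK, hSK, hKO⟩ := exists_compact_between hS hO h
  obtain ⟨f, h1, h0, -⟩ := exists_contMDiffMap_one_nhds_of_subset_interior (n := (⊤ : ℕ∞))
    (modelWithCornersSelf ℝ ℂ) hS.isClosed hSK
  have hsub : Function.support (fun z => (f z : ℂ)) ⊆ K := fun z hz => by
    by_contra hn
    exact hz (by simp [h0 z hn])
  have ht : tsupport (fun z => (f z : ℂ)) ⊆ K := closure_minimal hsub hK.isClosed
  exact ⟨fun z => f z, Complex.ofRealCLM.contDiff.comp f.contMDiff.contDiff,
    HasCompactSupport.of_support_subset_isCompact hK hsub, ht.trans hKO,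
    h1.mono fun z hz => by simp [hz]⟩

/-- Off the support of `χ` the function `f` may be arbitrary, since the product vanishes identically
near such points. -/
lemma contDiff_mul_cutoff {χ f : ℂ → ℂ} (hχ : ContDiff ℝ ∞ χ)
    (hf : ∀ z ∈ tsupport χ, ContDiffAt ℝ ∞ f z) : ContDiff ℝ ∞ fun z => χ z * f z := by
  rw [contDiff_iff_contDiffAt]
  intro z
  by_cases hz : z ∈ tsupport χ
  · exact hχ.contDiffAt.mul (hf z hz)
  · refine contDiffAt_const (c := (0 : ℂ)) |>.congr_of_eventuallyEq ?_
    filter_upwards [notMem_tsupport_iff_eventuallyEq.1 hz] with w hw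
    rw [hw, Pi.zero_apply, zero_mul]

/-- The `∂̄`-equation is solvable near a compact set. -/
lemma exists_dbarFun_eq_near {S : Set ℂ} (hS : IsCompact S) {f : ℂ → ℂ} (hf : f ∈ smoothNear S) :
    ∃ u : ℂ → ℂ, ContDiff ℝ ∞ u ∧ ∀ᶠ z in 𝓝ˢ S, dbarFun u z = f z := by
  obtain ⟨O, hO, hSO, hfO⟩ := eventually_nhdsSet_iff_exists.1 hf
  obtain ⟨χ, h1, h2, h3, h4⟩ := exists_cutoff hS hO hSO
  obtain ⟨u, hu, hd, -⟩ := exists_dbarFun_eq (contDiff_mul_cutoff h1 fun z hz => hfO z (h3 hz))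
    h2.mul_right
  exact ⟨u, hu, h4.mono fun z hz => by rw [hd, hz, one_mul]⟩

/-- The Dolbeault complex is acyclic in degree 1; only compactness matters, so the annulus is
covered as well as the disks. -/
lemma dbar_surjective {S : Set ℂ} (hS : IsCompact S) : Function.Surjective (dbar S) := by
  intro x
  obtain ⟨f, hf, rfl⟩ := germ_surj x
  obtain ⟨u, hu, hd⟩ := exists_dbarFun_eq_near hS hf
  exact ⟨germ u (mem_smoothNear.2 (Eventually.of_forall fun z => hu.contDiffAt)), germ_eq.2 hd⟩

/-- Real differentiability together with the Cauchy–Riemann equation on an open set gives complex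
differentiability there, hence analyticity. -/
lemma analyticAt_of_dbarFun_eq_zero {f : ℂ → ℂ} {z : ℂ}
    (h : ∀ᶠ w in 𝓝 z, ContDiffAt ℝ ∞ f w ∧ dbarFun f w = 0) : AnalyticAt ℂ f z := by
  obtain ⟨O, hO, hOo, hz⟩ := eventually_nhds_iff.1 h
  have hd : DifferentiableOn ℂ f O := fun w hw => by
    obtain ⟨h1, h2⟩ := hO w hw
    refine (differentiableAt_complex_iff_differentiableAt_real.2
      ⟨h1.differentiableAt (by simp), ?_⟩).differentiableWithinAt
    rw [dbarFun] at h2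
    rw [smul_eq_mul]
    linear_combination (-2 * Complex.I) * h2 + fderiv ℝ f w Complex.I * Complex.I_mul_I
  exact hd.analyticAt (hOo.mem_nhds hz)

lemma dbarFun_of_analyticAt {f : ℂ → ℂ} {z : ℂ} (h : AnalyticAt ℂ f z) : dbarFun f z = 0 := by
  have h1 : fderiv ℝ f z = (fderiv ℂ f z).restrictScalars ℝ :=
    (h.differentiableAt.hasFDerivAt.restrictScalars ℝ).fderiv
  have h2 : fderiv ℂ f z Complex.I = Complex.I * fderiv ℂ f z 1 := by
    rw [← smul_eq_mul, ← _root_.map_smul, smul_eq_mul, mul_one]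
  rw [dbarFun, h1, ContinuousLinearMap.coe_restrictScalars', h2, ← mul_assoc, Complex.I_mul_I]
  ring

lemma mem_Hol_iff {S : Set ℂ} (x : SmoothGerm S) : x ∈ Hol S ↔ dbar S x = 0 := by
  constructor
  · rintro ⟨f, hf, rfl⟩
    exact dbar_analytic hf
  · obtain ⟨f, hf, rfl⟩ := germ_surj x
    intro h
    have h1 : ∀ᶠ z in 𝓝ˢ S, dbarFun f z = 0 := germ_eq.1 h
    have h2 := (mem_smoothNear.1 hf).and h1
    rw [eventually_nhdsSet_iff_forall] at h2
    exact ⟨f, fun z hz => analyticAt_of_dbarFun_eq_zero (h2 z hz), rfl⟩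

lemma disk_eq : disk = Metric.closedBall 0 2 := by
  ext z; simp [disk]

lemma isCompact_disk : IsCompact disk := disk_eq ▸ isCompact_closedBall 0 2

lemma isCompact_annulus : IsCompact annulus := by
  refine isCompact_disk.of_isClosed_subset ?_ fun z hz => hz.2
  exact (isClosed_le continuous_const continuous_norm).inter
    (isClosed_le continuous_norm continuous_const)

/-- The radii `3/4` and `1` lie strictly between `1/2` and `2`, so the transition takes place in the
interior of the annulus. -/
lemma exists_radialCutoff : ∃ χ : ℂ → ℂ, ContDiff ℝ ∞ χ ∧ (∀ z, ‖z‖ ≤ 3 / 4 → χ z = 1) ∧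
    ∀ z, 1 ≤ ‖z‖ → χ z = 0 := by
  obtain ⟨χ, h1, -, h3, h4⟩ := exists_cutoff (isCompact_closedBall (0 : ℂ) (3 / 4))
    (Metric.isOpen_ball (x := (0 : ℂ)) (ε := 1)) (Metric.closedBall_subset_ball (by norm_num))
  refine ⟨χ, h1, fun z hz => h4.self_of_nhdsSet z (by simpa using hz), fun z hz => ?_⟩
  refine image_eq_zero_of_notMem_tsupport fun h => ?_
  have := h3 h
  rw [mem_ball_zero_iff] at this
  linarith

/-- A smooth function, equal to `1` on a disk inside and to `0` outside of the unit disk. -/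
def cut : ℂ → ℂ := exists_radialCutoff.choose

lemma contDiff_cut : ContDiff ℝ ∞ cut := exists_radialCutoff.choose_spec.1

lemma cut_of_le {z : ℂ} (h : ‖z‖ ≤ 3 / 4) : cut z = 1 := exists_radialCutoff.choose_spec.2.1 z h

lemma cut_of_ge {z : ℂ} (h : 1 ≤ ‖z‖) : cut z = 0 := exists_radialCutoff.choose_spec.2.2 z h

lemma eventually_norm_lt {z : ℂ} {r : ℝ} (h : ‖z‖ < r) : ∀ᶠ w in 𝓝 z, ‖w‖ < r :=
  continuous_norm.continuousAt.eventually_lt continuousAt_const h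

lemma eventually_lt_norm {z : ℂ} {r : ℝ} (h : r < ‖z‖) : ∀ᶠ w in 𝓝 z, r < ‖w‖ :=
  continuousAt_const.eventually_lt continuous_norm.continuousAt h

/-- The function `ξ ↦ cut ξ⁻¹`, extended by zero. -/
def cutInv (ξ : ℂ) : ℂ := if ‖ξ‖ < 1 then 0 else cut ξ⁻¹

lemma cutInv_of_lt {ξ : ℂ} (h : ‖ξ‖ < 1) : cutInv ξ = 0 := if_pos h

lemma cutInv_of_ne {ξ : ℂ} (h : ξ ≠ 0) : cutInv ξ = cut ξ⁻¹ := by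
  by_cases h1 : ‖ξ‖ < 1
  · rw [cutInv_of_lt h1, cut_of_ge]
    rw [norm_inv]
    exact (one_le_inv₀ (norm_pos_iff.2 h)).2 h1.le
  · exact if_neg h1

/-- Near `0` the function vanishes identically, because `cut` vanishes outside the unit disk;
elsewhere it is `cut` composed with the inversion. -/
lemma contDiff_cutInv : ContDiff ℝ ∞ cutInv := by
  rw [contDiff_iff_contDiffAt]
  intro z
  by_cases hz : z = 0
  · subst hz
    refine contDiffAt_const (c := (0 : ℂ)) |>.congr_of_eventuallyEq ?_
    exact (eventually_norm_lt (by norm_num : ‖(0 : ℂ)‖ < 1)).mono fun w hw => cutInv_of_lt hw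
  · refine ContDiffAt.congr_of_eventuallyEq (f := fun z => cut z⁻¹) ?_
      ((isOpen_ne.eventually_mem hz).mono fun w hw => cutInv_of_ne hw)
    exact contDiff_cut.contDiffAt.comp z ((contDiffAt_inv ℂ hz).restrict_scalars ℝ)

/-- Extension by zero of the product of a germ along the annulus by a function which vanishes near
the centre of the disk. -/
def cutMul (χ : ℂ → ℂ) (hχ : ContDiff ℝ ∞ χ) (h0 : ∀ z, ‖z‖ < 3 / 4 → χ z = 0) :
    SmoothGerm annulus →ₗ[ℂ] SmoothGerm disk where
  toFun := Quotient.lift (fun f : smoothNear annulus => germ (S := disk) (fun z => χ z * f.1 z) (by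
      refine eventually_nhdsSet_iff_forall.2 fun z hz => ?_
      -- Inside this radius the product is locally zero; the rest of the disk lies in the annulus,
      -- where `f` is smooth.
      by_cases h : ‖z‖ < 3 / 4
      · refine ((eventually_norm_lt h).eventually_nhds).mono fun w hw => ?_
        exact contDiffAt_const (c := (0 : ℂ)) |>.congr_of_eventuallyEq
          (hw.mono fun v hv => by simp [h0 v hv])
      · have hf : ∀ᶠ z in 𝓝ˢ annulus, ContDiffAt ℝ ∞ f.1 z := f.2
        have hzW : z ∈ annulus := ⟨by linarith, hz⟩
        exact (eventually_nhdsSet_iff_forall.1 hf z hzW).mono fun w hw => hχ.contDiffAt.mul hw))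
    (fun f g h => germ_eq.2 (by
      have hfg : f.1 =ᶠ[𝓝ˢ annulus] g.1 :=
        germ_eq (hf := f.2) (hg := g.2) |>.1 (Quotient.sound h)
      refine eventually_nhdsSet_iff_forall.2 fun z hz => ?_
      by_cases h : ‖z‖ < 3 / 4
      · exact (eventually_norm_lt h).mono fun w hw => by simp [h0 w hw]
      · have hzW : z ∈ annulus := ⟨by linarith, hz⟩
        exact (eventually_nhdsSet_iff_forall.1 hfg z hzW).mono fun w hw => by simp only [hw]))
  map_add' x y := by
    obtain ⟨f, hf, rfl⟩ := germ_surj x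
    obtain ⟨g, hg, rfl⟩ := germ_surj y
    exact germ_eq.2 (Eventually.of_forall fun z => mul_add _ _ _)
  map_smul' c x := by
    obtain ⟨f, hf, rfl⟩ := germ_surj x
    exact germ_eq.2 (Eventually.of_forall fun z => mul_left_comm _ _ _)

lemma norm_inv_mem {z : ℂ} (hz : z ∈ annulus) : z⁻¹ ∈ annulus := by
  have h : 0 < ‖z‖ := norm_pos_iff.2 (ne_zero_of_mem hz)
  refine ⟨?_, inclV.mapsTo hz⟩
  rw [norm_inv, le_inv_comm₀ (by norm_num) h]
  simpa using hz.2

/-- The inversion of the annulus. -/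
def annulusInv : HolMap annulus annulus where
  fn z := z⁻¹
  analytic _ hz := analyticAt_inv (ne_zero_of_mem hz)
  mapsTo _ hz := norm_inv_mem hz

/-- The component over `U` of a smooth splitting of a Čech cocycle. -/
def splitU : SmoothGerm annulus →ₗ[ℂ] SmoothGerm disk :=
  cutMul (fun z => 1 - cut z) (contDiff_const.sub contDiff_cut)
    (fun z hz => by rw [cut_of_le hz.le, sub_self]) ∘ₗ LinearMap.mulLeft ℂ (zp (-2))

/-- The component over `V` of a smooth splitting of a Čech cocycle. -/
def splitV : SmoothGerm annulus →ₗ[ℂ] SmoothGerm disk :=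
  - (cutMul cutInv contDiff_cutInv (fun z hz => cutInv_of_lt (by linarith)) ∘ₗ
    annulusInv.pullGerm.toLinearMap)

lemma eventually_ne_zero : ∀ᶠ z in 𝓝ˢ annulus, z ≠ (0 : ℂ) :=
  eventually_nhdsSet_iff_forall.2 fun _ hz => isOpen_ne.mem_nhds (ne_zero_of_mem hz)

/-- Write `x = (1 - cut) x + cut x`. The first summand vanishes near `z = 0` and so extends over
`U`, where `z⁻²` does no harm; the second vanishes near `ξ = 0` and so extends over `V`. -/
lemma zp_two_mul_splitU_sub (x : SmoothGerm annulus) :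
    zp 2 * inclU.pullGerm (splitU x) - inclV.pullGerm (splitV x) = x := by
  obtain ⟨f, hf, rfl⟩ := germ_surj x
  refine germ_eq.2 (eventually_ne_zero.mono fun z hz => ?_)
  change z ^ (2 : ℤ) * ((1 - cut z) * (z ^ (-2 : ℤ) * f z)) - -(cutInv z⁻¹ * f z⁻¹⁻¹) = f z
  rw [inv_inv, cutInv_of_ne (inv_ne_zero hz), inv_inv]
  have h : z ^ (2 : ℤ) * z ^ (-2 : ℤ) = 1 := by rw [← zpow_add₀ hz]; simp
  linear_combination (1 - cut z) * f z * h

/-- A function which is holomorphic near the annulus is a sum of functions which are holomorphic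
near the two disks. -/
lemma exists_laurent {f : ℂ → ℂ} (hf : ∀ z ∈ annulus, AnalyticAt ℂ f z) :
    ∃ P G : ℂ → ℂ, (∀ z ∈ disk, AnalyticAt ℂ P z) ∧ (∀ z ∈ disk, AnalyticAt ℂ G z) ∧
      ∀ z, z ≠ 0 → f z = P z + G z⁻¹ := by
  -- This fills the hole of the annulus smoothly. With `∂̄u = ∂̄F` near the disk, `F - u` will be
  -- the part of `f` holomorphic on the disk, and `f - (F - u)` the part holomorphic outside.
  set F : ℂ → ℂ := fun z => (1 - cut z) * f z with hF
  have hsm : ∀ z ∈ annulus, ∀ᶠ w in 𝓝 z, ContDiffAt ℝ ∞ f w := fun z hz =>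
    (hf z hz).eventually_analyticAt.mono fun w hw => hw.contDiffAt.restrict_scalars ℝ
  have hF0 : ∀ z, ‖z‖ < 3 / 4 → F =ᶠ[𝓝 z] fun _ => 0 := fun z hz =>
    (eventually_norm_lt hz).mono fun w hw => by
      simp [hF, cut_of_le hw.le]
  have hF1 : ∀ z, 1 < ‖z‖ → F =ᶠ[𝓝 z] f := fun z hz =>
    (eventually_lt_norm hz).mono fun w hw => by simp [hF, cut_of_ge hw.le]
  have hFs : ∀ z ∈ disk, ∀ᶠ w in 𝓝 z, ContDiffAt ℝ ∞ F w := fun z hz => by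
    by_cases h : ‖z‖ < 3 / 4
    · exact (hF0 z h).eventually_nhds.mono fun w hw => contDiffAt_const.congr_of_eventuallyEq hw
    · exact (hsm z ⟨by linarith, hz⟩).mono fun w hw =>
        (contDiff_const.sub contDiff_cut).contDiffAt.mul hw
  -- Nothing is lost on the disk by the truncation: beyond the unit circle `F` equals `f`, which is
  -- holomorphic there. It is needed because `f` is uncontrolled away from the annulus.
  set η : ℂ → ℂ := fun z => if ‖z‖ ≤ 1 then dbarFun F z else 0 with hη
  have hη1 : ∀ z, 1 < ‖z‖ → η z = 0 := fun z hz => if_neg (not_le.2 hz)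
  have hηF : ∀ z ∈ disk, η =ᶠ[𝓝 z] dbarFun F := fun z hz => by
    by_cases h : ‖z‖ ≤ 1
    · have h2 : ‖z‖ < 2 := by linarith
      filter_upwards [eventually_norm_lt h2] with w hw
      by_cases h3 : ‖w‖ ≤ 1
      · exact if_pos h3
      · rw [hη1 w (not_le.1 h3), dbarFun_congr (hF1 w (not_le.1 h3)),
          dbarFun_of_analyticAt (hf w ⟨by linarith, hw.le⟩)]
    · have h1 : 1 < ‖z‖ := not_le.1 h
      filter_upwards [eventually_lt_norm h1,
        (hf z ⟨by linarith, hz⟩).eventually_analyticAt] with w hw hw'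
      rw [hη1 w hw, dbarFun_congr (hF1 w hw), dbarFun_of_analyticAt hw']
  have hηs : ContDiff ℝ ∞ η := by
    rw [contDiff_iff_contDiffAt]
    intro z
    by_cases h : ‖z‖ ≤ 1
    · have hz : z ∈ disk := by change ‖z‖ ≤ 2; linarith
      refine ContDiffAt.congr_of_eventuallyEq ?_ (hηF z hz)
      have h1 : ∀ᶠ w in 𝓝ˢ {z}, ContDiffAt ℝ ∞ F w := by
        rw [nhdsSet_singleton]; exact hFs z hz
      have h2 := dbarFun_mem h1
      rw [mem_smoothNear, nhdsSet_singleton] at h2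
      exact h2.self_of_nhds
    · refine contDiffAt_const (c := (0 : ℂ)) |>.congr_of_eventuallyEq ?_
      exact (eventually_lt_norm (not_le.1 h)).mono fun w hw => hη1 w hw
  have hηc : HasCompactSupport η := by
    refine HasCompactSupport.of_support_subset_isCompact (isCompact_closedBall (0 : ℂ) 1) ?_
    intro z hz
    by_contra hn
    refine hz (hη1 z ?_)
    simpa using hn
  obtain ⟨u, hu, hdu, C, R, hC⟩ := exists_dbarFun_eq hηs hηc
  have hP : ∀ z ∈ disk, AnalyticAt ℂ (fun z => F z - u z) z := fun z hz => by
    refine analyticAt_of_dbarFun_eq_zero ?_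
    filter_upwards [hFs z hz, hηF z hz] with w h1 h2
    refine ⟨h1.sub hu.contDiffAt, ?_⟩
    have h3 : dbarFun (fun z => F z - u z) w = dbarFun F w - dbarFun u w := by
      simp only [dbarFun]
      rw [fderiv_fun_sub (h1.differentiableAt (by simp)) ((hu.differentiable (by simp)) w)]
      simp only [sub_apply]
      ring
    rw [h3, hdu, h2, sub_self]
  set Q : ℂ → ℂ := fun z => f z - (F z - u z) with hQ
  have hQa : ∀ z, 1 / 2 ≤ ‖z‖ → AnalyticAt ℂ Q z := fun z hz => by
    by_cases h : ‖z‖ ≤ 2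
    · exact (hf z ⟨hz, h⟩).sub (hP z h)
    · have h1 : 1 < ‖z‖ := by linarith
      have h2 : AnalyticAt ℂ u z := analyticAt_of_dbarFun_eq_zero <|
        (eventually_lt_norm h1).mono fun w hw => ⟨hu.contDiffAt, by rw [hdu, hη1 w hw]⟩
      refine h2.congr ((hF1 z h1).mono fun w hw => ?_)
      simp only [hQ, hw]
      ring
  -- Outside the unit disk `Q` equals `u`, even where `f` is not holomorphic. Boundedness of `u` far
  -- out makes `ξ = 0` a removable singularity of `Q ξ⁻¹`.
  have hQb : ∀ z, max 1 R < ‖z‖ → ‖Q z‖ ≤ C := fun z hz => by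
    have h1 := (hF1 z ((le_max_left _ _).trans_lt hz)).self_of_nhds
    have h2 : Q z = u z := by simp only [hQ, h1]; ring
    rw [h2]
    exact hC z ((le_max_right _ _).trans hz.le)
  have hM : (0 : ℝ) < max 1 R := by positivity
  set r : ℝ := (max 1 R)⁻¹ with hr
  have hr0 : 0 < r := inv_pos.2 hM
  have hr1 : r ≤ 1 := inv_le_one_of_one_le₀ (le_max_left _ _)
  have hinv : ∀ ξ ∈ Metric.ball (0 : ℂ) r \ {0}, max 1 R < ‖ξ⁻¹‖ := fun ξ hξ => by
    have h1 : 0 < ‖ξ‖ := norm_pos_iff.2 hξ.2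
    rw [norm_inv, lt_inv_comm₀ hM h1]
    exact mem_ball_zero_iff.1 hξ.1
  have hG0 := Complex.differentiableOn_update_limUnder_of_bddAbove (f := fun ξ => Q ξ⁻¹)
    (Metric.ball_mem_nhds (0 : ℂ) hr0)
    (fun ξ hξ => by
      have h1 := hinv ξ hξ
      have h2 : 1 < ‖ξ⁻¹‖ := (le_max_left _ _).trans_lt h1
      exact ((hQa ξ⁻¹ (by linarith)).comp (analyticAt_inv hξ.2)).differentiableAt.differentiableWithinAt)
    ⟨C, by
      rintro _ ⟨ξ, hξ, rfl⟩
      exact hQb _ (hinv ξ hξ)⟩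
  refine ⟨fun z => F z - u z,
    Function.update (fun ξ => Q ξ⁻¹) 0 (limUnder (𝓝[≠] 0) fun ξ => Q ξ⁻¹), hP, fun ξ hξ => ?_, fun z hz => ?_⟩
  · by_cases h : ξ = 0
    · subst h
      exact hG0.analyticAt (Metric.ball_mem_nhds (0 : ℂ) hr0)
    · have h1 : 0 < ‖ξ‖ := norm_pos_iff.2 h
      have h2 : 1 / 2 ≤ ‖ξ⁻¹‖ := by
        rw [norm_inv, le_inv_comm₀ (by norm_num) h1]
        simpa [disk] using hξ
      refine ((hQa ξ⁻¹ h2).comp (analyticAt_inv h)).congr ?_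
      exact (isOpen_ne.eventually_mem h).mono fun w hw =>
        (Function.update_of_ne hw _ _).symm
  · rw [Function.update_of_ne (inv_ne_zero hz), inv_inv]
    simp [hQ]

/-- A holomorphic difference quotient has a removable singularity at its base point. Applied twice,
this is division with remainder by `z²`. -/
lemma AnalyticAt.dslope_zero {P : ℂ → ℂ} (hP : ∀ z ∈ disk, AnalyticAt ℂ P z) :
    ∀ z ∈ disk, AnalyticAt ℂ (dslope P 0) z := by
  have h1 : ∀ᶠ z in 𝓝ˢ disk, AnalyticAt ℂ P z :=
    eventually_nhdsSet_iff_forall.2 fun z hz => (hP z hz).eventually_analyticAt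
  obtain ⟨O, hO, hsub, hOa⟩ := eventually_nhdsSet_iff_exists.1 h1
  have h0 : (0 : ℂ) ∈ disk := by simp [disk]
  have := (Complex.differentiableOn_dslope (hO.mem_nhds (hsub h0))).2
    fun z hz => (hOa z hz).differentiableAt.differentiableWithinAt
  exact fun z hz => this.analyticAt (hO.mem_nhds (hsub hz))

/-- The first cohomology of `𝒪(-2)` is spanned by the class of `z`. -/
lemma exists_cechD_eq (τ : Hol annulus) : ∃ (c : ℂ) (h : Hol disk × Hol disk),
    τ.1 = c • zp 1 + (cechD 2 0 h).1 := by
  obtain ⟨_, f, hf, rfl⟩ := τ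
  obtain ⟨P, G, hP, hG, h⟩ := exists_laurent hf
  have h1 := AnalyticAt.dslope_zero hP
  have h2 := AnalyticAt.dslope_zero h1
  have hGc : ∀ z ∈ disk, AnalyticAt ℂ (fun ξ => G ξ + P 0) z := fun z hz =>
    (hG z hz).add analyticAt_const
  -- Expand `P` to second order at `0`. The constant term is also regular in `ξ` and joins `G`, the
  -- remainder divisible by `z²` is a coboundary from `U`, and only `P'(0) z` is left.
  refine ⟨dslope P 0 0, (-⟨germ _ (analytic_mem h2), _, h2, rfl⟩,
    ⟨germ _ (analytic_mem hGc), _, hGc, rfl⟩), germ_eq.2 (eventually_ne_zero.mono fun z hz => ?_)⟩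
  change f z = dslope P 0 0 * z ^ (1 : ℤ) +
    (G z⁻¹ + P 0 - z ^ (2 - 0 : ℤ) * -dslope (dslope P 0) 0 z)
  rw [h z hz, dslope_of_ne (dslope P 0) hz, slope_def_field, dslope_of_ne P hz, slope_def_field,
    sub_zero, sub_zero, zpow_one, zpow_ofNat]
  field_simp
  ring

/-- The class of `z` in the first cohomology of `𝒪(-2)` does not vanish. -/
lemma zp_one_ne_cechD (h : Hol disk × Hol disk) : zp 1 ≠ (cechD 2 0 h).1 := by
  obtain ⟨⟨_, P, hP, rfl⟩, ⟨_, G, hG, rfl⟩⟩ := h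
  intro h
  have h1 : ∀ᶠ z in 𝓝ˢ annulus, z ^ (1 : ℤ) = G z⁻¹ - z ^ (2 - 0 : ℤ) * P z := germ_eq.1 h
  have h2 : ∀ᶠ z in 𝓝ˢ annulus, z + z ^ 2 * P z = G z⁻¹ := h1.mono fun z hz => by
    rw [zpow_one, sub_zero, zpow_ofNat] at hz
    linear_combination hz
  rw [eventually_nhdsSet_iff_forall] at h2
  -- The two sides of the identity glue to a bounded entire function. Liouville makes it constant,
  -- whereas its derivative at `0` is 1.
  set H : ℂ → ℂ := fun z => if ‖z‖ ≤ 1 then z + z ^ 2 * P z else G z⁻¹ with hH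
  have hU : ∀ z ∈ disk, H =ᶠ[𝓝 z] fun z => z + z ^ 2 * P z := fun z hz => by
    by_cases h : ‖z‖ < 1 / 2
    · exact (eventually_norm_lt h).mono fun w hw => if_pos (by linarith)
    · exact (h2 z ⟨by linarith, hz⟩).mono fun w hw => by
        simp only [hH, hw, ite_self]
  have hV : ∀ z, 1 < ‖z‖ → H =ᶠ[𝓝 z] fun z => G z⁻¹ := fun z hz =>
    (eventually_lt_norm hz).mono fun w hw => if_neg (not_le.2 hw)
  have hPd : ∀ z ∈ disk, DifferentiableAt ℂ (fun z => z + z ^ 2 * P z) z := fun z hz =>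
    differentiableAt_id.add ((differentiableAt_id.pow 2).mul (hP z hz).differentiableAt)
  have hGm : ∀ z, 1 < ‖z‖ → z⁻¹ ∈ disk := fun z hz => by
    change ‖z⁻¹‖ ≤ 2
    rw [norm_inv]
    linarith [inv_lt_one_of_one_lt₀ hz]
  have hd : Differentiable ℂ H := fun z => by
    by_cases h : ‖z‖ ≤ 2
    · exact (hPd z h).congr_of_eventuallyEq (hU z h)
    · have h1 : 1 < ‖z‖ := by linarith
      have h0 : z ≠ 0 := by rintro rfl; norm_num at h1
      refine DifferentiableAt.congr_of_eventuallyEq ?_ (hV z h1)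
      exact ((hG _ (hGm z h1)).comp (analyticAt_inv h0)).differentiableAt
  have hb : Bornology.IsBounded (Set.range H) := by
    have hc : ContinuousOn G disk := fun z hz => (hG z hz).continuousAt.continuousWithinAt
    obtain ⟨C, hC⟩ := isCompact_disk.exists_bound_of_continuousOn hd.continuous.continuousOn
    obtain ⟨C', hC'⟩ := isCompact_disk.exists_bound_of_continuousOn hc
    refine isBounded_iff_forall_norm_le.2 ⟨max C C', ?_⟩
    rintro _ ⟨z, rfl⟩
    by_cases h : ‖z‖ ≤ 2
    · exact (hC z h).trans (le_max_left _ _)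
    · have h1 : 1 < ‖z‖ := by linarith
      rw [(hV z h1).self_of_nhds]
      exact (hC' _ (hGm z h1)).trans (le_max_right _ _)
  have hconst : H = fun _ => H 0 := funext fun z => hd.apply_eq_apply_of_bounded hb z 0
  have h0 : (0 : ℂ) ∈ disk := by simp [disk]
  have hder : HasDerivAt H (1 + (((2 : ℕ) * (0 : ℂ) ^ (2 - 1) * 1) * P 0 + (0 : ℂ) ^ 2 * deriv P 0)) 0 := by
    refine HasDerivAt.congr_of_eventuallyEq ?_ (hU 0 h0)
    exact (hasDerivAt_id (0 : ℂ)).add (((hasDerivAt_id (0 : ℂ)).pow 2).mul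
      (hP 0 h0).differentiableAt.hasDerivAt)
  rw [hconst] at hder
  have := hder.unique (hasDerivAt_const 0 _)
  norm_num at this

end Germs

/-! ### Cohomology classes through representing cocycles. -/

section Classes

variable {K L : CochainComplex (ModuleCat.{0} ℂ) ℤ}

/-- A closed vector is a morphism out of the one-dimensional space `ℂ`, to which the universal
property of the cycles applies. -/
lemma exists_cycle {i j : ℤ} (hij : i + 1 = j) (z : K.X i) (hz : (K.d i j).hom z = 0) :
    ∃ c : K.cycles i, (K.iCycles i).hom c = z := by
  let k : ModuleCat.of ℂ ℂ ⟶ K.X i := ModuleCat.ofHom (LinearMap.toSpanSingleton ℂ _ z)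
  have hk : k ≫ K.d i j = 0 := by
    ext
    simpa [k] using hz
  refine ⟨(K.liftCycles k j (CochainComplex.next ℤ i |>.trans hij) hk).hom (1 : ℂ), ?_⟩
  have := ConcreteCategory.congr_hom (K.liftCycles_i k j (CochainComplex.next ℤ i |>.trans hij) hk)
    (1 : ℂ)
  refine this.trans ?_
  simp [k]

lemma IsClass.d_eq_zero {i : ℤ} (j : ℤ) {z : K.X i} {y : K.homology i} (h : IsClass K i z y) :
    (K.d i j).hom z = 0 := by
  obtain ⟨c, rfl, -⟩ := h
  exact ConcreteCategory.congr_hom (K.iCycles_d i j) c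

lemma IsClass.exists_of_closed {i j : ℤ} (hij : i + 1 = j) (z : K.X i) (hz : (K.d i j).hom z = 0) :
    ∃ y, IsClass K i z y := by
  obtain ⟨c, hc⟩ := exists_cycle hij z hz
  exact ⟨_, c, hc, rfl⟩

lemma IsClass.exists_rep {i : ℤ} (y : K.homology i) : ∃ z, IsClass K i z y := by
  obtain ⟨c, hc⟩ := (ModuleCat.epi_iff_surjective (K.homologyπ i)).1 inferInstance y
  exact ⟨_, c, rfl, hc⟩

lemma IsClass.sub {i : ℤ} {z z' : K.X i} {y y' : K.homology i} (h : IsClass K i z y)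
    (h' : IsClass K i z' y') : IsClass K i (z - z') (y - y') := by
  obtain ⟨c, rfl, rfl⟩ := h
  obtain ⟨c', rfl, rfl⟩ := h'
  exact ⟨c - c', map_sub _ _ _, map_sub _ _ _⟩

lemma IsClass.add {i : ℤ} {z z' : K.X i} {y y' : K.homology i} (h : IsClass K i z y)
    (h' : IsClass K i z' y') : IsClass K i (z + z') (y + y') := by
  obtain ⟨c, rfl, rfl⟩ := h
  obtain ⟨c', rfl, rfl⟩ := h'
  exact ⟨c + c', map_add _ _ _, map_add _ _ _⟩

lemma IsClass.smul {i : ℤ} {z : K.X i} {y : K.homology i} (a : ℂ) (h : IsClass K i z y) :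
    IsClass K i (a • z) (a • y) := by
  obtain ⟨c, rfl, rfl⟩ := h
  exact ⟨a • c, _root_.map_smul _ _ _, _root_.map_smul _ _ _⟩

/-- Homology is the cokernel of `toCycles`, and cycles embed in the complex; this turns vanishing of
a class into a statement about elements. -/
lemma IsClass.eq_zero_iff {i j : ℤ} (hij : i + 1 = j) {z : K.X j} {y : K.homology j}
    (h : IsClass K j z y) : y = 0 ↔ ∃ w : K.X i, (K.d i j).hom w = z := by
  obtain ⟨c, rfl, rfl⟩ := h
  have hprev : (ComplexShape.up ℤ).prev j = i := by rw [CochainComplex.prev]; omega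
  have hex := ShortComplex.exact_of_g_is_cokernel
    (ShortComplex.mk (K.toCycles i j) (K.homologyπ j) (K.toCycles_comp_homologyπ i j))
    (K.homologyIsCokernel i j hprev)
  have hcomp : ∀ w, (K.iCycles j).hom ((K.toCycles i j).hom w) = (K.d i j).hom w := fun w =>
    ConcreteCategory.congr_hom (K.toCycles_i i j) w
  constructor
  · intro h0
    obtain ⟨w, hw⟩ := (ShortComplex.moduleCat_exact_iff _).1 hex c h0
    exact ⟨w, (hcomp w).symm.trans (congrArg (K.iCycles j).hom hw)⟩
  · rintro ⟨w, hw⟩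
    have : c = (K.toCycles i j).hom w :=
      (ModuleCat.mono_iff_injective (K.iCycles j)).1 inferInstance (hw.symm.trans (hcomp w).symm)
    rw [this]
    exact ConcreteCategory.congr_hom (K.toCycles_comp_homologyπ i j) w

lemma IsClass.eq_iff {i j : ℤ} (hij : i + 1 = j) {z z' : K.X j} {y y' : K.homology j}
    (h : IsClass K j z y) (h' : IsClass K j z' y') :
    y = y' ↔ ∃ w : K.X i, (K.d i j).hom w = z - z' := by
  rw [← sub_eq_zero, (h.sub h').eq_zero_iff hij]

lemma IsClass.map (Φ : K ⟶ L) {i : ℤ} {z : K.X i} {y : K.homology i} (h : IsClass K i z y) :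
    IsClass L i ((Φ.f i).hom z) ((HomologicalComplex.homologyMap Φ i).hom y) := by
  obtain ⟨c, rfl, rfl⟩ := h
  refine ⟨(HomologicalComplex.cyclesMap Φ i).hom c, ?_, ?_⟩
  · exact ConcreteCategory.congr_hom (HomologicalComplex.cyclesMap_i Φ i) c
  · exact (ConcreteCategory.congr_hom (HomologicalComplex.homologyπ_naturality Φ i) c).symm

/-- A morphism of complexes of vector spaces is a quasi-isomorphism if it is injective and
surjective on cohomology classes. -/
lemma quasiIso_of_classes (Φ : K ⟶ L)
    (hinj : ∀ (i j k : ℤ), i + 1 = j → j + 1 = k → ∀ z : K.X j, (K.d j k).hom z = 0 →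
      (∃ w : L.X i, (L.d i j).hom w = (Φ.f j).hom z) → ∃ w : K.X i, (K.d i j).hom w = z)
    (hsurj : ∀ (i j k : ℤ), i + 1 = j → j + 1 = k → ∀ z : L.X j, (L.d j k).hom z = 0 →
      ∃ (z' : K.X j) (w : L.X i), (K.d j k).hom z' = 0 ∧ (L.d i j).hom w = (Φ.f j).hom z' - z) :
    QuasiIso Φ := by
  refine ⟨fun j => ?_⟩
  have h1 : j - 1 + 1 = j := by omega
  rw [quasiIsoAt_iff_isIso_homologyMap, ConcreteCategory.isIso_iff_bijective]
  constructor
  · refine (injective_iff_map_eq_zero (HomologicalComplex.homologyMap Φ j).hom).2 fun y hy => ?_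
    obtain ⟨z, hz⟩ := IsClass.exists_rep y
    rw [hz.eq_zero_iff h1]
    exact hinj _ _ _ h1 rfl z (hz.d_eq_zero _) (((hz.map Φ).eq_zero_iff h1).1 hy)
  · intro y
    obtain ⟨z, hz⟩ := IsClass.exists_rep y
    obtain ⟨z', w, hz', hw⟩ := hsurj _ _ _ h1 rfl z (hz.d_eq_zero _)
    obtain ⟨y', hy'⟩ := IsClass.exists_of_closed rfl z' hz'
    exact ⟨y', ((hy'.map Φ).eq_iff h1 hz).2 ⟨w, hw⟩⟩

end Classes

/-! ### Morphisms of cohesive modules of rank one. -/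

section RankOne

variable {k : Type} [Field k] {A B : DGAlgebra k} {X Y : CohMod A}

open CohMod in
-- By right linearity a morphism is determined by the image of the generator corresponding to `1`;
-- that image is the multiplier.
lemma CohMod.Triv.exists_mul_eq (s : X.Triv) (t : Y.Triv) {n : ℤ} (φ : hom X Y n) :
    ∃ a, Triv.mul s t n a = φ := by
  refine ⟨⟨t.val (φ.1 (s.val.symm 1)), ?_⟩, ?_⟩
  · have := t.val_mem (φ.2.2 0 _ (s.symm_mem A.one_mem))
    rwa [zero_add] at this
  · refine Subtype.ext (LinearMap.ext fun x => ?_)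
    rw [mul_apply, ← t.val_rmul, LinearEquiv.symm_apply_apply, ← φ.2.1, symm_rmul, _root_.one_mul,
      LinearEquiv.symm_apply_apply]

open CohMod in
lemma CohMod.Triv.mul_injective (s : X.Triv) (t : Y.Triv) (n : ℤ) :
    Function.Injective (Triv.mul s t n) := by
  intro a b h
  have h1 : (Triv.mul s t n a).1 (s.val.symm 1) = (Triv.mul s t n b).1 (s.val.symm 1) := by rw [h]
  rw [mul_apply, mul_apply, LinearEquiv.apply_symm_apply, _root_.mul_one, _root_.mul_one] at h1
  exact Subtype.ext (t.val.symm.injective h1)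

open CohMod in
-- Both sides are right linear over `B`, so it suffices to compare them on the image of `j`, where
-- the pulled back trivialization is `f` applied to the original one.
lemma CohMod.pullHom_mul (f : DGAlgebra.Hom A B) (s : X.Triv) (t : Y.Triv) {n : ℤ} (a : A.deg n) :
    pullHom f (Triv.mul s t n a) = Triv.mul (s.pull f) (t.pull f) n ⟨f.f a.1, f.map_deg a.2⟩ := by
  refine pull_hom_ext f fun m e => ?_
  rw [pullHom_j, Triv.mul_apply, Triv.mul_apply]
  apply (t.pull f).val.injective
  rw [LinearEquiv.apply_symm_apply]
  refine (t.pullVal_j f _).trans ?_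
  rw [LinearEquiv.apply_symm_apply, map_mul]
  exact congrArg (f.f a.1 * ·) (s.pullVal_j f _).symm

end RankOne

/-! ### The morphism complexes of `𝒬` in terms of forms. -/

section HomComplex

variable (i j : ℤ)

/-- The morphism `A(i) → A(j)` of `𝒬` given by the multiplications by forms on `U`, `V` and `W`. -/
def mulHom (n : ℤ) : (AU.deg n × AV.deg n × AW.deg (n - 1)) →ₗ[ℂ] Q.Hom (objA i) (objA j) n :=
  (CohMod.Triv.mul (unitTriv AU) (unitTriv AU) n).prodMap
    ((CohMod.Triv.mul (unitTriv AV) (unitTriv AV) n).prodMap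
      (CohMod.Triv.mul ((unitTriv AU).pull resU) ((unitTriv AV).pull resV) (n - 1)))

lemma mulHom_injective (n : ℤ) : Function.Injective (mulHom i j n) :=
  Function.Injective.prodMap (CohMod.Triv.mul_injective _ _ _)
    (Function.Injective.prodMap (CohMod.Triv.mul_injective _ _ _) (CohMod.Triv.mul_injective _ _ _))

lemma exists_mulHom_eq {n : ℤ} (f : Q.Hom (objA i) (objA j) n) : ∃ a, mulHom i j n a = f := by
  obtain ⟨a, ha⟩ := (unitTriv AU).exists_mul_eq (unitTriv AU) f.1
  obtain ⟨b, hb⟩ := (unitTriv AV).exists_mul_eq (unitTriv AV) f.2.1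
  obtain ⟨c, hc⟩ := CohMod.Triv.exists_mul_eq ((unitTriv AU).pull resU) ((unitTriv AV).pull resV) f.2.2
  exact ⟨(a, b, c), Prod.ext ha (Prod.ext hb hc)⟩

/-- The differential of the complex of morphisms from `A(i)` to `A(j)`, in terms of forms. -/
lemma d_mulHom {p q : ℤ} (h : p + 1 = q) (a : AU.deg p × AV.deg p × AW.deg (p - 1))
    (b : AU.deg q × AV.deg q × AW.deg (q - 1)) (h1 : AU.d a.1.1 = b.1.1) (h2 : AV.d a.2.1.1 = b.2.1.1)
    (h3 : - AW.d a.2.2.1 + TrivSqZeroExt.inl (zp (-j)) * resU.f a.1.1 -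
      resV.f a.2.1.1 * TrivSqZeroExt.inl (zp (-i)) = b.2.2.1) :
    Q.d h (mulHom i j p a) = mulHom i j q b := by
  refine Prod.ext (CohMod.Triv.mul_d _ _ h a.1 b.1 h1)
    (Prod.ext (CohMod.Triv.mul_d _ _ h a.2.1 b.2.1 h2) ?_)
  have hq : (0 : ℤ) + p = q - 1 := by omega
  have hq' : p + (0 : ℤ) = q - 1 := by omega
  have hq'' : p - 1 + 1 = q - 1 := by omega
  have m1 : AW.d a.2.2.1 ∈ AW.deg (q - 1) := hq'' ▸ AW.d_mem a.2.2.2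
  have m2 : TrivSqZeroExt.inl (zp (-j)) * resU.f a.1.1 ∈ AW.deg (q - 1) :=
    hq ▸ AW.mul_mem (inl_mem _ (zp (-j))) (resU.map_deg a.1.2)
  have m3 : resV.f a.2.1.1 * TrivSqZeroExt.inl (zp (-i)) ∈ AW.deg (q - 1) :=
    hq' ▸ AW.mul_mem (resV.map_deg a.2.1.2) (inl_mem _ (zp (-i)))
  -- Each of the three terms of the last component is the multiplication by a form, in the
  -- trivializations pulled back to `W`.
  have e1 := CohMod.Triv.mul_d ((unitTriv AU).pull resU) ((unitTriv AV).pull resV) hq'' a.2.2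
    ⟨_, m1⟩ rfl
  have e2 : CohMod.compHom _ _ _ hq (glue j) (CohMod.pullHom resU
      (CohMod.Triv.mul (unitTriv AU) (unitTriv AU) p a.1)) = _ :=
    (congrArg _ (CohMod.pullHom_mul resU (unitTriv AU) (unitTriv AU) a.1)).trans
      (CohMod.Triv.mul_comp _ _ _ hq (form0 (zp (-j))) _ ⟨_, m2⟩ rfl)
  have e3 : CohMod.compHom _ _ _ hq' (CohMod.pullHom resV
      (CohMod.Triv.mul (unitTriv AV) (unitTriv AV) p a.2.1)) (glue i) = _ :=
    (congrArg (fun f => CohMod.compHom _ _ _ hq' f (glue i))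
      (CohMod.pullHom_mul resV (unitTriv AV) (unitTriv AV) a.2.1)).trans
      (CohMod.Triv.mul_comp _ _ _ hq' _ (form0 (zp (-i))) ⟨_, m3⟩ rfl)
  have key : - CohMod.dHom _ _ hq'' (CohMod.Triv.mul ((unitTriv AU).pull resU)
        ((unitTriv AV).pull resV) (p - 1) a.2.2) +
      CohMod.compHom _ _ _ hq (glue j) (CohMod.pullHom resU
        (CohMod.Triv.mul (unitTriv AU) (unitTriv AU) p a.1)) -
      CohMod.compHom _ _ _ hq' (CohMod.pullHom resV
        (CohMod.Triv.mul (unitTriv AV) (unitTriv AV) p a.2.1)) (glue i) =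
      CohMod.Triv.mul ((unitTriv AU).pull resU) ((unitTriv AV).pull resV) (q - 1) b.2.2 := by
    rw [e1, e2, e3, ← map_neg, ← map_add, ← map_sub]
    exact congrArg _ (Subtype.ext h3)
  exact key

end HomComplex

/-! ### Forms by degree. -/

section FormDegrees

variable {S : Set ℂ}

/-- Functions as forms of degree `0`. -/
def form0L : SmoothGerm S →ₗ[ℂ] (Dolb S).deg 0 where
  toFun := form0
  map_add' _ _ := Subtype.ext (TrivSqZeroExt.inl_add _ _ _)
  map_smul' _ _ := Subtype.ext (TrivSqZeroExt.inl_smul _ _ _)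

/-- The forms `x dz̄`. -/
def form1L : SmoothGerm S →ₗ[ℂ] (Dolb S).deg 1 where
  toFun := form1
  map_add' _ _ := Subtype.ext (TrivSqZeroExt.inr_add _ _ _)
  map_smul' _ _ := Subtype.ext (TrivSqZeroExt.inr_smul _ _ _)

lemma exists_form0_eq (a : (Dolb S).deg 0) : ∃ x, form0 x = a :=
  ⟨a.1.fst, Subtype.ext (TrivSqZeroExt.ext rfl (a.2.2 (by norm_num)).symm)⟩

lemma exists_form1_eq (a : (Dolb S).deg 1) : ∃ x, form1 x = a :=
  ⟨a.1.snd, Subtype.ext (TrivSqZeroExt.ext (a.2.1 (by norm_num)).symm rfl)⟩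

lemma form_eq_zero {n : ℤ} (h0 : n ≠ 0) (h1 : n ≠ 1) (a : (Dolb S).deg n) : a = 0 :=
  Subtype.ext (TrivSqZeroExt.ext (a.2.1 h0) (a.2.2 h1))

lemma d_form0 (x : SmoothGerm S) : (Dolb S).d (form0 x).1 = (form1 (dbar S x)).1 := rfl

lemma d_form1 (x : SmoothGerm S) : (Dolb S).d (form1 x).1 = 0 := by
  change TrivSqZeroExt.inr (dbar S (form1 x).1.fst) = _
  rw [show (form1 x).1.fst = 0 from rfl, map_zero]
  rfl

lemma form1_injective : Function.Injective (form1 (S := S)) := fun _ _ h =>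
  TrivSqZeroExt.inr_injective (congrArg Subtype.val h)

lemma form0_injective : Function.Injective (form0 (S := S)) := fun _ _ h =>
  TrivSqZeroExt.inl_injective (congrArg Subtype.val h)

lemma pullForm_form0 {S' : Set ℂ} (h : HolMap S S') (x : SmoothGerm S') :
    h.pullForm.f (form0 x).1 = (form0 (h.pullGerm x)).1 := by
  change TrivSqZeroExt.inl (h.pullGerm x) + TrivSqZeroExt.inr (h.pullGerm 0 * _) = _
  rw [map_zero, zero_mul, TrivSqZeroExt.inr_zero, add_zero]
  rfl

end FormDegrees

/-! ### The comparison of the Čech complex with `𝒬(A(2), A)`. -/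

section Comparison

lemma QC_d {p q : ℤ} (h : p + 1 = q) : QC.d p q = ModuleCat.ofHom (Q.d (x := objA 2) (y := objA 0) h) := by
  subst h
  exact CochainComplex.of_d (fun n => ModuleCat.of ℂ (Q.Hom (objA 2) (objA 0) n))
    (fun n => ModuleCat.ofHom (Q.d (rfl : n + 1 = n + 1))) p

lemma cech_d (i j : ℤ) : (cech i j).d 0 1 = ModuleCat.ofHom (cechD i j) :=
  CochainComplex.of_d cechX (cechDiff i j) 0

/-- The morphism `A(2) → A` of degree `0` given by smooth functions on `U` and `V`. -/
def hom₀ (a b : SmoothGerm disk) : Q.Hom (objA 2) (objA 0) 0 :=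
  mulHom 2 0 0 (form0 a, form0 b, 0)

/-- The morphism `A(2) → A` of degree `1` given by forms on `U` and `V` and a function on `W`. -/
def hom₁ (a b : SmoothGerm disk) (c : SmoothGerm annulus) : Q.Hom (objA 2) (objA 0) 1 :=
  mulHom 2 0 1 (form1 a, form1 b, form0 c)

/-- The morphism `A(2) → A` of degree `2` given by a form on `W`. -/
def hom₂ (c : SmoothGerm annulus) : Q.Hom (objA 2) (objA 0) 2 :=
  mulHom 2 0 2 (0, 0, form1 c)

lemma exists_hom₀_eq (f : Q.Hom (objA 2) (objA 0) 0) : ∃ a b, hom₀ a b = f := by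
  obtain ⟨⟨a, b, c⟩, rfl⟩ := exists_mulHom_eq 2 0 f
  obtain ⟨a, rfl⟩ := exists_form0_eq a
  obtain ⟨b, rfl⟩ := exists_form0_eq b
  rw [form_eq_zero (n := 0 - 1) (by norm_num) (by norm_num) c]
  exact ⟨a, b, rfl⟩

lemma exists_hom₁_eq (f : Q.Hom (objA 2) (objA 0) 1) : ∃ a b c, hom₁ a b c = f := by
  obtain ⟨⟨a, b, c⟩, rfl⟩ := exists_mulHom_eq 2 0 f
  obtain ⟨a, rfl⟩ := exists_form1_eq a
  obtain ⟨b, rfl⟩ := exists_form1_eq b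
  obtain ⟨c, rfl⟩ := exists_form0_eq (S := annulus) c
  exact ⟨a, b, c, rfl⟩

lemma exists_hom₂_eq (f : Q.Hom (objA 2) (objA 0) 2) : ∃ c, hom₂ c = f := by
  obtain ⟨⟨a, b, c⟩, rfl⟩ := exists_mulHom_eq 2 0 f
  obtain ⟨c, rfl⟩ := exists_form1_eq (S := annulus) c
  rw [form_eq_zero (by norm_num) (by norm_num) a, form_eq_zero (by norm_num) (by norm_num) b]
  exact ⟨c, rfl⟩

/-- Forms live in degrees 0 and 1, and the homotopy component over `W` is shifted by one; nothing
remains outside the degrees 0, 1, 2. -/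
lemma hom_eq_zero {n : ℤ} (h0 : n ≠ 0) (h1 : n ≠ 1) (h2 : n ≠ 2) (f : Q.Hom (objA 2) (objA 0) n) :
    f = 0 := by
  obtain ⟨⟨a, b, c⟩, rfl⟩ := exists_mulHom_eq 2 0 f
  rw [form_eq_zero h0 h1 a, form_eq_zero h0 h1 b, form_eq_zero (n := n - 1) (by omega) (by omega) c]
  exact map_zero _

lemma hom₀_inj {a b a' b' : SmoothGerm disk} (h : hom₀ a b = hom₀ a' b') : a = a' ∧ b = b' := by
  have := mulHom_injective _ _ _ h
  exact ⟨form0_injective (congrArg (fun x => x.1) this),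
    form0_injective (congrArg (fun x => x.2.1) this)⟩

lemma hom₁_inj {a b a' b' : SmoothGerm disk} {c c' : SmoothGerm annulus}
    (h : hom₁ a b c = hom₁ a' b' c') : a = a' ∧ b = b' ∧ c = c' := by
  have := mulHom_injective _ _ _ h
  exact ⟨form1_injective (congrArg (fun x => x.1) this),
    form1_injective (congrArg (fun x => x.2.1) this),
    form0_injective (congrArg (fun x => x.2.2) this)⟩

lemma hom₁_sub (a b a' b' : SmoothGerm disk) (c c' : SmoothGerm annulus) :
    hom₁ a b c - hom₁ a' b' c' = hom₁ (a - a') (b - b') (c - c') := by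
  rw [hom₁, hom₁, hom₁, ← map_sub]
  congr 1
  exact Prod.ext (map_sub form1L a a').symm
    (Prod.ext (map_sub form1L b b').symm (map_sub form0L c c').symm)

lemma hom₁_zero : hom₁ 0 0 0 = 0 :=
  (congrArg (mulHom 2 0 1) (Prod.ext (map_zero form1L) (Prod.ext (map_zero form1L)
    (map_zero form0L)))).trans (map_zero _)

lemma hom₀_zero : hom₀ 0 0 = 0 :=
  (congrArg (mulHom 2 0 0) (Prod.ext (map_zero form0L) (Prod.ext (map_zero form0L) rfl))).trans
    (map_zero _)

lemma hom₂_eq_zero {c : SmoothGerm annulus} (h : hom₂ c = 0) : c = 0 := by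
  have := mulHom_injective _ _ _ (h.trans (map_zero (mulHom 2 0 2)).symm)
  exact form1_injective ((congrArg (fun x => x.2.2) this).trans (map_zero form1L).symm)

/-- The gluing maps of `A` and `A(2)` are `1` and `z⁻²`. The last component measures the failure of
the two functions to define one smooth homomorphism `𝒪(2) → 𝒪`. -/
lemma d_hom₀ (a b : SmoothGerm disk) :
    Q.d (rfl : (0 : ℤ) + 1 = 1) (hom₀ a b) =
      hom₁ (dbar disk a) (dbar disk b) (inclU.pullGerm a - inclV.pullGerm b * zp (-2)) := by
  have key := fun h => d_mulHom 2 0 (p := 0) (q := 1) rfl (form0 a, form0 b, 0)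
    (form1 (dbar disk a), form1 (dbar disk b),
      form0 (inclU.pullGerm a - inclV.pullGerm b * zp (-2))) (d_form0 a) (d_form0 b) h
  refine key ?_
  change - AW.d 0 + TrivSqZeroExt.inl (zp (-0)) * resU.f (form0 a).1 -
      resV.f (form0 b).1 * TrivSqZeroExt.inl (zp (-2)) = _
  rw [map_zero, neg_zero, zero_add, pullForm_form0, pullForm_form0]
  have h : zp (-0) = 1 := germ_eq.2 (Eventually.of_forall fun z => by simp)
  rw [h, TrivSqZeroExt.inl_one, one_mul]
  change TrivSqZeroExt.inl _ - TrivSqZeroExt.inl _ * TrivSqZeroExt.inl _ = TrivSqZeroExt.inl _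
  rw [← TrivSqZeroExt.inl_mul, TrivSqZeroExt.inl_sub]

lemma pullForm_form1 {S S' : Set ℂ} (h : HolMap S S') (x : SmoothGerm S') :
    h.pullForm.f (form1 x).1 = (form1 (h.pullGerm x * h.conjDeriv)).1 := by
  change TrivSqZeroExt.inl (h.pullGerm 0) + TrivSqZeroExt.inr (h.pullGerm x * _) = _
  rw [map_zero, TrivSqZeroExt.inl_zero, zero_add]
  rfl

/-- The factors `conjDeriv` come from rewriting `dz̄` and `dξ̄` in the coordinate of `W`. -/
lemma d_hom₁ (a b : SmoothGerm disk) (c : SmoothGerm annulus) :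
    Q.d (rfl : (1 : ℤ) + 1 = 2) (hom₁ a b c) =
      hom₂ (- dbar annulus c + inclU.pullGerm a * inclU.conjDeriv -
        inclV.pullGerm b * inclV.conjDeriv * zp (-2)) := by
  have key := fun h => d_mulHom 2 0 (p := 1) (q := 2) rfl (form1 a, form1 b, form0 c)
    (0, 0, form1 (- dbar annulus c + inclU.pullGerm a * inclU.conjDeriv -
      inclV.pullGerm b * inclV.conjDeriv * zp (-2))) (d_form1 a) (d_form1 b) h
  refine key ?_
  change - AW.d (form0 c).1 + TrivSqZeroExt.inl (zp (-0)) * resU.f (form1 a).1 -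
      resV.f (form1 b).1 * TrivSqZeroExt.inl (zp (-2)) = _
  rw [pullForm_form1, pullForm_form1, d_form0]
  have h : zp (-0) = 1 := germ_eq.2 (Eventually.of_forall fun z => by simp)
  rw [h, TrivSqZeroExt.inl_one, one_mul]
  change -TrivSqZeroExt.inr _ + TrivSqZeroExt.inr _ - TrivSqZeroExt.inr _ * TrivSqZeroExt.inl _ =
    TrivSqZeroExt.inr _
  rw [TrivSqZeroExt.inr_mul_inl, op_smul_eq_mul, ← TrivSqZeroExt.inr_neg,
    ← TrivSqZeroExt.inr_add, ← TrivSqZeroExt.inr_sub]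

lemma dbarTriple_eq (a b : SmoothGerm disk) : dbarTriple a b = hom₁ (dbar disk a) (dbar disk b) 0 := by
  refine Prod.ext rfl (Prod.ext rfl ?_)
  have : (form0 (0 : SmoothGerm annulus)) = 0 := map_zero form0L
  change 0 = CohMod.Triv.mul ((unitTriv AU).pull resU) ((unitTriv AV).pull resV) 0 (form0 0)
  rw [this]
  exact (map_zero _).symm

/-- The component of degree `0` of the comparison morphism. -/
def compare₀ : Hol disk × Hol disk →ₗ[ℂ] Q.Hom (objA 2) (objA 0) 0 :=
  mulHom 2 0 0 ∘ₗ
    (form0L ∘ₗ (splitU ∘ₗ (Hol annulus).subtype ∘ₗ cechD 2 0 +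
      (Hol disk).subtype ∘ₗ LinearMap.fst ℂ _ _)).prod
    ((form0L ∘ₗ (splitV ∘ₗ (Hol annulus).subtype ∘ₗ cechD 2 0 +
      (Hol disk).subtype ∘ₗ LinearMap.snd ℂ _ _)).prod 0)

lemma compare₀_apply (h : Hol disk × Hol disk) :
    compare₀ h = hom₀ (splitU (cechD 2 0 h).1 + h.1.1) (splitV (cechD 2 0 h).1 + h.2.1) := rfl

/-- The component of degree `1` of the comparison morphism. -/
def compare₁ : Hol annulus →ₗ[ℂ] Q.Hom (objA 2) (objA 0) 1 :=
  mulHom 2 0 1 ∘ₗ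
    (form1L ∘ₗ (dbar disk).toLinearMap ∘ₗ splitU ∘ₗ (Hol annulus).subtype).prod
    ((form1L ∘ₗ (dbar disk).toLinearMap ∘ₗ splitV ∘ₗ (Hol annulus).subtype).prod 0)

lemma compare₁_apply (τ : Hol annulus) :
    compare₁ τ = hom₁ (dbar disk (splitU τ.1)) (dbar disk (splitV τ.1)) 0 := by
  have : (form0 (0 : SmoothGerm annulus)) = 0 := map_zero form0L
  rw [hom₁, this]
  rfl

lemma zp_mul_cancel (x : SmoothGerm annulus) : zp 2 * (zp (-2) * x) = x := by
  rw [← mul_assoc, zp_mul_zp 2 (-2) (by norm_num), one_mul]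

lemma zp_mul_cancel' (x : SmoothGerm annulus) : zp (-2) * (zp 2 * x) = x := by
  rw [← mul_assoc, zp_mul_zp (-2) 2 (by norm_num), one_mul]

/-- A pair of functions is closed over `W` if the components over `U` and `V` agree there. -/
lemma glue_eq_iff (a b : SmoothGerm disk) :
    inclU.pullGerm a - inclV.pullGerm b * zp (-2) = 0 ↔
      zp 2 * inclU.pullGerm a = inclV.pullGerm b := by
  rw [sub_eq_zero, mul_comm]
  constructor
  · intro h
    rw [h, zp_mul_cancel]
  · intro h
    rw [← h, zp_mul_cancel']

/-- The splitting of `h_V - z² h_U`, added to `(h_U, h_V)`, is a pair that agrees on `W`, so the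
last component vanishes; `h_U` and `h_V` themselves are killed by `∂̄`. -/
lemma d_compare₀ (h : Hol disk × Hol disk) :
    Q.d (rfl : (0 : ℤ) + 1 = 1) (compare₀ h) = compare₁ (cechD 2 0 h) := by
  rw [compare₀_apply, compare₁_apply, d_hom₀, map_add, map_add, (mem_Hol_iff _).1 h.1.2,
    (mem_Hol_iff _).1 h.2.2, add_zero, add_zero]
  congr 1
  rw [glue_eq_iff, map_add, map_add, mul_add]
  have h1 := zp_two_mul_splitU_sub (cechD 2 0 h).1
  have h2 : (cechD 2 0 h).1 = inclV.pullGerm h.2.1 - zp 2 * inclU.pullGerm h.1.1 := rfl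
  linear_combination h1 + h2

/-- If `z² μ_U - μ_V` is holomorphic on `W` then `(∂̄μ_U, ∂̄μ_V, 0)` is closed. -/
lemma d_dbarTriple (μU μV : SmoothGerm disk)
    (h : zp 2 * inclU.pullGerm μU - inclV.pullGerm μV ∈ Hol annulus) :
    Q.d (rfl : (1 : ℤ) + 1 = 2) (dbarTriple μU μV) = 0 := by
  -- The last component of the differential is `∂̄(μ_U - z⁻² μ_V)`, since the holomorphic factor
  -- `z⁻²` passes through `∂̄`.
  have h1 : zp (-2) * (zp 2 * inclU.pullGerm μU - inclV.pullGerm μV) =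
      inclU.pullGerm μU - inclV.pullGerm μV * zp (-2) := by
    rw [mul_sub, zp_mul_cancel', mul_comm (zp (-2))]
  have h2 := (mem_Hol_iff _).1 (zp_mul_hol (-2) h)
  rw [h1, map_sub, (dbar annulus).leibniz, dbar_zp, HolMap.dbar_pull, HolMap.dbar_pull] at h2
  simp only [smul_eq_mul, mul_zero, zero_add] at h2
  rw [dbarTriple_eq, d_hom₁, map_zero, neg_zero, zero_add, mul_comm _ (zp (-2)), h2]
  exact (mulHom 2 0 2).map_zero.symm ▸ congrArg (mulHom 2 0 2)
    (Prod.ext rfl (Prod.ext rfl (map_zero form1L)))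

lemma d_compare₁ (τ : Hol annulus) : Q.d (rfl : (1 : ℤ) + 1 = 2) (compare₁ τ) = 0 := by
  rw [compare₁_apply, ← dbarTriple_eq]
  exact d_dbarTriple _ _ (by rw [zp_two_mul_splitU_sub]; exact τ.2)

/-- The components of the comparison morphism. -/
def compareX : ∀ n : ℤ, cechX n ⟶ ModuleCat.of ℂ (Q.Hom (objA 2) (objA 0) n)
  | 0 => ModuleCat.ofHom compare₀
  | 1 => ModuleCat.ofHom compare₁
  | Int.ofNat (_ + 2) => 0
  | Int.negSucc _ => 0

lemma compareX_comm : ∀ n : ℤ, compareX n ≫ ModuleCat.ofHom (Q.d (rfl : n + 1 = n + 1)) =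
    cechDiff 2 0 n ≫ compareX (n + 1)
  | 0 => ModuleCat.hom_ext (LinearMap.ext d_compare₀)
  | 1 => ModuleCat.hom_ext (LinearMap.ext d_compare₁)
  | Int.ofNat (_ + 2) => Limits.zero_comp.trans Limits.zero_comp.symm
  | Int.negSucc _ => Limits.zero_comp.trans Limits.zero_comp.symm

/-- The comparison of the Čech complex with the complex of morphisms of `𝒬`. -/
def compare : cech 2 0 ⟶ QC :=
  CochainComplex.ofHom (X := cech 2 0) (Y := QC) compareX fun n =>
    (congrArg (compareX n ≫ ·) (QC_d rfl)).trans ((compareX_comm n).trans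
      (congrArg (· ≫ compareX (n + 1)) (CochainComplex.of_d cechX (cechDiff 2 0) n)).symm)

lemma compare_f_one (τ : Hol annulus) : (compare.f 1).hom (toCech τ) = compare₁ τ := rfl

lemma cech_eq_zero {n : ℤ} (h0 : n ≠ 0) (h1 : n ≠ 1) (x : (cech 2 0).X n) : x = 0 := by
  change cechX n at x
  match n, h0, h1, x with
  | 0, h0, _, _ => exact absurd rfl h0
  | 1, _, h1, _ => exact absurd rfl h1
  | Int.ofNat (_ + 2), _, _, _ => rfl
  | Int.negSucc _, _, _, _ => rfl

/-- The forms `(∂̄μ_U, ∂̄μ_V, 0)` of all smooth splittings of `τ` are cohomologous. -/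
lemma d_eq_dbarTriple_sub (τ : Hol annulus) (μU μV : SmoothGerm disk) (h : IsSplit τ μU μV) :
    Q.d (rfl : (0 : ℤ) + 1 = 1) (hom₀ (μU - splitU τ.1) (μV - splitV τ.1)) =
      dbarTriple μU μV - compare₁ τ := by
  have h' : zp 2 * inclU.pullGerm μU - inclV.pullGerm μV = τ.1 := h
  have h1 := zp_two_mul_splitU_sub τ.1
  rw [d_hom₀, dbarTriple_eq, compare₁_apply, hom₁_sub, map_sub, map_sub, sub_zero]
  congr 1
  rw [glue_eq_iff, map_sub, map_sub]
  linear_combination h' - h1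

/-- If `(a, b)` bounds the image of `τ`, then `a - μ_U` and `b - μ_V` are holomorphic, and their
Čech coboundary is `τ` because `a` and `b` agree on `W`. -/
lemma compare₁_inj (τ : Hol annulus) (f : Q.Hom (objA 2) (objA 0) 0)
    (h : Q.d (rfl : (0 : ℤ) + 1 = 1) f = compare₁ τ) : ∃ w, cechD 2 0 w = τ := by
  obtain ⟨a, b, rfl⟩ := exists_hom₀_eq f
  rw [d_hom₀, compare₁_apply] at h
  obtain ⟨ha, hb, hab⟩ := hom₁_inj h
  rw [glue_eq_iff] at hab
  refine ⟨(⟨a - splitU τ.1, ?_⟩, ⟨b - splitV τ.1, ?_⟩), Subtype.ext ?_⟩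
  · rw [mem_Hol_iff, map_sub, ha, sub_self]
  · rw [mem_Hol_iff, map_sub, hb, sub_self]
  · change inclV.pullGerm (b - splitV τ.1) - zp 2 * inclU.pullGerm (a - splitU τ.1) = τ.1
    have h1 := zp_two_mul_splitU_sub τ.1
    rw [map_sub, map_sub]
    linear_combination h1 - hab

/-- Primitives `α`, `β` of the two forms exist on the disks. Closedness says that `c - α + z⁻² β` is
holomorphic on `W`; multiplied by `-z²` it is the wanted cocycle. -/
lemma compare₁_surj (f : Q.Hom (objA 2) (objA 0) 1) (h : Q.d (rfl : (1 : ℤ) + 1 = 2) f = 0) :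
    ∃ τ w, Q.d (rfl : (0 : ℤ) + 1 = 1) w = compare₁ τ - f := by
  obtain ⟨a, b, c, rfl⟩ := exists_hom₁_eq f
  obtain ⟨α, rfl⟩ := dbar_surjective isCompact_disk a
  obtain ⟨β, rfl⟩ := dbar_surjective isCompact_disk b
  rw [d_hom₁] at h
  have h' := hom₂_eq_zero h
  let c' := c - inclU.pullGerm α + zp (-2) * inclV.pullGerm β
  have hc' : c' ∈ Hol annulus := by
    rw [mem_Hol_iff, map_add, map_sub, (dbar annulus).leibniz, dbar_zp, HolMap.dbar_pull,
      HolMap.dbar_pull]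
    simp only [smul_eq_mul, mul_zero, add_zero]
    linear_combination -h'
  let τ : Hol annulus := ⟨-(zp 2 * c'), neg_mem (zp_mul_hol 2 hc')⟩
  refine ⟨τ, hom₀ (splitU τ.1 - α) (splitV τ.1 - β), ?_⟩
  rw [d_hom₀, compare₁_apply, hom₁_sub, map_sub, map_sub]
  congr 1
  have h1 := zp_two_mul_splitU_sub τ.1
  have h2 : zp (-2) * τ.1 = -c' := by
    change zp (-2) * -(zp 2 * c') = -c'
    rw [mul_neg, zp_mul_cancel']
  rw [← h1, mul_sub, zp_mul_cancel'] at h2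
  rw [map_sub, map_sub]
  linear_combination h2

lemma compare₀_inj (h : Hol disk × Hol disk) (hd : cechD 2 0 h = 0) (h0 : compare₀ h = 0) :
    h = 0 := by
  rw [compare₀_apply, hd, ← hom₀_zero] at h0
  obtain ⟨ha, hb⟩ := hom₀_inj h0
  rw [ZeroMemClass.coe_zero, map_zero, zero_add] at ha hb
  exact Prod.ext (Subtype.ext ha) (Subtype.ext hb)

/-- Closed pairs are holomorphic and have zero Čech coboundary. The splitting of `0` is `0`, so
`compare₀` leaves such a pair unchanged. -/
lemma compare₀_surj (f : Q.Hom (objA 2) (objA 0) 0) (hf : Q.d (rfl : (0 : ℤ) + 1 = 1) f = 0) :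
    ∃ h, cechD 2 0 h = 0 ∧ compare₀ h = f := by
  obtain ⟨a, b, rfl⟩ := exists_hom₀_eq f
  rw [d_hom₀, ← hom₁_zero] at hf
  obtain ⟨ha, hb, hab⟩ := hom₁_inj hf
  rw [glue_eq_iff] at hab
  let h : Hol disk × Hol disk := (⟨a, (mem_Hol_iff a).2 ha⟩, ⟨b, (mem_Hol_iff b).2 hb⟩)
  have hd : cechD 2 0 h = 0 := by
    refine Subtype.ext ?_
    change inclV.pullGerm b - zp 2 * inclU.pullGerm a = 0
    rw [hab, sub_self]
  refine ⟨h, hd, ?_⟩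
  rw [compare₀_apply, hd, ZeroMemClass.coe_zero, map_zero, map_zero, zero_add, zero_add]

/-- The Čech complex has no term in degree 2. Solving `∂̄` on the annulus shows that the extra
degree of `𝒬(A(2), A)` contributes no cohomology. -/
lemma compare₂_surj (f : Q.Hom (objA 2) (objA 0) 2) :
    ∃ w, Q.d (rfl : (1 : ℤ) + 1 = 2) w = -f := by
  obtain ⟨c, rfl⟩ := exists_hom₂_eq f
  obtain ⟨γ, rfl⟩ := dbar_surjective isCompact_annulus c
  refine ⟨hom₁ 0 0 γ, ?_⟩
  rw [d_hom₁, map_zero, map_zero, zero_mul, zero_mul, zero_mul, add_zero, sub_zero]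
  exact (congrArg (mulHom 2 0 2) (a₂ := -(0, 0, form1 (dbar annulus γ)))
    (Prod.ext neg_zero.symm (Prod.ext neg_zero.symm (map_neg form1L _)))).trans (map_neg _ _)

lemma quasiIso_compare : QuasiIso compare := by
  refine quasiIso_of_classes compare ?_ ?_
  · rintro i j k hij hjk z hz ⟨w, hw⟩
    by_cases h0 : j = 0
    · subst h0
      obtain rfl : i = -1 := by omega
      obtain rfl : k = 1 := by omega
      refine ⟨0, ?_⟩
      have hw' : w = 0 := hom_eq_zero (by norm_num) (by norm_num) (by norm_num) w
      rw [hw', map_zero] at hw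
      rw [cech_d] at hz
      rw [map_zero]
      exact (compare₀_inj z hz hw.symm).symm
    by_cases h1 : j = 1
    · subst h1
      obtain rfl : i = 0 := by omega
      rw [QC_d hij] at hw
      obtain ⟨v, hv⟩ := compare₁_inj z w hw
      exact ⟨v, by rw [cech_d]; exact hv⟩
    · exact ⟨0, by rw [map_zero, cech_eq_zero h0 h1 z]⟩
  · rintro i j k hij hjk z hz
    rw [QC_d hjk] at hz
    rw [QC_d hij]
    by_cases h0 : j = 0
    · subst h0
      obtain rfl : k = 1 := by omega
      obtain ⟨h, hd, rfl⟩ := compare₀_surj z hz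
      refine ⟨h, 0, by rw [cech_d]; exact hd, ?_⟩
      rw [map_zero]
      exact (sub_self _).symm
    by_cases h1 : j = 1
    · subst h1
      obtain rfl : i = 0 := by omega
      obtain rfl : k = 2 := by omega
      obtain ⟨τ, w, hw⟩ := compare₁_surj z hz
      exact ⟨τ, w, cech_eq_zero (by norm_num) (by norm_num) _, hw⟩
    by_cases h2 : j = 2
    · subst h2
      obtain rfl : i = 1 := by omega
      obtain ⟨w, hw⟩ := compare₂_surj z
      refine ⟨0, w, map_zero _, hw.trans ?_⟩
      rw [map_zero]
      exact (zero_sub _).symm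
    · refine ⟨0, 0, map_zero _, ?_⟩
      rw [map_zero, map_zero, hom_eq_zero h0 h1 h2 z]
      exact (sub_zero _).symm

/-- The components over `U` and `V` of a morphism `A(2) → A` of degree `1` are exact. -/
lemma exists_d_eq_components (f : Q.Hom (objA 2) (objA 0) 1) :
    (∃ a, (cohCat AU).d (zero_add 1) a = f.1) ∧ ∃ b, (cohCat AV).d (zero_add 1) b = f.2.1 := by
  obtain ⟨a, b, c, rfl⟩ := exists_hom₁_eq f
  obtain ⟨α, rfl⟩ := dbar_surjective isCompact_disk a
  obtain ⟨β, rfl⟩ := dbar_surjective isCompact_disk b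
  exact ⟨⟨_, CohMod.Triv.mul_d (unitTriv AU) (unitTriv AU) (zero_add 1) (form0 α) _ (d_form0 α)⟩,
    ⟨_, CohMod.Triv.mul_d (unitTriv AV) (unitTriv AV) (zero_add 1) (form0 β) _ (d_form0 β)⟩⟩

end Comparison

/-! ### `Ext¹` and short exact sequences in an abelian category. -/

section Extensions

open Pretriangulated DerivedCategory Limits Abelian

universe w w' v u

variable {C : Type u} [Category.{v} C] [Abelian C]

/-- This is the long exact homology sequence of the triangle: the outer objects sit in degree 0, so
the neighbouring terms `H⁻¹` of `Y` and `H¹` of `X` vanish. -/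
lemma shortExact_of_distTriang [HasDerivedCategory.{w} C] {X E Y : C} (f : X ⟶ E) (g : E ⟶ Y)
    (δ : (singleFunctor C 0).obj Y ⟶ ((singleFunctor C 0).obj X)⟦(1 : ℤ)⟧)
    (hT : Triangle.mk ((singleFunctor C 0).map f) ((singleFunctor C 0).map g) δ ∈
      distTriang (DerivedCategory C)) :
    ∃ w : f ≫ g = 0, (ShortComplex.mk f g w).ShortExact := by
  have w : f ≫ g = 0 := by
    apply (singleFunctor C 0).map_injective
    rw [Functor.map_comp, Functor.map_zero]
    exact comp_distTriang_mor_zero₁₂ _ hT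
  let e := singleFunctorCompHomologyFunctorIso C 0
  have hf : Mono ((homologyFunctor C 0).map ((singleFunctor C 0).map f)) :=
    (HomologySequence.mono_homologyMap_mor₁_iff _ hT (-1) 0 (by norm_num)).2
      ((isZero_of_isGE ((singleFunctor C 0).obj Y) 0 (-1) (by norm_num)).eq_of_src _ _)
  have hg : Epi ((homologyFunctor C 0).map ((singleFunctor C 0).map g)) :=
    (HomologySequence.epi_homologyMap_mor₂_iff _ hT 0 1 (by norm_num)).2
      ((isZero_of_isLE ((singleFunctor C 0).obj X) 0 1 (by norm_num)).eq_of_tgt _ _)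
  have ex := HomologySequence.exact₂ _ hT 0
  refine ⟨w, ?_⟩
  have hf' : f = e.inv.app X ≫ (homologyFunctor C 0).map ((singleFunctor C 0).map f) ≫
    e.hom.app E := (NatIso.naturality_1 e f).symm
  have hg' : g = e.inv.app E ≫ (homologyFunctor C 0).map ((singleFunctor C 0).map g) ≫
    e.hom.app Y := (NatIso.naturality_1 e g).symm
  have mf : Mono f := by
    rw [hf']
    infer_instance
  have eg : Epi g := by
    rw [hg']
    infer_instance
  refine { exact := ShortComplex.exact_of_iso (ShortComplex.isoMk (e.app X) (e.app E) (e.app Y)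
      (e.hom.naturality f).symm (e.hom.naturality g).symm) ex, mono_f := mf, epi_g := eg }

/-- Every element of `Ext¹` is the class of an extension. -/
lemma exists_extClass_eq [HasExt.{w'} C] {X Y : C} (x : Ext.{w'} Y X 1) :
    ∃ (E : C) (f : X ⟶ E) (g : E ⟶ Y) (w : f ≫ g = 0) (h : (ShortComplex.mk f g w).ShortExact),
      h.extClass = x := by
  let := HasDerivedCategory.standard C
  -- The class is a morphism from `Y` to the shift of `X`; the middle term of its triangle will be
  -- the extension.
  obtain ⟨E', f', g', hT⟩ := distinguished_cocone_triangle₂ (C := DerivedCategory C) x.hom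
  -- The heart is closed under extensions, so `E'` comes from an object of `C`.
  have h1 : E'.IsGE 0 := TStructure.t.isGE₂ _ hT 0
    (inferInstanceAs (((singleFunctor C 0).obj X).IsGE 0))
    (inferInstanceAs (((singleFunctor C 0).obj Y).IsGE 0))
  have h2 : E'.IsLE 0 := TStructure.t.isLE₂ _ hT 0
    (inferInstanceAs (((singleFunctor C 0).obj X).IsLE 0))
    (inferInstanceAs (((singleFunctor C 0).obj Y).IsLE 0))
  obtain ⟨E, ⟨i⟩⟩ := exists_iso_singleFunctor_obj_of_isGE_of_isLE E' 0
  obtain ⟨f, hf⟩ := (singleFunctor C 0).map_surjective (f' ≫ i.hom)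
  obtain ⟨g, hg⟩ := (singleFunctor C 0).map_surjective (i.inv ≫ g')
  have hT' : Triangle.mk ((singleFunctor C 0).map f) ((singleFunctor C 0).map g) x.hom ∈
      distTriang (DerivedCategory C) := by
    refine isomorphic_distinguished _ hT _ (Triangle.isoMk _ _ (Iso.refl _) i.symm (Iso.refl _)
      ?_ ?_ ?_)
    · change (singleFunctor C 0).map f ≫ i.inv = 𝟙 _ ≫ f'
      rw [hf, Category.assoc, i.hom_inv_id, Category.comp_id, Category.id_comp]
    · change (singleFunctor C 0).map g ≫ 𝟙 _ = i.inv ≫ g'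
      rw [hg, Category.comp_id]
    · change x.hom ≫ (𝟙 _)⟦1⟧' = 𝟙 _ ≫ x.hom
      rw [CategoryTheory.Functor.map_id]
      exact (Category.comp_id _).trans (Category.id_comp _).symm
  obtain ⟨w, h⟩ := shortExact_of_distTriang f g _ hT'
  refine ⟨E, f, g, w, h, ?_⟩
  -- The triangle of the sequence and that of `x` share the maps `f` and `g`. The induced map on the
  -- third terms is the identity because `g` is an epimorphism, so the connecting maps coincide.
  obtain ⟨c, hc1, hc2⟩ := complete_distinguished_triangle_morphism _ _
    h.singleTriangle_distinguished hT' (𝟙 _) (𝟙 _) rfl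
  obtain ⟨γ, rfl⟩ := (singleFunctor C 0).map_surjective c
  have hγ : γ = 𝟙 Y := by
    have := h.epi_g
    rw [← cancel_epi g, Category.comp_id]
    apply (singleFunctor C 0).map_injective
    rw [Functor.map_comp]
    exact hc1.trans (Category.id_comp _)
  subst hγ
  refine Ext.ext ?_
  rw [ShortComplex.ShortExact.extClass_hom]
  change h.singleδ ≫ (𝟙 _)⟦1⟧' = (singleFunctor C 0).map (𝟙 Y) ≫ x.hom at hc2
  rwa [CategoryTheory.Functor.map_id, CategoryTheory.Functor.map_id, Category.comp_id, Category.id_comp] at hc2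

/-- An extension of class zero splits. -/
lemma exists_section_of_extClass_eq_zero [HasExt.{w'} C] {S : ShortComplex C} (h : S.ShortExact)
    (h0 : h.extClass = 0) : ∃ s : S.X₃ ⟶ S.X₂, s ≫ S.g = 𝟙 _ := by
  -- The obstruction to lifting the identity through `S.g` is its product with the extension class.
  obtain ⟨y, hy⟩ := Ext.covariant_sequence_exact₃ S.X₃ h (Ext.mk₀ (𝟙 S.X₃)) (n₁ := 1) rfl
    (by rw [h0, Ext.comp_zero])
  obtain ⟨s, rfl⟩ := (Ext.mk₀_bijective _ _).2 y
  refine ⟨s, (Ext.mk₀_bijective _ _).1 ?_⟩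
  rw [← hy, Ext.mk₀_comp_mk₀]

end Extensions

/-! ### Classes of extensions of sheaves of modules. -/

section ExtnClass

open Abelian

variable {M N : SheafOfModules.{0} structSheaf}

lemma Extn.exists_cls_eq (x : Ext M N 1) : ∃ S : Extn M N, S.cls = x := by
  obtain ⟨E, f, g, w, h, rfl⟩ := exists_extClass_eq x
  exact ⟨⟨E, f, g, w, h⟩, rfl⟩

lemma Extn.exists_section_of_cls_eq_zero (S : Extn M N) (h : S.cls = 0) :
    ∃ s : M ⟶ S.E, s ≫ S.g = 𝟙 M := exists_section_of_extClass_eq_zero S.exact h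

/-- A morphism of extensions which is the multiplication by `c` on the subobjects and the identity
on the quotients multiplies the class by `c`. -/
lemma Extn.cls_eq_smul (S S' : Extn M N) (c : ℂ) (φ : S.E ⟶ S'.E)
    (hf : S.f ≫ φ = (c • 𝟙 N) ≫ S'.f) (hg : φ ≫ S'.g = S.g) : S'.cls = c • S.cls := by
  have := ShortComplex.ShortExact.extClass_naturality S.exact S'.exact
    ⟨c • 𝟙 N, φ, 𝟙 M, hf.symm, by rw [Category.comp_id]; exact hg⟩
  rw [Ext.smul_eq_comp_mk₀]
  exact (this.trans (Ext.mk₀_id_comp _)).symm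

end ExtnClass

open TopologicalSpace Opposite

/-! ### Exactness on sections and gluing. -/

section SheafExact

open Limits

/-- The presheaf image of `g` becomes a monomorphism and an epimorphism into `M` after
sheafification, hence an isomorphism, so its inclusion is locally bijective. The factor onto the
image is surjective on sections. -/
lemma isLocallySurjective_of_epi {E M : SheafOfModules.{0} structSheaf} (g : E ⟶ M) [Epi g] :
    TopCat.Presheaf.IsLocallySurjective ((PresheafOfModules.toPresheaf _).map g.val) := by
  let F := PresheafOfModules.sheafification (𝟙 structSheaf.obj)
  let adj := PresheafOfModules.sheafificationAdjunction (𝟙 structSheaf.obj)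
  let G := SheafOfModules.forget structSheaf ⋙ PresheafOfModules.restrictScalars (𝟙 structSheaf.obj)
  let p := factorThruImage (G.map g)
  let i := image.ι (G.map g)
  have hpi : p ≫ i = G.map g := image.fac _
  -- The counit of the sheafification adjunction is an isomorphism, so this map is `g` up to
  -- isomorphism.
  have h1 : Epi (F.map (G.map g)) := by
    have h : F.map (G.map g) = adj.counit.app E ≫ g ≫ inv (adj.counit.app M) := by
      rw [← Category.assoc, IsIso.eq_comp_inv]
      exact adj.counit.naturality g
    rw [h]
    infer_instance
  have h2 : Epi (F.map i) := by
    rw [← hpi, F.map_comp] at h1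
    exact epi_of_epi (F.map p) (F.map i)
  have h3 : Mono (F.map i) := inferInstance
  have h4 : IsIso (F.map i) := isIso_of_mono_of_epi _
  have h6 : (Opens.grothendieckTopology PLine).W ((PresheafOfModules.toPresheaf _).map i) :=
    (GrothendieckTopology.W_iff _ _).2
      (inferInstance : IsIso ((SheafOfModules.toSheaf structSheaf).map (F.map i)))
  have h7 := ((GrothendieckTopology.W_iff_isLocallyBijective _ _).1 h6).2
  have hp : ∀ ⦃X⦄, Function.Surjective (p.app X).hom :=
    (PresheafOfModules.epi_iff_surjective p).1 inferInstance
  have h8 : Presheaf.IsLocallySurjective (Opens.grothendieckTopology PLine)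
      ((PresheafOfModules.toPresheaf _).map p) :=
    Presheaf.isLocallySurjective_of_surjective _ _ fun U => hp (X := U)
  have h9 := Presheaf.isLocallySurjective_comp (J := Opens.grothendieckTopology PLine)
    ((PresheafOfModules.toPresheaf _).map p) ((PresheafOfModules.toPresheaf _).map i)
  rw [← Functor.map_comp, hpi] at h9
  exact h9

/-- Evaluation at `Ω` preserves kernels, so exactness on the left holds over `Ω` itself, without
shrinking. -/
lemma exists_app_eq {N E M : SheafOfModules.{0} structSheaf} (f : N ⟶ E) (g : E ⟶ M)
    (w : f ≫ g = 0) (h : (ShortComplex.mk f g w).ShortExact) (Ω : Opens PLine)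
    (e : E.val.obj (op Ω)) (he : g.val.app (op Ω) e = 0) :
    ∃! n : N.val.obj (op Ω), f.val.app (op Ω) n = e := by
  have : Mono f := h.mono_f
  have : (SheafOfModules.evaluation structSheaf (op Ω)).PreservesZeroMorphisms := ⟨fun _ _ => rfl⟩
  have h1 := h.exact.map_of_mono_of_preservesKernel (SheafOfModules.evaluation structSheaf (op Ω)) inferInstance inferInstance
  have h2 : Mono ((SheafOfModules.evaluation structSheaf (op Ω)).map f) := inferInstance
  have h3 := (ModuleCat.mono_iff_injective _).1 h2
  rw [ShortComplex.moduleCat_exact_iff] at h1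
  obtain ⟨n, hn⟩ := h1 e he
  exact ⟨n, hn, fun n' hn' => h3 (hn'.trans hn.symm)⟩

variable {M N : SheafOfModules.{0} structSheaf}

/-- The restriction of sections of a sheaf of modules. -/
def res (M : SheafOfModules.{0} structSheaf) {Ω Ω' : Opens PLine} (h : Ω' ≤ Ω) :
    M.val.obj (op Ω) →+ M.val.obj (op Ω') := (M.val.presheaf.map (homOfLE h).op).hom

/-- The restriction of functions. -/
def resO {Ω Ω' : Opens PLine} (h : Ω' ≤ Ω) :
    structSheaf.obj.obj (op Ω) →+* structSheaf.obj.obj (op Ω') :=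
  (structSheaf.obj.map (homOfLE h).op).hom

lemma res_self {Ω : Opens PLine} (h : Ω ≤ Ω) (m : M.val.obj (op Ω)) : res M h m = m :=
  ConcreteCategory.congr_hom (M.val.presheaf.map_id (op Ω)) m

lemma res_res {Ω Ω' Ω'' : Opens PLine} (h : Ω' ≤ Ω) (h' : Ω'' ≤ Ω') (m : M.val.obj (op Ω)) :
    res M h' (res M h m) = res M (h'.trans h) m :=
  (ConcreteCategory.congr_hom (M.val.presheaf.map_comp (homOfLE h).op (homOfLE h').op) m).symm

lemma res_smul {Ω Ω' : Opens PLine} (h : Ω' ≤ Ω) (r : structSheaf.obj.obj (op Ω))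
    (m : M.val.obj (op Ω)) : res M h (r • m) = resO h r • res M h m :=
  PresheafOfModules.map_smul M.val (homOfLE h).op r m

lemma app_res (f : M ⟶ N) {Ω Ω' : Opens PLine} (h : Ω' ≤ Ω) (m : M.val.obj (op Ω)) :
    f.val.app (op Ω') (res M h m) = res N h (f.val.app (op Ω) m) :=
  PresheafOfModules.naturality_apply f.val (homOfLE h).op m

lemma eq_of_res {ι : Type} {Ω : Opens PLine} (B : ι → Opens PLine) (hB : ∀ i, B i ≤ Ω)
    (hcov : Ω ≤ iSup B) {m m' : M.val.obj (op Ω)} (h : ∀ i, res M (hB i) m = res M (hB i) m') :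
    m = m' :=
  TopCat.Sheaf.eq_of_locally_eq' (⟨M.val.presheaf, M.isSheaf⟩ : TopCat.Sheaf Ab PLine) B Ω
    (fun i => homOfLE (hB i)) hcov m m' h

lemma exists_res_eq {ι : Type} {Ω : Opens PLine} (B : ι → Opens PLine) (hB : ∀ i, B i ≤ Ω)
    (hcov : Ω ≤ iSup B) (s : ∀ i, M.val.obj (op (B i)))
    (h : ∀ i j (D : Opens PLine) (h1 : D ≤ B i) (h2 : D ≤ B j), res M h1 (s i) = res M h2 (s j)) :
    ∃ m : M.val.obj (op Ω), ∀ i, res M (hB i) m = s i := by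
  let s' : ∀ i, ToType (M.val.presheaf.obj (op (B i))) := s
  obtain ⟨m, hm, -⟩ := TopCat.Sheaf.existsUnique_gluing'
    (⟨M.val.presheaf, M.isSheaf⟩ : TopCat.Sheaf Ab PLine) B Ω (fun i => homOfLE (hB i)) hcov s'
    (fun i j => h i j (B i ⊓ B j) inf_le_left inf_le_right)
  exact ⟨m, hm⟩

lemma exists_local_lift (g : M ⟶ N) [Epi g] {Ω : Opens PLine} (n : N.val.obj (op Ω))
    {x : OnePoint ℂ} (hx : x ∈ Ω) :
    ∃ (B : Opens PLine) (h : B ≤ Ω) (m : M.val.obj (op B)), x ∈ B ∧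
      g.val.app (op B) m = res N h n := by
  obtain ⟨B, h, ⟨m, hm⟩, hxB⟩ :=
    (TopCat.Presheaf.isLocallySurjective_iff _).1 (isLocallySurjective_of_epi g) Ω n x hx
  exact ⟨B, h, m, hxB, hm⟩

end SheafExact

/-! ### The first Cousin problem. -/

section Cousin

variable {ι : Type} {B : ι → Set ℂ} {c : ι → ι → ℂ → ℂ}

/-- Holomorphic cocycles are coboundaries of smooth functions. -/
lemma exists_smooth_cochain (hB : ∀ i, IsOpen (B i)) (hcov : ∀ z, ∃ i, z ∈ B i)
    (hc : ∀ i j, ∀ z ∈ B i, z ∈ B j → AnalyticAt ℂ (c i j) z)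
    (hcc : ∀ i j k z, z ∈ B i → z ∈ B j → z ∈ B k → c i j z + c j k z = c i k z) :
    ∃ b : ι → ℂ → ℂ, (∀ i, ∀ z ∈ B i, ContDiffAt ℝ ∞ (b i) z) ∧
      ∀ i j z, z ∈ B i → z ∈ B j → b i z - b j z = c i j z := by
  obtain ⟨ρ, hρ⟩ := SmoothPartitionOfUnity.exists_isSubordinate (modelWithCornersSelf ℝ ℂ)
    isClosed_univ B hB fun z _ => Set.mem_iUnion.2 (hcov z)
  -- Averaging `c i k` over `k` by the partition of unity: the cocycle identity turns the difference
  -- for `i` and `j` into `∑ ρ k • c i j = c i j`.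
  refine ⟨fun i z => ∑ᶠ k, ρ k z • c i k z, fun i z hz => ?_, fun i j z hi hj => ?_⟩
  · exact ρ.contDiffAt_finsum fun k hk =>
      (hc i k z hz (hρ k hk)).contDiffAt.restrict_scalars ℝ
  · have hfin : ∀ g : ι → ℂ, (Function.support fun k => ρ k z • g k).Finite := fun g =>
      (ρ.locallyFinite.point_finite z).subset fun k hk => by
        have : ρ k z • g k ≠ 0 := hk
        exact left_ne_zero_of_smul this
    rw [← finsum_sub_distrib (hfin _) (hfin _)]
    have h : ∀ k, ρ k z • c i k z - ρ k z • c j k z = ρ k z • c i j z := fun k => by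
      by_cases hk : ρ k z = 0
      · rw [hk, zero_smul, zero_smul, zero_smul, sub_zero]
      · have hz : z ∈ B k := hρ k (subset_closure hk)
        rw [← hcc i j k z hi hj hz, smul_add, add_sub_cancel_right]
    rw [finsum_congr h, ← finsum_smul' (ρ.locallyFinite.point_finite z),
      ρ.sum_eq_one (Set.mem_univ z), one_smul]

/-- The first Cousin problem on a disk. -/
lemma exists_cousin (hB : ∀ i, IsOpen (B i)) (hcov : ∀ z, ∃ i, z ∈ B i)
    (hc : ∀ i j, ∀ z ∈ B i, z ∈ B j → AnalyticAt ℂ (c i j) z)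
    (hcc : ∀ i j k z, z ∈ B i → z ∈ B j → z ∈ B k → c i j z + c j k z = c i k z) (r : ℝ) :
    ∃ a : ι → ℂ → ℂ, (∀ i, ∀ z ∈ B i, ‖z‖ < r → AnalyticAt ℂ (a i) z) ∧
      ∀ i j z, z ∈ B i → z ∈ B j → a i z - a j z = c i j z := by
  obtain ⟨b, hb, hbc⟩ := exists_smooth_cochain hB hcov hc hcc
  choose x hx using hcov
  -- The differences `b i - b j` are holomorphic, so the functions `∂̄(b i)` agree on overlaps and
  -- define one global smooth function; `x w` is any index whose set contains `w`.
  have hd : ∀ i j z, z ∈ B i → z ∈ B j → dbarFun (b i) z = dbarFun (b j) z := fun i j z hi hj => by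
    have h1 : b i =ᶠ[𝓝 z] b j + c i j := by
      filter_upwards [(hB i).mem_nhds hi, (hB j).mem_nhds hj] with w h1 h2
      rw [Pi.add_apply, ← hbc i j w h1 h2, add_sub_cancel]
    have h2 := (dbarFun_add (S := {z}) (f := b j) (g := c i j)
      (mem_smoothNear.2 (by
        rw [nhdsSet_singleton]
        exact Eventually.mono ((hB j).mem_nhds hj) (hb j)))
      (mem_smoothNear.2 (by
        rw [nhdsSet_singleton]
        exact (hc i j z hi hj).eventually_analyticAt.mono fun w hw =>
          hw.contDiffAt.restrict_scalars ℝ)))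
    rw [nhdsSet_singleton] at h2
    rw [dbarFun_congr h1, h2.eq_of_nhds, Pi.add_apply, dbarFun_of_analyticAt (hc i j z hi hj),
      add_zero]
  have hsm : ∀ i, ∀ z ∈ B i, ContDiffAt ℝ ∞ (dbarFun (b i)) z := fun i z hi => by
    have := dbarFun_mem (S := {z}) (mem_smoothNear.2 (by
        rw [nhdsSet_singleton]
        exact Eventually.mono ((hB i).mem_nhds hi) (hb i)))
    rw [mem_smoothNear, nhdsSet_singleton] at this
    exact this.self_of_nhds
  have hloc : ∀ i, ∀ z ∈ B i, (fun w => dbarFun (b (x w)) w) =ᶠ[𝓝 z] dbarFun (b i) :=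
      fun i z hi => by
    filter_upwards [(hB i).mem_nhds hi] with w hw
    exact hd _ _ w (hx w) hw
  -- The equation is solved near a closed disk only, whence the restriction to `‖z‖ < r`; in the
  -- coboundary relation `u` cancels everywhere.
  obtain ⟨u, hu, hud⟩ := exists_dbarFun_eq_near (isCompact_closedBall (0 : ℂ) r)
    (f := fun w => dbarFun (b (x w)) w) (mem_smoothNear.2 (Eventually.of_forall fun z =>
      (hsm _ z (hx z)).congr_of_eventuallyEq (hloc _ z (hx z))))
  refine ⟨fun i z => b i z - u z, fun i z hi hz => analyticAt_of_dbarFun_eq_zero ?_,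
    fun i j z hi hj => by rw [← hbc i j z hi hj]; ring⟩
  filter_upwards [(hB i).mem_nhds hi, Metric.isOpen_ball.mem_nhds (show z ∈ Metric.ball (0 : ℂ) r by
    rwa [mem_ball_zero_iff])] with w hw hw'
  refine ⟨(hb i w hw).sub hu.contDiffAt, ?_⟩
  have h1 := (eventually_nhdsSet_iff_forall.1 hud w (Metric.ball_subset_closedBall hw')).self_of_nhds
  have h2 := (hloc i w hw).eq_of_nhds
  have h3 : (fun z => b i z - u z) = b i - u := rfl
  rw [dbarFun, h3, fderiv_sub ((hb i w hw).differentiableAt (by simp))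
    (hu.contDiffAt.differentiableAt (by simp))]
  rw [h2, dbarFun, dbarFun] at h1
  simp only [sub_apply]
  linear_combination -h1

end Cousin

/-! ### The two charts of `ℙ¹` and sections of `𝒪(n)` in them. -/

section Sections

lemma coordV_mul' (m n : ℤ) (F G : OnePoint ℂ → ℂ) :
    coordV (m + n) (F * G) = coordV m F * coordV n G := by
  funext ξ
  by_cases h : ξ = 0
  · simp [coordV, h]
  · simp only [coordV, h, if_false, Pi.mul_apply, zpow_add₀ h]
    ring

lemma IsSec.mul' {m n k : ℤ} (hk : m + n = k) {Ω : Opens PLine} {f g : Ω → ℂ} (hf : IsSec m f)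
    (hg : IsSec n g) : IsSec k (f * g) := by
  subst hk
  rw [IsSec, extZero_mul, coordV_mul']
  exact ⟨fun z hz => (hf.1 z hz).mul (hg.1 z hz), fun hz => (hf.2 hz).mul (hg.2 hz)⟩

/-- The coordinate `ξ = z⁻¹` as a parametrization of a neighbourhood of `∞`. -/
def psiV (ξ : ℂ) : OnePoint ℂ := if ξ = 0 then OnePoint.infty else ((ξ⁻¹ : ℂ) : OnePoint ℂ)

/-- The coordinate `ξ = z⁻¹`. -/
def chiV : OnePoint ℂ → ℂ
  | none => 0
  | some z => z⁻¹

/-- The coordinate `z`. -/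
def chiU : OnePoint ℂ → ℂ
  | none => 0
  | some z => z

@[simp] lemma psiV_zero : psiV 0 = OnePoint.infty := if_pos rfl
lemma psiV_of_ne {ξ : ℂ} (h : ξ ≠ 0) : psiV ξ = ((ξ⁻¹ : ℂ) : OnePoint ℂ) := if_neg h
@[simp] lemma chiV_infty : chiV OnePoint.infty = 0 := rfl
@[simp] lemma chiV_coe (z : ℂ) : chiV (z : OnePoint ℂ) = z⁻¹ := rfl
@[simp] lemma chiU_coe (z : ℂ) : chiU (z : OnePoint ℂ) = z := rfl

lemma chiV_psiV (ξ : ℂ) : chiV (psiV ξ) = ξ := by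
  by_cases h : ξ = 0
  · rw [h, psiV_zero, chiV_infty]
  · rw [psiV_of_ne h, chiV_coe, inv_inv]

lemma psiV_chiV (x : OnePoint ℂ) (hx : x ≠ ((0 : ℂ) : OnePoint ℂ)) : psiV (chiV x) = x := by
  induction x using OnePoint.rec with
  | infty => rw [chiV_infty, psiV_zero]
  | coe z =>
    have hz : z ≠ 0 := fun h => hx (by rw [h])
    rw [chiV_coe, psiV_of_ne (inv_ne_zero hz), inv_inv]

/-- At the origin this says that `ξ⁻¹` tends to the point at infinity, which is `eventually_inv`. -/
lemma continuous_psiV : Continuous psiV := by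
  rw [continuous_iff_continuousAt]
  intro ξ
  by_cases h : ξ = 0
  · subst h
    intro s hs
    rw [psiV_zero] at hs
    obtain ⟨O, hOs, hO, hm⟩ := mem_nhds_iff.1 hs
    have := eventually_inv (Ω := ⟨O, hO⟩) hm
    refine mem_map.2 (this.mono fun η hη => ?_)
    by_cases h0 : η = 0
    · subst h0
      exact hOs (by rw [psiV_zero]; exact hm)
    · exact hOs (by rw [psiV_of_ne h0]; exact hη h0)
  · have h1 : psiV =ᶠ[𝓝 ξ] fun η => ((η⁻¹ : ℂ) : OnePoint ℂ) := by
      filter_upwards [isOpen_ne.mem_nhds h] with η hη using psiV_of_ne hη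
    refine ContinuousAt.congr ?_ h1.symm
    exact OnePoint.continuous_coe.continuousAt.comp (continuousAt_inv₀ h)

/-- The complement of `∞`. -/
def domU : Opens PLine := ⟨{OnePoint.infty}ᶜ, isOpen_compl_singleton⟩

/-- The complement of `0`. -/
def domV : Opens PLine := ⟨{((0 : ℂ) : OnePoint ℂ)}ᶜ, isOpen_compl_singleton⟩

lemma psiV_mem (ξ : ℂ) : psiV ξ ∈ domV := fun h => by
  by_cases h0 : ξ = 0
  · rw [h0, psiV_zero] at h
    exact OnePoint.infty_ne_coe _ h
  · rw [psiV_of_ne h0] at h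
    exact inv_ne_zero h0 (OnePoint.coe_injective h)

lemma continuousOn_chiU : ContinuousOn chiU domU := by
  intro x hx
  induction x using OnePoint.rec with
  | infty => exact absurd rfl hx
  | coe z =>
    refine ContinuousAt.continuousWithinAt ?_
    rw [OnePoint.continuousAt_coe]
    exact continuousAt_id

lemma continuousOn_chiV : ContinuousOn chiV domV := by
  intro x hx
  refine ContinuousAt.continuousWithinAt ?_
  induction x using OnePoint.rec with
  | infty =>
    rw [OnePoint.continuousAt_infty']
    rw [coclosedCompact_eq_cocompact, ← Metric.cobounded_eq_cocompact]
    exact tendsto_inv₀_cobounded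
  | coe z =>
    rw [OnePoint.continuousAt_coe]
    exact continuousAt_inv₀ fun h => hx (by rw [h]; rfl)

lemma analyticAt_extZero {n : ℤ} {Ω : Opens PLine} {f : Ω → ℂ} (hf : IsSec n f) {z : ℂ}
    (hz : (z : OnePoint ℂ) ∈ Ω) : AnalyticAt ℂ (fun w : ℂ => extZero f (w : OnePoint ℂ)) z :=
  hf.1 z hz

lemma coordV_eq (n : ℤ) (F : OnePoint ℂ → ℂ) {ξ : ℂ} (h : ξ ≠ 0) :
    coordV n F =ᶠ[𝓝 ξ] fun η => η ^ n * F ((η⁻¹ : ℂ) : OnePoint ℂ) := by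
  filter_upwards [isOpen_ne.mem_nhds h] with η hη using if_neg hη

lemma analyticAt_coordV {n : ℤ} {Ω : Opens PLine} {f : Ω → ℂ} (hf : IsSec n f) {ξ : ℂ}
    (hξ : psiV ξ ∈ Ω) : AnalyticAt ℂ (coordV n (extZero f)) ξ := by
  by_cases h : ξ = 0
  · subst h
    exact hf.2 (by rwa [psiV_zero] at hξ)
  · rw [psiV_of_ne h] at hξ
    refine AnalyticAt.congr ?_ (coordV_eq n _ h).symm
    exact (analyticAt_id.zpow h).mul ((hf.1 _ hξ).fun_comp (analyticAt_inv h))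

/-- The frame `e_U` exists on all of `domU` and the condition at `∞` is void there, so `n` plays no
role. -/
lemma isSec_of_U (n : ℤ) {Ω : Opens PLine} (hΩ : Ω ≤ domU) {F : ℂ → ℂ}
    (hF : ∀ z : ℂ, (z : OnePoint ℂ) ∈ Ω → AnalyticAt ℂ F z) :
    IsSec n (fun x : Ω => F (chiU x)) := by
  refine ⟨fun z hz => (hF z hz).congr ?_, fun h => absurd rfl (hΩ h)⟩
  filter_upwards [eventually_coe hz] with w hw
  rw [extZero_of_mem _ hw, chiU_coe]

/-- The section of `𝒪(n)` whose coordinate in the frame `e_V` is the function `F` of `ξ`. -/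
def fnV (n : ℤ) (F : ℂ → ℂ) : OnePoint ℂ → ℂ
  | none => F 0
  | some z => z ^ n * F z⁻¹

@[simp] lemma fnV_infty (n : ℤ) (F : ℂ → ℂ) : fnV n F OnePoint.infty = F 0 := rfl
@[simp] lemma fnV_coe (n : ℤ) (F : ℂ → ℂ) (z : ℂ) : fnV n F (z : OnePoint ℂ) = z ^ n * F z⁻¹ := rfl

lemma coordV_fnV (n : ℤ) (F : ℂ → ℂ) : coordV n (fnV n F) = F := by
  funext ξ
  by_cases h : ξ = 0
  · simp [coordV, h]
  · rw [coordV, if_neg h, fnV_coe, inv_inv, ← mul_assoc, inv_zpow, mul_inv_cancel₀ (zpow_ne_zero n h),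
      one_mul]

lemma isSec_of_V (n : ℤ) {Ω : Opens PLine} (hΩ : Ω ≤ domV) {F : ℂ → ℂ}
    (hF : ∀ ξ : ℂ, psiV ξ ∈ Ω → AnalyticAt ℂ F ξ) :
    IsSec n (fun x : Ω => fnV n F x) := by
  have hc : ∀ x ∈ Ω, fnV n F x = extZero (fun x : Ω => fnV n F x) x := fun x hx => by
    rw [extZero_of_mem _ hx]
  refine ⟨fun z hz => ?_, fun h => ?_⟩
  · have hz0 : z ≠ 0 := fun h => hΩ hz (by rw [h]; rfl)
    refine AnalyticAt.congr ?_ (sec_congr_coe hc hz)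
    refine (analyticAt_id.zpow hz0).mul (AnalyticAt.fun_comp (hF _ ?_) (analyticAt_inv hz0))
    rwa [psiV_of_ne (inv_ne_zero hz0), inv_inv]
  · refine AnalyticAt.congr ?_ (sec_congr_infty n hc h)
    rw [coordV_fnV]
    exact hF 0 (by rwa [psiV_zero])

lemma coordV_zero_apply (F : OnePoint ℂ → ℂ) (ξ : ℂ) : coordV 0 F ξ = F (psiV ξ) := by
  by_cases h : ξ = 0
  · simp [coordV, h]
  · simp [coordV, h, psiV_of_ne h]

/-- A coordinate on an open subset of `ℙ¹`. -/
structure Chart where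
  ψ : ℂ → OnePoint ℂ
  χ : OnePoint ℂ → ℂ
  dom : Opens PLine
  mem : ∀ ξ, ψ ξ ∈ dom
  cont : Continuous ψ
  left_inv : ∀ ξ, χ (ψ ξ) = ξ
  right_inv : ∀ x ∈ dom, ψ (χ x) = x
  contOn : ContinuousOn χ dom
  analyticAt : ∀ {Ω : Opens PLine} {f : Ω → ℂ}, IsSec 0 f → ∀ ξ, ψ ξ ∈ Ω →
    AnalyticAt ℂ (fun η => extZero f (ψ η)) ξ
  isSec : ∀ {Ω : Opens PLine}, Ω ≤ dom → ∀ {F : ℂ → ℂ}, (∀ ξ, ψ ξ ∈ Ω → AnalyticAt ℂ F ξ) →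
    IsSec 0 (fun x : Ω => F (χ x))

/-- The coordinate `z`. -/
def chartU : Chart where
  ψ z := (z : OnePoint ℂ)
  χ := chiU
  dom := domU
  mem z := OnePoint.coe_ne_infty z
  cont := OnePoint.continuous_coe
  left_inv := chiU_coe
  right_inv x hx := by
    induction x using OnePoint.rec with
    | infty => exact absurd rfl hx
    | coe z => rfl
  contOn := continuousOn_chiU
  analyticAt hf ξ hξ := hf.1 ξ hξ
  isSec hΩ _ hF := isSec_of_U 0 hΩ hF

/-- The coordinate `ξ = z⁻¹`. -/
def chartV : Chart where
  ψ := psiV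
  χ := chiV
  dom := domV
  mem ξ := psiV_mem ξ
  cont := continuous_psiV
  left_inv := chiV_psiV
  right_inv x hx := psiV_chiV x hx
  contOn := continuousOn_chiV
  analyticAt hf ξ hξ := (analyticAt_coordV hf hξ).congr
    (Eventually.of_forall fun η => coordV_zero_apply _ η)
  isSec {Ω} hΩ F hF := by
    have : (fun x : Ω => F (chiV x)) = fun x : Ω => fnV 0 F x := by
      funext ⟨x, hx⟩
      induction x using OnePoint.rec with
      | infty => rfl
      | coe z => simp
    rw [this]
    exact isSec_of_V 0 hΩ hF

namespace Chart

variable (C : Chart)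

/-- The open disk of radius `r` in a chart. -/
def ball (r : ℝ) : Opens PLine :=
  ⟨C.dom ∩ C.χ ⁻¹' Metric.ball 0 r, C.contOn.isOpen_inter_preimage C.dom.isOpen Metric.isOpen_ball⟩

lemma ball_le (r : ℝ) : C.ball r ≤ C.dom := fun _ h => h.1

lemma norm_lt {r : ℝ} {x : OnePoint ℂ} (hx : x ∈ C.ball r) : ‖C.χ x‖ < r :=
  mem_ball_zero_iff.1 hx.2

end Chart

/-- The radius 3 only has to exceed 2. -/
lemma isNhdU_ball : IsNhdU (chartU.ball 3) := by
  refine ⟨fun z hz => ⟨OnePoint.coe_ne_infty z, ?_⟩, fun h => absurd rfl h.1⟩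
  rw [disk_eq, mem_closedBall_zero_iff] at hz
  exact mem_ball_zero_iff.2 (hz.trans_lt (by norm_num))

lemma isNhdV_ball : IsNhdV (chartV.ball 3) := by
  refine ⟨⟨OnePoint.infty_ne_coe _, mem_ball_zero_iff.2 ?_⟩, fun ξ h0 hξ => ⟨fun h => ?_, ?_⟩,
    fun h => absurd rfl h.1⟩
  · change ‖chiV OnePoint.infty‖ < 3
    rw [chiV_infty, norm_zero]
    norm_num
  · exact inv_ne_zero h0 (OnePoint.coe_injective h)
  · rw [disk_eq, mem_closedBall_zero_iff] at hξ
    refine mem_ball_zero_iff.2 ?_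
    change ‖chiV _‖ < 3
    rw [chiV_coe, inv_inv]
    exact hξ.trans_lt (by norm_num)

end Sections

/-! ### Sections of `𝒪(n)` as functions. -/

section LineSections

variable {n : ℤ} {Ω Ω' : Opens PLine}

/-- The function of a section of `𝒪(n)`. -/
def fn (s : (lineSheaf n).val.obj (op Ω)) : Ω → ℂ := (show secGroup n Ω from s).1

/-- The section of `𝒪(n)` of a function. -/
def mkSec (f : Ω → ℂ) (hf : IsSec n f) : (lineSheaf n).val.obj (op Ω) := toSec ⟨f, hf⟩

/-- The function of a section of `𝒪`. -/
def fnO (s : structSheaf.obj.obj (op Ω)) : Ω → ℂ := (show secRing Ω from s).1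

/-- The section of `𝒪` of a function. -/
def mkO (f : Ω → ℂ) (hf : IsSec 0 f) : structSheaf.obj.obj (op Ω) := (⟨f, hf⟩ : secRing Ω)

lemma isSec_fn (s : (lineSheaf n).val.obj (op Ω)) : IsSec n (fn s) := (show secGroup n Ω from s).2
@[simp] lemma fn_mkSec (f : Ω → ℂ) (hf : IsSec n f) : fn (mkSec f hf) = f := rfl
@[simp] lemma fnO_mkO (f : Ω → ℂ) (hf : IsSec 0 f) : fnO (mkO f hf) = f := rfl
lemma fn_ext {s t : (lineSheaf n).val.obj (op Ω)} (h : ∀ x, fn s x = fn t x) : s = t :=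
  Subtype.ext (p := fun f => f ∈ secGroup n Ω) (funext h)
lemma fn_add (s t : (lineSheaf n).val.obj (op Ω)) (x : Ω) : fn (s + t) x = fn s x + fn t x := rfl
lemma fn_sub (s t : (lineSheaf n).val.obj (op Ω)) (x : Ω) : fn (s - t) x = fn s x - fn t x := rfl
lemma fn_neg (s : (lineSheaf n).val.obj (op Ω)) (x : Ω) : fn (-s) x = -fn s x := rfl
lemma fn_zero (x : Ω) : fn (0 : (lineSheaf n).val.obj (op Ω)) x = 0 := rfl
lemma fn_smul (r : structSheaf.obj.obj (op Ω)) (s : (lineSheaf n).val.obj (op Ω)) (x : Ω) :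
    fn (r • s) x = fnO r x * fn s x := rfl
lemma fn_res (h : Ω' ≤ Ω) (s : (lineSheaf n).val.obj (op Ω)) (x : Ω') :
    fn (res _ h s) x = fn s ⟨x.1, h x.2⟩ := rfl

lemma IsSec.res (h : Ω' ≤ Ω) {f : Ω → ℂ} (hf : IsSec n f) :
    IsSec n (fun x : Ω' => f ⟨x.1, h x.2⟩) := (secPred n).res (homOfLE h) f hf

end LineSections

/-! ### Lifting sections along extensions by `𝒪`. -/

section Lift

variable {E M : SheafOfModules.{0} structSheaf}

/-- Sections lift along an extension by `𝒪` over the disks of a chart. -/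
lemma exists_lift_ball {f : lineSheaf 0 ⟶ E} {g : E ⟶ M} {w : f ≫ g = 0}
    (hS : (ShortComplex.mk f g w).ShortExact) (C : Chart) (n : M.val.obj (op C.dom)) (r : ℝ) :
    ∃ m : E.val.obj (op (C.ball r)), g.val.app _ m = res M (C.ball_le r) n := by
  have : Epi g := hS.epi_g
  have hker := exists_app_eq f g w hS
  have hinj : ∀ (Ω : Opens PLine) (a b : (lineSheaf 0).val.obj (op Ω)),
      f.val.app (op Ω) a = f.val.app (op Ω) b → a = b := fun Ω a b hab =>
    (hker Ω (f.val.app (op Ω) b) (by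
      have := congrArg (fun φ => φ.val.app (op Ω) b) w
      exact this)).unique hab rfl
  -- Local lifts around every point of the chart. Their differences come from sections of `𝒪` and
  -- form a holomorphic cocycle `c`.
  choose B hB m hx hm using fun ξ => exists_local_lift g n (C.mem ξ)
  have hdiff : ∀ i j, g.val.app (op (B i ⊓ B j)) (res E inf_le_left (m i) - res E inf_le_right (m j))
      = 0 := fun i j => by
    rw [map_sub, app_res, app_res, hm, hm, res_res, res_res, sub_self]
  choose c hc using fun i j => (hker _ _ (hdiff i j)).exists
  have hc' : ∀ i j (D : Opens PLine) (h1 : D ≤ B i) (h2 : D ≤ B j),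
      f.val.app (op D) (res _ (le_inf h1 h2) (c i j)) = res E h1 (m i) - res E h2 (m j) := by
    intro i j D h1 h2
    rw [app_res, hc, map_sub, res_res, res_res]
  -- On the disk of radius `r` the Cousin problem gives `c i j = a i - a j`, so the corrected lifts
  -- `m i - f (a i)` agree on overlaps and glue.
  obtain ⟨a, ha, hac⟩ := exists_cousin (B := fun i => C.ψ ⁻¹' (B i))
    (c := fun i j ξ => extZero (fn (c i j)) (C.ψ ξ)) (fun i => (B i).isOpen.preimage C.cont)
    (fun ξ => ⟨ξ, hx ξ⟩) (fun i j ξ h1 h2 => C.analyticAt (isSec_fn _) ξ ⟨h1, h2⟩)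
    (fun i j k ξ h1 h2 h3 => by
      let D := B i ⊓ B j ⊓ B k
      have e1 : D ≤ B i := inf_le_left.trans inf_le_left
      have e2 : D ≤ B j := inf_le_left.trans inf_le_right
      have e3 : D ≤ B k := inf_le_right
      have key : res _ (le_inf e1 e2) (c i j) + res _ (le_inf e2 e3) (c j k) =
          res _ (le_inf e1 e3) (c i k) := by
        apply hinj
        rw [map_add, hc' i j D e1 e2, hc' j k D e2 e3, hc' i k D e1 e3, sub_add_sub_cancel]
      have := congrArg (fun s => fn s (⟨C.ψ ξ, show C.ψ ξ ∈ D from ⟨⟨h1, h2⟩, h3⟩⟩ : D)) key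
      rw [extZero_of_mem _ (show C.ψ ξ ∈ B i ⊓ B j from ⟨h1, h2⟩),
        extZero_of_mem _ (show C.ψ ξ ∈ B j ⊓ B k from ⟨h2, h3⟩),
        extZero_of_mem _ (show C.ψ ξ ∈ B i ⊓ B k from ⟨h1, h3⟩)]
      exact this) r
  have hsec : ∀ i, IsSec 0 (fun x : (B i ⊓ C.ball r : Opens PLine) => a i (C.χ x)) := fun i =>
    C.isSec (inf_le_right.trans (C.ball_le r)) fun ξ hξ => ha i ξ hξ.1 (by
      have := C.norm_lt hξ.2
      rwa [C.left_inv] at this)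
  obtain ⟨e, he⟩ := exists_res_eq (M := E) (fun i => B i ⊓ C.ball r) (Ω := C.ball r)
    (fun i => inf_le_right)
    (fun x hxr => Opens.mem_iSup.2 ⟨C.χ x, by
      have := hx (C.χ x)
      rw [C.right_inv x hxr.1] at this
      exact ⟨this, hxr⟩⟩)
    (fun i => res E inf_le_left (m i) - f.val.app _ (mkSec _ (hsec i)))
    (fun i j D h1 h2 => by
      rw [map_sub, map_sub, res_res, res_res, ← app_res, ← app_res, sub_eq_sub_iff_sub_eq_sub,
        ← hc' i j D _ _, ← map_sub]
      congr 1
      refine fn_ext fun x => ?_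
      have hxr : x.1 ∈ C.ball r := (h1 x.2).2
      have e1 := hac i j (C.χ x) (by
        rw [Set.mem_preimage, C.right_inv _ hxr.1]; exact (h1 x.2).1) (by
        rw [Set.mem_preimage, C.right_inv _ hxr.1]; exact (h2 x.2).1)
      rw [C.right_inv _ hxr.1,
        extZero_of_mem _ (show x.1 ∈ B i ⊓ B j from ⟨(h1 x.2).1, (h2 x.2).1⟩)] at e1
      exact e1.symm)
  refine ⟨e, eq_of_res (M := M) (fun i => B i ⊓ C.ball r) (fun i => inf_le_right)
    (fun x hxr => Opens.mem_iSup.2 ⟨C.χ x, by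
      have := hx (C.χ x)
      rw [C.right_inv x hxr.1] at this
      exact ⟨this, hxr⟩⟩) fun i => ?_⟩
  rw [← app_res, he, map_sub, app_res, hm, res_res, res_res]
  have hz : ∀ s, g.val.app (op (B i ⊓ C.ball r)) (f.val.app _ s) = 0 := fun s =>
    congrArg (fun φ => φ.val.app (op (B i ⊓ C.ball r)) s) w
  rw [hz, sub_zero]

end Lift

/-! ### Morphisms of sheaves over an open set. -/

section LocalHoms

/-- A morphism of sheaves of modules over the open set `D`. -/
structure LocalHom (M N : SheafOfModules.{0} structSheaf) (D : Opens PLine) where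
  app : ∀ Ω : Opens PLine, Ω ≤ D →
    (M.val.obj (op Ω) →ₗ[structSheaf.obj.obj (op Ω)] N.val.obj (op Ω))
  app_res : ∀ {Ω Ω' : Opens PLine} (h : Ω ≤ D) (i : Ω' ≤ Ω) (s : M.val.obj (op Ω)),
    res N i (app Ω h s) = app Ω' (i.trans h) (res M i s)

namespace LocalHom

variable {M N P : SheafOfModules.{0} structSheaf} {D D' : Opens PLine}

def ofHom (f : M ⟶ N) (D : Opens PLine) : LocalHom M N D where
  app Ω _ := (f.val.app (op Ω)).hom
  app_res _ i s := (Glue.app_res f i s).symm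

def restrict (φ : LocalHom M N D) (h : D' ≤ D) : LocalHom M N D' where
  app Ω hΩ := φ.app Ω (hΩ.trans h)
  app_res hΩ i s := φ.app_res (hΩ.trans h) i s

def comp (ψ : LocalHom N P D) (φ : LocalHom M N D) : LocalHom M P D where
  app Ω h := ψ.app Ω h ∘ₗ φ.app Ω h
  app_res h i s := by
    rw [LinearMap.comp_apply, ψ.app_res, φ.app_res]
    rfl

instance : Add (LocalHom M N D) where
  add φ ψ :=
    { app := fun Ω h => φ.app Ω h + ψ.app Ω h
      app_res := fun h i s => by
        rw [LinearMap.add_apply, LinearMap.add_apply, map_add, φ.app_res, ψ.app_res] }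

lemma comp_app (ψ : LocalHom N P D) (φ : LocalHom M N D) (Ω) (h : Ω ≤ D) (s) :
    (ψ.comp φ).app Ω h s = ψ.app Ω h (φ.app Ω h s) := rfl
lemma add_app (ψ φ : LocalHom M N D) (Ω) (h : Ω ≤ D) (s) :
    (ψ + φ).app Ω h s = ψ.app Ω h s + φ.app Ω h s := rfl
lemma ofHom_app (f : M ⟶ N) (D : Opens PLine) (Ω) (h : Ω ≤ D) (s) :
    (ofHom f D).app Ω h s = f.val.app (op Ω) s := rfl

/-- Morphisms over two open sets which cover `ℙ¹` and which agree on the intersection glue. -/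
lemma exists_glue (φ : LocalHom M N D) (ψ : LocalHom M N D') (hcov : ∀ x, x ∈ D ∨ x ∈ D')
    (h : ∀ Ω (h : Ω ≤ D) (h' : Ω ≤ D') s, φ.app Ω h s = ψ.app Ω h' s) :
    ∃ f : M ⟶ N, (∀ Ω (h : Ω ≤ D) s, f.val.app (op Ω) s = φ.app Ω h s) ∧
      ∀ Ω (h : Ω ≤ D') s, f.val.app (op Ω) s = ψ.app Ω h s := by
  -- Every `Ω` is covered by its intersections with `D` and `D'`. The image of a section is the
  -- unique one with the two prescribed restrictions, and linearity and naturality follow from this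
  -- uniqueness.
  let B : Opens PLine → Bool → Opens PLine := fun Ω b => if b then Ω ⊓ D else Ω ⊓ D'
  have hB : ∀ Ω b, B Ω b ≤ Ω := fun Ω b => by cases b <;> exact inf_le_left
  have hBc : ∀ Ω, Ω ≤ iSup (B Ω) := fun Ω x hx => by
    rcases hcov x with h | h
    · exact Opens.mem_iSup.2 ⟨true, hx, h⟩
    · exact Opens.mem_iSup.2 ⟨false, hx, h⟩
  have hex : ∀ Ω (s : M.val.obj (op Ω)), ∃ t : N.val.obj (op Ω),
      res N (hB Ω true) t = φ.app (Ω ⊓ D) inf_le_right (res M inf_le_left s) ∧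
      res N (hB Ω false) t = ψ.app (Ω ⊓ D') inf_le_right (res M inf_le_left s) := by
    intro Ω s
    obtain ⟨t, ht⟩ := exists_res_eq (M := N) (B Ω) (hB Ω) (hBc Ω)
      (fun b => match b with
        | true => φ.app (Ω ⊓ D) inf_le_right (res M inf_le_left s)
        | false => ψ.app (Ω ⊓ D') inf_le_right (res M inf_le_left s))
      (fun i j Δ h1 h2 => by
        cases i <;> cases j
        · rfl
        · exact (ψ.app_res _ h1 _).trans (((congrArg _ (res_res _ _ s)).trans
            ((h Δ (h2.trans inf_le_right) (h1.trans inf_le_right) _).symm.trans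
              (congrArg _ (res_res _ _ s).symm))).trans (φ.app_res _ h2 _).symm)
        · exact (φ.app_res _ h1 _).trans (((congrArg _ (res_res _ _ s)).trans
            ((h Δ (h1.trans inf_le_right) (h2.trans inf_le_right) _).trans
              (congrArg _ (res_res _ _ s).symm))).trans (ψ.app_res _ h2 _).symm)
        · rfl)
    exact ⟨t, ht true, ht false⟩
  have huniq : ∀ {Ω} {t t' : N.val.obj (op Ω)}, res N (hB Ω true) t = res N (hB Ω true) t' →
      res N (hB Ω false) t = res N (hB Ω false) t' → t = t' := fun {Ω} {t t'} h1 h2 =>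
    eq_of_res (M := N) (B Ω) (hB Ω) (hBc Ω) fun b => by cases b <;> assumption
  choose F h1 h2 using hex
  have hadd : ∀ Ω s s', F Ω (s + s') = F Ω s + F Ω s' := fun Ω s s' =>
    huniq (by rw [map_add, h1, h1, h1, map_add, map_add]) (by rw [map_add, h2, h2, h2, map_add, map_add])
  have hsmul : ∀ Ω (r : structSheaf.obj.obj (op Ω)) s, F Ω (r • s) = r • F Ω s := fun Ω r s =>
    huniq (by rw [res_smul, h1, h1, res_smul, _root_.map_smul])
      (by rw [res_smul, h2, h2, res_smul, _root_.map_smul])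
  have hφ : ∀ Ω (h : Ω ≤ D) s, F Ω s = φ.app Ω h s := fun Ω hΩ s => by
    refine huniq ?_ ?_
    · exact (h1 Ω s).trans (φ.app_res hΩ inf_le_left s).symm
    · exact (h2 Ω s).trans ((h _ (inf_le_left.trans hΩ) inf_le_right _).symm.trans
        (φ.app_res hΩ inf_le_left s).symm)
  have hψ : ∀ Ω (h : Ω ≤ D') s, F Ω s = ψ.app Ω h s := fun Ω hΩ s => by
    refine huniq ?_ ?_
    · exact (h1 Ω s).trans ((h _ inf_le_right (inf_le_left.trans hΩ) _).trans
        (ψ.app_res hΩ inf_le_left s).symm)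
    · exact (h2 Ω s).trans (ψ.app_res hΩ inf_le_left s).symm
  have hnat : ∀ Ω Ω' (i : Ω' ≤ Ω) s, F Ω' (res M i s) = res N i (F Ω s) := fun Ω Ω' i s => by
    refine huniq ?_ ?_
    · have e1 : Ω' ⊓ D ≤ Ω ⊓ D := inf_le_inf_right _ i
      have := congrArg (res N e1) (h1 Ω s)
      rw [res_res, φ.app_res, res_res] at this
      rw [h1, res_res, res_res]
      exact this.symm
    · have e1 : Ω' ⊓ D' ≤ Ω ⊓ D' := inf_le_inf_right _ i
      have := congrArg (res N e1) (h2 Ω s)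
      rw [res_res, ψ.app_res, res_res] at this
      rw [h2, res_res, res_res]
      exact this.symm
  refine ⟨⟨{ app := fun Ω => ModuleCat.ofHom
                { toFun := F Ω.unop, map_add' := hadd Ω.unop, map_smul' := hsmul Ω.unop }
             naturality := fun {Ω Ω'} i => ?_ }⟩, hφ, hψ⟩
  ext s
  exact hnat Ω.unop Ω'.unop i.unop.le s

variable {i j k : ℤ}

/-- The multiplication by a section of `𝒪(k)`. -/
def mul (hk : k + i = j) (H : OnePoint ℂ → ℂ) (hH : IsSec k fun x : D => H x) :
    LocalHom (lineSheaf i) (lineSheaf j) D where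
  app Ω h :=
    { toFun := fun s => mkSec ((fun x : Ω => H x) * fn s) ((hH.res h).mul' hk (isSec_fn s))
      map_add' := fun _ _ => fn_ext fun _ => mul_add _ _ _
      map_smul' := fun _ _ => fn_ext fun _ => mul_left_comm _ _ _ }
  app_res _ _ _ := fn_ext fun _ => rfl

lemma fn_mul (hk : k + i = j) (H : OnePoint ℂ → ℂ) (hH : IsSec k fun x : D => H x) (Ω) (h : Ω ≤ D)
    (s) (x : Ω) : fn ((mul hk H hH).app Ω h s) x = H x * fn s x := rfl

end LocalHom

section Splittings

variable {E M : SheafOfModules.{0} structSheaf} {g : E ⟶ M} {D : Opens PLine}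

/-- A splitting over `D` as a morphism over `D`. -/
def LocalSplitting.hom (σ : LocalSplitting g D) : LocalHom M E D where
  app := σ.σ
  app_res h i s := σ.naturality h (i.trans h) (homOfLE i) s

/-- A morphism over `D` which is a section of `g` is a splitting. -/
def LocalHom.splitting (φ : LocalHom M E D)
    (h : ∀ Ω (h : Ω ≤ D) s, g.val.app (op Ω) (φ.app Ω h s) = s) : LocalSplitting g D where
  σ := φ.app
  naturality h _ i s := φ.app_res h i.le s
  split := h

end Splittings

end LocalHoms

/-! ### Splittings over the charts and their cocycles. -/

section Cocycles

variable {E M : SheafOfModules.{0} structSheaf} {D : Opens PLine}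

/-- The morphism `𝒪 → E` over `D` given by a section of `E`. -/
def LocalHom.smulSec (m : E.val.obj (op D)) : LocalHom (lineSheaf 0) E D where
  app Ω h :=
    { toFun := fun s => mkO (fn s) (isSec_fn s) • res E h m
      map_add' := fun s t => add_smul (mkO (fn s) (isSec_fn s)) (mkO (fn t) (isSec_fn t)) _
      map_smul' := fun r s => mul_smul r (mkO (fn s) (isSec_fn s)) _ }
  app_res h i s := by
    refine (res_smul i _ _).trans ?_
    rw [res_res]
    rfl

lemma LocalHom.smulSec_app (m : E.val.obj (op D)) (Ω : Opens PLine) (h : Ω ≤ D)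
    (s : (lineSheaf 0).val.obj (op Ω)) :
    (LocalHom.smulSec m).app Ω h s = mkO (fn s) (isSec_fn s) • res E h m := rfl

lemma hom_app_smul {N : SheafOfModules.{0} structSheaf} (g : E ⟶ N) (Ω : Opens PLine)
    (r : structSheaf.obj.obj (op Ω)) (m : E.val.obj (op Ω)) :
    g.val.app (op Ω) (r • m) = r • g.val.app (op Ω) m := _root_.map_smul (g.val.app (op Ω)).hom r m

/-- Over a chart `e` is a frame of `𝒪(n)` and `e'` the dual frame. A lift `m` of `e` exists over the
disk, and `s ↦ (e' s) m` is a splitting. -/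
lemma exists_splitting {n : ℤ} (S : Extn (lineSheaf n) (lineSheaf 0)) (C : Chart)
    (e e' : OnePoint ℂ → ℂ) (he : IsSec n fun x : C.dom => e x) (he' : IsSec (-n) fun x : C.dom => e' x)
    (hee : ∀ x ∈ C.dom, e x * e' x = 1) (r : ℝ) : Nonempty (LocalSplitting S.g (C.ball r)) := by
  obtain ⟨m, hm⟩ := exists_lift_ball S.exact C (mkSec _ he) r
  let μ : LocalHom (lineSheaf n) (lineSheaf 0) (C.ball r) :=
    LocalHom.mul (neg_add_cancel n) e' (he'.res (C.ball_le r))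
  refine ⟨LocalHom.splitting ((LocalHom.smulSec m).comp μ) fun Ω h s => ?_⟩
  rw [LocalHom.comp_app, LocalHom.smulSec_app, hom_app_smul, app_res, hm, res_res]
  refine fn_ext fun x => ?_
  rw [fn_smul, fn_res, fn_mkSec, fnO_mkO, LocalHom.fn_mul]
  have := hee x.1 (C.ball_le r (h x.2))
  linear_combination (fn s x) * this

lemma isSec_one_U (n : ℤ) : IsSec n fun _ : domU => (1 : ℂ) :=
  isSec_of_U n le_rfl (F := fun _ => 1) fun _ _ => analyticAt_const

lemma isSec_fnV_one (n : ℤ) : IsSec n fun x : domV => fnV n (fun _ => 1) x :=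
  isSec_of_V n le_rfl fun _ _ => analyticAt_const

lemma fnV_one_mul (n : ℤ) (x : OnePoint ℂ) (hx : x ∈ domV) :
    fnV n (fun _ => 1) x * fnV (-n) (fun _ => 1) x = 1 := by
  induction x using OnePoint.rec with
  | infty => simp
  | coe z =>
    have hz : z ≠ 0 := fun h => hx (by rw [h]; rfl)
    rw [fnV_coe, fnV_coe, mul_one, mul_one, ← zpow_add₀ hz, add_neg_cancel, zpow_zero]

/-- Every extension of `𝒪(n)` by `𝒪` splits near `U`. -/
lemma exists_splitting_U {n : ℤ} (S : Extn (lineSheaf n) (lineSheaf 0)) :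
    Nonempty (LocalSplitting S.g (chartU.ball 3)) :=
  exists_splitting S chartU (fun _ => 1) (fun _ => 1) (isSec_one_U n) (isSec_one_U (-n))
    (fun _ _ => one_mul 1) 3

/-- Every extension of `𝒪(n)` by `𝒪` splits near `V`. -/
lemma exists_splitting_V {n : ℤ} (S : Extn (lineSheaf n) (lineSheaf 0)) :
    Nonempty (LocalSplitting S.g (chartV.ball 3)) :=
  exists_splitting S chartV _ _ (isSec_fnV_one n) (isSec_fnV_one (-n)) (fnV_one_mul n) 3

/-- The difference of the morphisms `σ'` and `σ` over the intersection of their domains is the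
multiplication by `ρ`, followed by `f`. -/
def IsCocycle {n : ℤ} (f : lineSheaf 0 ⟶ E) {D D' : Opens PLine} (σ : LocalHom (lineSheaf n) E D)
    (σ' : LocalHom (lineSheaf n) E D') (ρ : ℂ → ℂ) : Prop :=
  ∀ (Ω : Opens PLine) (h : Ω ≤ D) (h' : Ω ≤ D') (s : (lineSheaf n).val.obj (op Ω)),
    ∃ r : (lineSheaf 0).val.obj (op Ω),
      (∀ (z : ℂ) (hz : (z : OnePoint ℂ) ∈ Ω), fn r ⟨z, hz⟩ = ρ z * fn s ⟨z, hz⟩) ∧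
      σ'.app Ω h' s - σ.app Ω h s = f.val.app (op Ω) r

/-- Changing the splittings by `f ∘ μ` and `f ∘ μ'` changes the cocycle by `μ' - μ`. -/
lemma IsCocycle.add {n : ℤ} {f : lineSheaf 0 ⟶ E} {D D' D₁ D₁' : Opens PLine}
    {σ : LocalHom (lineSheaf n) E D} {σ' : LocalHom (lineSheaf n) E D'} {ρ ρ' : ℂ → ℂ}
    (hc : IsCocycle f σ σ' ρ) (hD : D₁ ≤ D) (hD' : D₁' ≤ D')
    (μ : LocalHom (lineSheaf n) (lineSheaf 0) D₁) (μ' : LocalHom (lineSheaf n) (lineSheaf 0) D₁')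
    (h : ∀ (Ω : Opens PLine) (h : Ω ≤ D₁) (h' : Ω ≤ D₁') (s : (lineSheaf n).val.obj (op Ω)) (z : ℂ)
      (hz : (z : OnePoint ℂ) ∈ Ω), ρ z * fn s ⟨z, hz⟩ + (fn (μ'.app Ω h' s) ⟨z, hz⟩ -
        fn (μ.app Ω h s) ⟨z, hz⟩) = ρ' z * fn s ⟨z, hz⟩) :
    IsCocycle f (σ.restrict hD + (LocalHom.ofHom f D₁).comp μ)
      (σ'.restrict hD' + (LocalHom.ofHom f D₁').comp μ') ρ' := by
  intro Ω h₁ h₁' s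
  obtain ⟨r, hr, hr'⟩ := hc Ω (h₁.trans hD) (h₁'.trans hD') s
  refine ⟨r + (μ'.app Ω h₁' s - μ.app Ω h₁ s), fun z hz => ?_, ?_⟩
  · rw [fn_add, fn_sub, hr, h]
  · refine Eq.trans ?_ (_root_.map_add (f.val.app (op Ω)).hom r _).symm
    refine Eq.trans ?_ (congrArg₂ (· + ·) hr'
      (_root_.map_sub (f.val.app (op Ω)).hom (μ'.app Ω h₁' s) (μ.app Ω h₁ s)).symm)
    exact add_sub_add_comm _ _ _ _

/-- Away from `∞` the sheaf `𝒪(n)` has the frame `e_U`, and the difference of the splittings is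
determined by its value there. That value is killed by `S.g`, hence comes from a function. -/
lemma exists_isCocycle {n : ℤ} (S : Extn (lineSheaf n) (lineSheaf 0)) {D D' : Opens PLine}
    (σ : LocalSplitting S.g D) (σ' : LocalSplitting S.g D') (hD : OnePoint.infty ∉ D) :
    ∃ ρ : ℂ → ℂ, (∀ z : ℂ, (z : OnePoint ℂ) ∈ D → (z : OnePoint ℂ) ∈ D' → AnalyticAt ℂ ρ z) ∧
      IsCocycle S.f σ.hom σ'.hom ρ := by
  have hU : ∀ {Ω}, Ω ≤ D → Ω ≤ domU := fun h x hx hx' => hD (by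
    rw [← show x = OnePoint.infty from hx']; exact h hx)
  let e : (lineSheaf n).val.obj (op (D ⊓ D')) :=
    mkSec _ ((isSec_one_U n).res (hU (inf_le_left : D ⊓ D' ≤ D)))
  obtain ⟨r₀, hr₀, -⟩ := exists_app_eq S.f S.g S.w S.exact (D ⊓ D')
    (σ'.σ _ inf_le_right e - σ.σ _ inf_le_left e) (by
      rw [map_sub, σ.split, σ'.split, sub_self])
  refine ⟨fun z => extZero (fn r₀) z, fun z h h' => (isSec_fn r₀).1 z ⟨h, h'⟩, fun Ω h h' s => ?_⟩
  have hΩ : Ω ≤ D ⊓ D' := le_inf h h'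
  let q : structSheaf.obj.obj (op Ω) := mkO (fn s) (by
    have := ((isSec_one_U (-n)).res (hU h)).mul' (neg_add_cancel n) (isSec_fn s)
    convert this using 1
    exact (one_mul _).symm)
  have hs : s = q • res _ hΩ e := fn_ext fun x => (mul_one _).symm
  refine ⟨q • res _ hΩ r₀, fun z hz => ?_, ?_⟩
  · change fnO q ⟨z, hz⟩ * fn (res _ hΩ r₀) ⟨z, hz⟩ = extZero (fn r₀) z * fn s ⟨z, hz⟩
    rw [extZero_of_mem _ (hΩ hz), mul_comm]
    rfl
  · have h1 := σ.hom.app_res inf_le_left hΩ e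
    have h2 := σ'.hom.app_res inf_le_right hΩ e
    have h3 : σ'.hom.app _ inf_le_right e - σ.hom.app _ inf_le_left e = S.f.val.app _ r₀ := hr₀.symm
    have e1 : σ.hom.app Ω h s = q • σ.hom.app Ω h (res _ hΩ e) :=
      (congrArg (σ.hom.app Ω h) hs).trans (_root_.map_smul (σ.hom.app Ω h) q _)
    have e2 : σ'.hom.app Ω h' s = q • σ'.hom.app Ω h' (res _ hΩ e) :=
      (congrArg (σ'.hom.app Ω h') hs).trans (_root_.map_smul (σ'.hom.app Ω h') q _)
    rw [e1, e2, hom_app_smul, app_res, ← h3, map_sub, h1, h2, smul_sub]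

lemma cechExt_iff (τ : Hol annulus) (x : Abelian.Ext (lineSheaf 2) (lineSheaf 0) 1) :
    CechExt 2 0 τ x ↔ ∃ S : Extn (lineSheaf 2) (lineSheaf 0), S.cls = x ∧
      ∃ (D D' : Opens PLine) (_ : IsNhdU D) (_ : IsNhdV D')
        (σU : LocalSplitting S.g D) (σV : LocalSplitting S.g D')
        (t : ℂ → ℂ) (ht : ∀ z ∈ annulus, AnalyticAt ℂ t z), germ t (analytic_mem ht) = τ.1 ∧
        IsCocycle S.f σU.hom σV.hom (fun z => z ^ ((0 : ℤ) - 2) * t z) := Iff.rfl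

lemma coe_mem_of_annulus {D D' : Opens PLine} (hD : IsNhdU D) (hD' : IsNhdV D') {z : ℂ}
    (hz : z ∈ annulus) : (z : OnePoint ℂ) ∈ D ∧ (z : OnePoint ℂ) ∈ D' := by
  refine ⟨hD.1 z hz.2, ?_⟩
  have := hD'.2.1 z⁻¹ (inv_ne_zero (ne_zero_of_mem hz)) (inclV.mapsTo hz)
  rwa [inv_inv] at this

/-- Every class in `Ext¹(𝒪(2), 𝒪)` is described by a cocycle. -/
lemma exists_cechExt (x : Abelian.Ext (lineSheaf 2) (lineSheaf 0) 1) : ∃ τ, CechExt 2 0 τ x := by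
  obtain ⟨S, rfl⟩ := Extn.exists_cls_eq x
  obtain ⟨σU⟩ := exists_splitting_U S
  obtain ⟨σV⟩ := exists_splitting_V S
  obtain ⟨ρ, hρ, hc⟩ := exists_isCocycle S σU σV isNhdU_ball.2
  -- The function `ρ` is the cocycle in the frames over `U`; the factor `z²` passes to the frames
  -- over `V`.
  have ht : ∀ z ∈ annulus, AnalyticAt ℂ (fun z => z ^ (2 : ℤ) * ρ z) z := fun z hz => by
    obtain ⟨h1, h2⟩ := coe_mem_of_annulus isNhdU_ball isNhdV_ball hz
    exact (analyticAt_id.zpow (ne_zero_of_mem hz)).mul (hρ z h1 h2)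
  refine ⟨⟨_, _, ht, rfl⟩, (cechExt_iff _ _).2 ⟨S, rfl, _, _, isNhdU_ball, isNhdV_ball, σU, σV, _,
    ht, rfl, fun Ω h h' s => ?_⟩⟩
  obtain ⟨r, hr, hr'⟩ := hc Ω h h' s
  refine ⟨r, fun z hz => ?_, hr'⟩
  have hz0 : z ≠ 0 := fun h0 => isNhdV_ball.2.2 (by rw [← h0]; exact h' hz)
  change fn r ⟨z, hz⟩ = z ^ ((0 : ℤ) - 2) * (z ^ (2 : ℤ) * ρ z) * _
  rw [hr z hz, ← mul_assoc, ← zpow_add₀ hz0]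
  norm_num

/-- The points of `D` where the function `F` of the coordinate of a chart is analytic. -/
def Chart.restrict (C : Chart) (D : Opens PLine) (s : Set ℂ) (hs : IsOpen s) : Opens PLine :=
  D ⊓ ⟨C.dom ∩ C.χ ⁻¹' s, C.contOn.isOpen_inter_preimage C.dom.isOpen hs⟩

lemma isNhdU_restrict {D : Opens PLine} (hD : IsNhdU D) {s : Set ℂ} (hs : IsOpen s)
    (h : disk ⊆ s) : IsNhdU (chartU.restrict D s hs) :=
  ⟨fun z hz => ⟨hD.1 z hz, OnePoint.coe_ne_infty z, h hz⟩, fun hx => hD.2 hx.1⟩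

lemma isNhdV_restrict {D : Opens PLine} (hD : IsNhdV D) {s : Set ℂ} (hs : IsOpen s)
    (h : disk ⊆ s) : IsNhdV (chartV.restrict D s hs) := by
  refine ⟨⟨hD.1, OnePoint.infty_ne_coe _, h ?_⟩, fun ξ h0 hξ => ⟨hD.2.1 ξ h0 hξ, fun hx => ?_, ?_⟩,
    fun hx => hD.2.2 hx.1⟩
  · change ‖(0 : ℂ)‖ ≤ 2
    simp
  · exact inv_ne_zero h0 (OnePoint.coe_injective hx)
  · change (ξ⁻¹)⁻¹ ∈ s
    rw [inv_inv]
    exact h hξ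

/-- Splittings may be changed by multiplications, which changes the cocycle by a coboundary. -/
lemma CechExt.add_cechD {τ : Hol annulus} {x : Abelian.Ext (lineSheaf 2) (lineSheaf 0) 1}
    (hx : CechExt 2 0 τ x) (h : Hol disk × Hol disk) : CechExt 2 0 (τ + cechD 2 0 h) x := by
  obtain ⟨S, rfl, D, D', hD, hD', σU, σV, t, ht, htτ, hc⟩ := (cechExt_iff _ _).1 hx
  obtain ⟨⟨_, P, hP, rfl⟩, ⟨_, G, hG, rfl⟩⟩ := h
  -- The germs `P` and `G` are holomorphic only near the disks, so the neighbourhoods shrink to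
  -- where they act as homomorphisms `𝒪(2) → 𝒪`, that is, as sections of `𝒪(-2)`.
  let D₁ := chartU.restrict D {z | AnalyticAt ℂ P z} (isOpen_analyticAt ℂ P)
  let D₁' := chartV.restrict D' {z | AnalyticAt ℂ G z} (isOpen_analyticAt ℂ G)
  let μU : LocalHom (lineSheaf 2) (lineSheaf 0) D₁ := LocalHom.mul (by norm_num)
    (fun x => P (chiU x)) (isSec_of_U (-2) (fun x (hx : x ∈ D₁) => hx.2.1) fun z (hz : (z : OnePoint ℂ) ∈ D₁) => hz.2.2)
  let μV : LocalHom (lineSheaf 2) (lineSheaf 0) D₁' := LocalHom.mul (by norm_num)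
    (fnV (-2) G) (isSec_of_V (-2) (fun x (hx : x ∈ D₁') => hx.2.1) fun ξ (hξ : psiV ξ ∈ D₁') => by
      have := hξ.2.2
      rwa [Set.mem_preimage, show chartV.χ = chiV from rfl, chiV_psiV] at this)
  have hker : ∀ Ω s, S.g.val.app (op Ω) (S.f.val.app (op Ω) s) = 0 := fun Ω s =>
    congrArg (fun φ => φ.val.app (op Ω) s) S.w
  let φU : LocalHom (lineSheaf 2) S.E D₁ := σU.hom.restrict (show D₁ ≤ D from inf_le_left) + (LocalHom.ofHom S.f D₁).comp μU
  let φV : LocalHom (lineSheaf 2) S.E D₁' := σV.hom.restrict (show D₁' ≤ D' from inf_le_left) + (LocalHom.ofHom S.f D₁').comp μV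
  have ht' : ∀ z ∈ annulus, AnalyticAt ℂ (fun z => t z + (G z⁻¹ - z ^ (2 - 0 : ℤ) * P z)) z :=
    fun z hz => (ht z hz).add (((hG _ (inclV.mapsTo hz)).fun_comp
      (analyticAt_inv (ne_zero_of_mem hz))).sub
      ((analyticAt_id.zpow (ne_zero_of_mem hz)).mul (hP z hz.2)))
  refine (cechExt_iff _ _).2 ⟨S, rfl, D₁, D₁', isNhdU_restrict hD _ hP, isNhdV_restrict hD' _ hG,
    φU.splitting fun Ω h s => ?_, φV.splitting fun Ω h s => ?_, _, ht', ?_,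
    hc.add _ _ μU μV fun Ω h h' s z hz => ?_⟩
  · rw [LocalHom.add_app, LocalHom.comp_app, LocalHom.ofHom_app, map_add, hker, add_zero]
    exact σU.split Ω _ s
  · rw [LocalHom.add_app, LocalHom.comp_app, LocalHom.ofHom_app, map_add, hker, add_zero]
    exact σV.split Ω _ s
  · rw [Submodule.coe_add, ← htτ]
    rfl
  · have hz0 : z ≠ 0 := fun h0 => (h' hz).2.1 (by rw [h0]; rfl)
    rw [LocalHom.fn_mul, LocalHom.fn_mul, fnV_coe, chiU_coe]
    have h1 : z ^ ((0 : ℤ) - 2) * z ^ (2 - 0 : ℤ) = 1 := by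
      rw [← zpow_add₀ hz0]
      norm_num
    have h2 : z ^ (-2 : ℤ) = z ^ ((0 : ℤ) - 2) := by norm_num
    rw [h2]
    linear_combination (P z * fn s ⟨z, hz⟩) * h1

end Cocycles

/-! ### Criteria for exactness in terms of sections. -/

section ExactSections

open Limits

variable {N E M : SheafOfModules.{0} structSheaf}

lemma app_injective (f : N ⟶ E) [Mono f] (Ω : Opens PLine) :
    Function.Injective (f.val.app (op Ω)) := by
  have h : Mono ((SheafOfModules.evaluation structSheaf (op Ω)).map f) := inferInstance
  exact (ModuleCat.mono_iff_injective _).1 h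

lemma mono_of_injective (f : N ⟶ E) (h : ∀ Ω : Opens PLine, Function.Injective (f.val.app (op Ω))) :
    Mono f :=
  ⟨fun _ _ hab => sheafHom_ext fun Ω m => h Ω.unop
    (congrArg (fun φ => φ.val.app Ω m) hab)⟩

/-- Two morphisms which agree after `g` agree on local lifts, and a section of a sheaf is determined
locally. -/
lemma epi_of_locally_surjective (g : E ⟶ M)
    (h : ∀ (Ω : Opens PLine) (m : M.val.obj (op Ω)) (x : Ω), ∃ (B : Opens PLine) (hB : B ≤ Ω)
      (e : E.val.obj (op B)), x.1 ∈ B ∧ g.val.app (op B) e = res M hB m) : Epi g := by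
  refine ⟨fun {P} a b hab => sheafHom_ext fun Ω m => ?_⟩
  choose B hB e hx he using h Ω.unop m
  refine eq_of_res (M := P) (Ω := Ω.unop) B hB
    (fun x hxΩ => Opens.mem_iSup.2 ⟨⟨x, hxΩ⟩, hx ⟨x, hxΩ⟩⟩) fun x => ?_
  refine (app_res a (hB x) m).symm.trans (Eq.trans ?_ (app_res b (hB x) m))
  rw [← he x]
  exact congrArg (fun φ => φ.val.app (op (B x)) (e x)) hab

/-- Exactness in the middle means that `f` maps epimorphically onto the kernel of `g`; by `hfg` it
is even surjective on sections. -/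
lemma shortExact_of_sections (f : N ⟶ E) (g : E ⟶ M) (w : f ≫ g = 0)
    (hf : ∀ Ω : Opens PLine, Function.Injective (f.val.app (op Ω)))
    (hfg : ∀ (Ω : Opens PLine) (e : E.val.obj (op Ω)), g.val.app (op Ω) e = 0 →
      ∃ n, f.val.app (op Ω) n = e)
    (hg : ∀ (Ω : Opens PLine) (m : M.val.obj (op Ω)) (x : Ω), ∃ (B : Opens PLine) (hB : B ≤ Ω)
      (e : E.val.obj (op B)), x.1 ∈ B ∧ g.val.app (op B) e = res M hB m) :
    (ShortComplex.mk f g w).ShortExact := by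
  refine { exact := ?_, mono_f := mono_of_injective f hf, epi_g := epi_of_locally_surjective g hg }
  rw [ShortComplex.exact_iff_epi_kernel_lift]
  refine epi_of_locally_surjective (kernel.lift g f w) fun Ω k x => ?_
  obtain ⟨n, hn⟩ := hfg Ω ((kernel.ι g).val.app (op Ω) k)
    (congrArg (fun φ => φ.val.app (op Ω) k) (kernel.condition g))
  refine ⟨Ω, le_rfl, n, x.2, ?_⟩
  rw [res_self]
  refine app_injective (kernel.ι g) Ω (Eq.trans ?_ hn)
  exact congrArg (fun φ => φ.val.app (op Ω) n) (kernel.lift_ι g f w)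

lemma hom_ext_of_cover {D D' : Opens PLine} (hcov : ∀ x, x ∈ D ∨ x ∈ D') (f g : M ⟶ N)
    (h : ∀ Ω ≤ D, ∀ s, f.val.app (op Ω) s = g.val.app (op Ω) s)
    (h' : ∀ Ω ≤ D', ∀ s, f.val.app (op Ω) s = g.val.app (op Ω) s) : f = g := by
  refine sheafHom_ext fun Ω s => ?_
  refine eq_of_res (M := N) (Ω := Ω.unop) (fun b : Bool => if b then Ω.unop ⊓ D else Ω.unop ⊓ D')
    (fun b => by cases b <;> exact inf_le_left) (fun x hx => ?_) fun b => ?_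
  · rcases hcov x with hx' | hx'
    · exact Opens.mem_iSup.2 ⟨true, hx, hx'⟩
    · exact Opens.mem_iSup.2 ⟨false, hx, hx'⟩
  · refine (app_res f _ s).symm.trans (Eq.trans ?_ (app_res g _ s))
    cases b
    · exact h' _ inf_le_right _
    · exact h _ inf_le_right _

/-- A morphism over all of `ℙ¹`. -/
def LocalHom.toHom (φ : LocalHom M N ⊤) : M ⟶ N where
  val :=
    { app := fun Ω => ModuleCat.ofHom (φ.app Ω.unop le_top)
      naturality := fun {Ω Ω'} i => by
        ext s
        exact (φ.app_res le_top i.unop.le s).symm }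

end ExactSections

/-! ### The Koszul extension of `𝒪(2)` by `𝒪`. -/

section Koszul

open Limits

variable {Ω : Opens PLine}

/-- The section of `𝒪(1)` which vanishes at `∞`. -/
def secOne : OnePoint ℂ → ℂ
  | none => 0
  | some _ => 1

/-- The section of `𝒪(1)` which vanishes at `0`. -/
def secZ : OnePoint ℂ → ℂ
  | none => 1
  | some z => z

@[simp] lemma secOne_infty : secOne OnePoint.infty = 0 := rfl
@[simp] lemma secOne_coe (z : ℂ) : secOne z = 1 := rfl
@[simp] lemma secZ_infty : secZ OnePoint.infty = 1 := rfl
@[simp] lemma secZ_coe (z : ℂ) : secZ z = z := rfl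

lemma extZero_top (F : OnePoint ℂ → ℂ) : extZero (fun x : (⊤ : Opens PLine) => F x) = F :=
  funext fun _ => extZero_of_mem _ (Opens.mem_top _)

lemma isSec_secOne : IsSec 1 fun x : (⊤ : Opens PLine) => secOne x := by
  rw [IsSec, extZero_top]
  refine ⟨fun z _ => analyticAt_const (v := (1 : ℂ)), fun _ => ?_⟩
  convert analyticAt_id (𝕜 := ℂ) (E := ℂ) (z := 0) using 1
  funext ξ
  by_cases h : ξ = 0 <;> simp [coordV, h]

lemma isSec_secZ : IsSec 1 fun x : (⊤ : Opens PLine) => secZ x := by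
  rw [IsSec, extZero_top]
  refine ⟨fun z _ => analyticAt_id, fun _ => ?_⟩
  convert analyticAt_const (𝕜 := ℂ) (v := (1 : ℂ)) (x := (0 : ℂ)) using 1
  funext ξ
  by_cases h : ξ = 0 <;> simp [coordV, h]

variable {i j : ℤ}

def mulOne (h : 1 + i = j) : lineSheaf i ⟶ lineSheaf j := (LocalHom.mul h _ isSec_secOne).toHom
def mulZ (h : 1 + i = j) : lineSheaf i ⟶ lineSheaf j := (LocalHom.mul h _ isSec_secZ).toHom

lemma fn_mulOne (h : 1 + i = j) (s : (lineSheaf i).val.obj (op Ω)) (x : Ω) :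
    fn ((mulOne h).val.app (op Ω) s) x = secOne x * fn s x := rfl
lemma fn_mulZ (h : 1 + i = j) (s : (lineSheaf i).val.obj (op Ω)) (x : Ω) :
    fn ((mulZ h).val.app (op Ω) s) x = secZ x * fn s x := rfl

/-- The homogeneous coordinates `secOne` and `secZ` have no common zero, so their Koszul complex is
exact. In the frames over `U` its maps are `s ↦ (s, z s)` and `(a, b) ↦ z a - b`. -/
abbrev koszulE : SheafOfModules.{0} structSheaf := lineSheaf 1 ⊞ lineSheaf 1

def koszulF : lineSheaf 0 ⟶ koszulE := biprod.lift (mulOne (add_zero 1)) (mulZ (add_zero 1))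
def koszulG : koszulE ⟶ lineSheaf 2 := biprod.desc (mulZ one_add_one_eq_two) (-mulOne one_add_one_eq_two)

/-- The components of a section. -/
def fst₁ (e : koszulE.val.obj (op Ω)) : (lineSheaf 1).val.obj (op Ω) :=
  (biprod.fst : koszulE ⟶ lineSheaf 1).val.app (op Ω) e
def snd₁ (e : koszulE.val.obj (op Ω)) : (lineSheaf 1).val.obj (op Ω) :=
  (biprod.snd : koszulE ⟶ lineSheaf 1).val.app (op Ω) e

/-- The biproduct is only known by its universal property; evaluating `biprod.total` on a section
recovers the section from its components. -/
lemma pair_ext {e e' : koszulE.val.obj (op Ω)} (h : fst₁ e = fst₁ e') (h' : snd₁ e = snd₁ e') :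
    e = e' := by
  have key : ∀ e : koszulE.val.obj (op Ω),
      (biprod.inl : _ ⟶ koszulE).val.app (op Ω) (fst₁ e) +
        (biprod.inr : _ ⟶ koszulE).val.app (op Ω) (snd₁ e) = e := fun e =>
    congrArg (fun φ => φ.val.app (op Ω) e) (biprod.total (X := lineSheaf 1) (Y := lineSheaf 1))
  rw [← key e, ← key e', h, h']

lemma exists_pair (a b : (lineSheaf 1).val.obj (op Ω)) : ∃ e, fst₁ e = a ∧ snd₁ e = b := by
  refine ⟨(biprod.inl : _ ⟶ koszulE).val.app (op Ω) a +
    (biprod.inr : _ ⟶ koszulE).val.app (op Ω) b, ?_, ?_⟩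
  · refine (_root_.map_add ((biprod.fst : koszulE ⟶ lineSheaf 1).val.app (op Ω)).hom _ _).trans ?_
    refine (congrArg₂ (· + ·)
      (congrArg (fun φ => φ.val.app (op Ω) a) (biprod.inl_fst (X := lineSheaf 1) (Y := lineSheaf 1)))
      (congrArg (fun φ => φ.val.app (op Ω) b)
        (biprod.inr_fst (X := lineSheaf 1) (Y := lineSheaf 1)))).trans (add_zero _)
  · refine (_root_.map_add ((biprod.snd : koszulE ⟶ lineSheaf 1).val.app (op Ω)).hom _ _).trans ?_
    refine (congrArg₂ (· + ·)
      (congrArg (fun φ => φ.val.app (op Ω) a) (biprod.inl_snd (X := lineSheaf 1) (Y := lineSheaf 1)))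
      (congrArg (fun φ => φ.val.app (op Ω) b)
        (biprod.inr_snd (X := lineSheaf 1) (Y := lineSheaf 1)))).trans (zero_add _)

lemma fn_koszulG (e : koszulE.val.obj (op Ω)) (x : Ω) :
    fn (koszulG.val.app (op Ω) e) x = secZ x * fn (fst₁ e) x - secOne x * fn (snd₁ e) x := by
  have h : koszulG = biprod.fst ≫ mulZ one_add_one_eq_two + biprod.snd ≫ (-mulOne one_add_one_eq_two) :=
    biprod.desc_eq
  rw [h, sub_eq_add_neg]
  rfl

lemma fst_koszulF (s : (lineSheaf 0).val.obj (op Ω)) :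
    fst₁ (koszulF.val.app (op Ω) s) = (mulOne (add_zero 1)).val.app (op Ω) s :=
  congrArg (fun φ => φ.val.app (op Ω) s) (biprod.lift_fst (mulOne (add_zero 1)) (mulZ (add_zero 1)))

lemma snd_koszulF (s : (lineSheaf 0).val.obj (op Ω)) :
    snd₁ (koszulF.val.app (op Ω) s) = (mulZ (add_zero 1)).val.app (op Ω) s :=
  congrArg (fun φ => φ.val.app (op Ω) s) (biprod.lift_snd (mulOne (add_zero 1)) (mulZ (add_zero 1)))

lemma koszulG_koszulF (s : (lineSheaf 0).val.obj (op Ω)) :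
    koszulG.val.app (op Ω) (koszulF.val.app (op Ω) s) = 0 := fn_ext fun x => by
  rw [fn_koszulG, fst_koszulF, snd_koszulF, fn_mulOne, fn_mulZ, fn_zero]
  ring

/-- At `∞`, where `secOne` vanishes, the second component detects the section; elsewhere the first
one does. -/
lemma koszulF_injective : Function.Injective (koszulF.val.app (op Ω)) := fun s t h => by
  refine fn_ext fun x => ?_
  obtain ⟨x, hx⟩ := x
  induction x using OnePoint.rec with
  | infty =>
    have := congrArg (fun e => fn (snd₁ e) ⟨_, hx⟩) h
    beta_reduce at this
    rwa [snd_koszulF, snd_koszulF, fn_mulZ, fn_mulZ, secZ_infty, one_mul, one_mul] at this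
  | coe z =>
    have := congrArg (fun e => fn (fst₁ e) ⟨_, hx⟩) h
    beta_reduce at this
    rwa [fst_koszulF, fst_koszulF, fn_mulOne, fn_mulOne, secOne_coe, one_mul, one_mul] at this

lemma exists_koszulF_eq (e : koszulE.val.obj (op Ω)) (he : koszulG.val.app (op Ω) e = 0) :
    ∃ s, koszulF.val.app (op Ω) s = e := by
  let a := extZero (fn (fst₁ e))
  let b := extZero (fn (snd₁ e))
  have hab : ∀ x ∈ Ω, secZ x * a x = secOne x * b x := fun x hx => by
    have := congrArg (fun s => fn s ⟨x, hx⟩) he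
    beta_reduce at this
    rw [fn_koszulG, fn_zero] at this
    change secZ x * extZero _ x = secOne x * extZero _ x
    rw [extZero_of_mem _ hx, extZero_of_mem _ hx]
    linear_combination this
  -- Since `z a = b`, the preimage is `a` away from `∞`. At `∞` it is `b`, because `secZ` has the
  -- coordinate 1 there.
  let n : OnePoint ℂ → ℂ
    | none => b OnePoint.infty
    | some z => a (z : ℂ)
  have hn : ∀ x ∈ Ω, extZero (fun x : Ω => n x) x = n x := fun x hx => extZero_of_mem _ hx
  have hsec : IsSec 0 fun x : Ω => n x := by
    refine ⟨fun z hz => ((isSec_fn (fst₁ e)).1 z hz).congr (sec_congr_coe hn hz).symm, fun hx => ?_⟩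
    refine (AnalyticAt.congr ((isSec_fn (snd₁ e)).2 hx) ?_).congr (sec_congr_infty 0 hn hx).symm
    filter_upwards [eventually_inv hx] with ξ hξ
    by_cases h : ξ = 0
    · simp [coordV, h, n, b]
    · have := hab _ (hξ h)
      rw [secZ_coe, secOne_coe, one_mul] at this
      rw [coordV, coordV, if_neg h, if_neg h, zpow_one, zpow_zero, one_mul]
      change ξ * b _ = a _
      rw [← this, mul_inv_cancel_left₀ h]
  refine ⟨mkSec _ hsec, pair_ext ?_ ?_⟩
  · rw [fst_koszulF]
    refine fn_ext fun ⟨x, hx⟩ => ?_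
    rw [fn_mulOne, ← extZero_of_mem (fn (fst₁ e)) hx, fn_mkSec]
    have := hab x hx
    induction x using OnePoint.rec with
    | infty =>
      rw [secZ_infty, secOne_infty, zero_mul, one_mul] at this
      exact (zero_mul _).trans this.symm
    | coe z => exact one_mul _
  · rw [snd_koszulF]
    refine fn_ext fun ⟨x, hx⟩ => ?_
    rw [fn_mulZ, ← extZero_of_mem (fn (snd₁ e)) hx, fn_mkSec]
    have := hab x hx
    induction x using OnePoint.rec with
    | infty => exact one_mul _
    | coe z =>
      rw [secOne_coe, one_mul] at this
      exact this

lemma secZ_mul_fnV (c : ℂ) (x : OnePoint ℂ) (hx : x ∈ domV) : secZ x * fnV (-1) (fun _ => c) x = c := by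
  induction x using OnePoint.rec with
  | infty => simp
  | coe z =>
    have hz : z ≠ 0 := fun h => hx (by rw [h]; rfl)
    rw [fnV_coe, secZ_coe, zpow_neg_one, mul_inv_cancel_left₀ hz]

lemma isSec_fnV_const (n : ℤ) (c : ℂ) {D : Opens PLine} (h : D ≤ domV) :
    IsSec n fun x : D => fnV n (fun _ => c) x :=
  isSec_of_V n h fun _ _ => analyticAt_const

lemma isSec_const_U (n : ℤ) (c : ℂ) {D : Opens PLine} (h : D ≤ domU) :
    IsSec n fun _ : D => c :=
  isSec_of_U n h (F := fun _ => c) fun _ _ => analyticAt_const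

/-- Away from `∞` the section `secOne` is invertible, away from `0` the section `secZ` is; dividing
by it gives a preimage with one zero component. -/
lemma exists_koszulG_eq (m : (lineSheaf 2).val.obj (op Ω)) (x : Ω) :
    ∃ (B : Opens PLine) (hB : B ≤ Ω) (e : koszulE.val.obj (op B)), x.1 ∈ B ∧
      koszulG.val.app (op B) e = res _ hB m := by
  obtain ⟨x, hx⟩ := x
  by_cases h : x ∈ domU
  · let μ : LocalHom (lineSheaf 2) (lineSheaf 1) (Ω ⊓ domU) :=
      LocalHom.mul (by norm_num) (fun _ => 1) (isSec_const_U (-1) 1 inf_le_right)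
    obtain ⟨e, h1, h2⟩ := exists_pair 0 (-μ.app _ le_rfl (res _ inf_le_left m))
    refine ⟨Ω ⊓ domU, inf_le_left, e, ⟨hx, h⟩, fn_ext fun ⟨y, hy⟩ => ?_⟩
    rw [fn_koszulG, h1, h2, fn_neg, fn_zero, LocalHom.fn_mul]
    induction y using OnePoint.rec with
    | infty => exact absurd rfl hy.2
    | coe z =>
      rw [secOne_coe]
      ring
  · have hx' : x ∈ domV := fun h0 => h (by
      rw [show x = ((0 : ℂ) : OnePoint ℂ) from h0]
      exact OnePoint.coe_ne_infty 0)
    let μ : LocalHom (lineSheaf 2) (lineSheaf 1) (Ω ⊓ domV) :=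
      LocalHom.mul (by norm_num) _ (isSec_fnV_const (-1) 1 inf_le_right)
    obtain ⟨e, h1, h2⟩ := exists_pair (μ.app _ le_rfl (res _ inf_le_left m)) 0
    refine ⟨Ω ⊓ domV, inf_le_left, e, ⟨hx, hx'⟩, fn_ext fun ⟨y, hy⟩ => ?_⟩
    rw [fn_koszulG, h1, h2, fn_zero, LocalHom.fn_mul]
    have := secZ_mul_fnV 1 y hy.2
    linear_combination (fn (res _ _ m) ⟨y, hy⟩) * this

/-- The Koszul extension `0 → 𝒪 → 𝒪(1) ⊕ 𝒪(1) → 𝒪(2) → 0`. -/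
def koszul : Extn (lineSheaf 2) (lineSheaf 0) where
  E := koszulE
  f := koszulF
  g := koszulG
  w := sheafHom_ext fun Ω s => koszulG_koszulF (Ω := Ω.unop) s
  exact := shortExact_of_sections _ _ _ (fun _ => koszulF_injective) (fun _ => exists_koszulF_eq)
    fun _ => exists_koszulG_eq

end Koszul

/-! ### Classes of extensions as multiples of the Koszul class. -/

section KoszulClass

open Limits

/-- The restriction of a splitting. -/
def LocalSplitting.restrict {E M : SheafOfModules.{0} structSheaf} {g : E ⟶ M} {D D' : Opens PLine}
    (σ : LocalSplitting g D) (h : D' ≤ D) : LocalSplitting g D' where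
  σ Ω hΩ := σ.σ Ω (hΩ.trans h)
  naturality hΩ hΩ' i s := σ.naturality (hΩ.trans h) (hΩ'.trans h) i s
  split Ω hΩ s := σ.split Ω (hΩ.trans h) s

lemma smul_id_app (c : ℂ) (Ω : Opens PLine) (s : (lineSheaf 0).val.obj (op Ω)) :
    (c • 𝟙 (lineSheaf 0)).val.app (op Ω) s = constSec c (op Ω) • s := by
  have h : c • 𝟙 (lineSheaf 0) = scal c (lineSheaf 0) := Category.id_comp (scal c (lineSheaf 0))
  rw [h]
  rfl

/-- An extension with the cocycle `c z⁻¹` in the frames over `U` is a multiple of the Koszul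
extension. -/
lemma cls_eq_smul_koszul (S : Extn (lineSheaf 2) (lineSheaf 0)) (c : ℂ) {D D' : Opens PLine}
    (hU : D ≤ domU) (hV : D' ≤ domV) (hcov : ∀ x, x ∈ D ∨ x ∈ D') (σ : LocalSplitting S.g D)
    (σ' : LocalSplitting S.g D') {ρ : ℂ → ℂ} (hc : IsCocycle S.f σ.hom σ'.hom ρ)
    (hρ : ∀ z : ℂ, (z : OnePoint ℂ) ∈ D → (z : OnePoint ℂ) ∈ D' → ρ z = c * z⁻¹) :
    S.cls = c • koszul.cls := by
  -- In the frames over `U` these maps are `(a, b) ↦ c a` and `(a, b) ↦ c z⁻¹ b`. Their difference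
  -- on the overlap is `c z⁻¹ (z a - b)`, the cocycle applied to `koszulG (a, b)`. This is what lets
  -- the two local morphisms into `S.E` glue.
  let α : LocalHom koszulE (lineSheaf 0) D :=
    (LocalHom.mul (neg_add_cancel 1) (fun _ => c) (isSec_const_U (-1) c hU)).comp
      (LocalHom.ofHom biprod.fst D)
  let α' : LocalHom koszulE (lineSheaf 0) D' :=
    (LocalHom.mul (neg_add_cancel 1) _ (isSec_fnV_const (-1) c hV)).comp
      (LocalHom.ofHom biprod.snd D')
  have hα : ∀ Ω h e x, fn (α.app Ω h e) x = c * fn (fst₁ e) x := fun _ _ _ _ => rfl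
  have hα' : ∀ Ω h e x, fn (α'.app Ω h e) x = fnV (-1) (fun _ => c) x * fn (snd₁ e) x :=
    fun _ _ _ _ => rfl
  clear_value α α'
  have hker : ∀ Ω s, S.g.val.app (op Ω) (S.f.val.app (op Ω) s) = 0 := fun Ω s =>
    congrArg (fun φ => φ.val.app (op Ω) s) S.w
  obtain ⟨φ, hφ, hφ'⟩ := LocalHom.exists_glue
    ((LocalHom.ofHom S.f D).comp α + σ.hom.comp (LocalHom.ofHom koszulG D))
    ((LocalHom.ofHom S.f D').comp α' + σ'.hom.comp (LocalHom.ofHom koszulG D')) hcov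
    fun Ω h h' e => by
      obtain ⟨r, hr, hr'⟩ := hc Ω h h' (koszulG.val.app (op Ω) e)
      have key : α.app Ω h e = α'.app Ω h' e + r := fn_ext fun ⟨x, hx⟩ => by
        induction x using OnePoint.rec with
        | infty => exact absurd rfl (hU (h hx))
        | coe z =>
          have hz : z ≠ 0 := fun h0 => hV (h' hx) (by rw [h0]; rfl)
          rw [fn_add, hα, hα', hr, hρ z (h hx) (h' hx), fn_koszulG, secZ_coe, secOne_coe, fnV_coe,
            zpow_neg_one]
          linear_combination (-c * fn (fst₁ e) ⟨z, hx⟩) * (inv_mul_cancel₀ hz)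
      change S.f.val.app (op Ω) (α.app Ω h e) + σ.hom.app Ω h (koszulG.val.app (op Ω) e) =
        S.f.val.app (op Ω) (α'.app Ω h' e) + σ'.hom.app Ω h' (koszulG.val.app (op Ω) e)
      rw [key, sub_eq_iff_eq_add.1 hr', ← add_assoc]
      exact congrArg (· + _) (_root_.map_add (S.f.val.app (op Ω)).hom (α'.app Ω h' e) r)
  have hφ₁ : ∀ Ω (h : Ω ≤ D) e, φ.val.app (op Ω) e = S.f.val.app (op Ω) (α.app Ω h e) +
      σ.σ Ω h (koszulG.val.app (op Ω) e) := hφ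
  have hφ₂ : ∀ Ω (h : Ω ≤ D') e, φ.val.app (op Ω) e = S.f.val.app (op Ω) (α'.app Ω h e) +
      σ'.σ Ω h (koszulG.val.app (op Ω) e) := hφ'
  refine Extn.cls_eq_smul koszul S c φ (hom_ext_of_cover hcov _ _ ?_ ?_)
    (hom_ext_of_cover hcov _ _ ?_ ?_)
  · intro Ω h s
    change φ.val.app (op Ω) (koszulF.val.app (op Ω) s) =
      S.f.val.app (op Ω) ((c • 𝟙 (lineSheaf 0)).val.app (op Ω) s)
    rw [hφ₁ Ω h, koszulG_koszulF, map_zero, add_zero, smul_id_app]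
    congr 1
    refine fn_ext fun ⟨x, hx⟩ => ?_
    rw [hα, fst_koszulF, fn_mulOne, fn_smul]
    induction x using OnePoint.rec with
    | infty => exact absurd rfl (hU (h hx))
    | coe z => exact congrArg (c * ·) (one_mul _)
  · intro Ω h s
    change φ.val.app (op Ω) (koszulF.val.app (op Ω) s) =
      S.f.val.app (op Ω) ((c • 𝟙 (lineSheaf 0)).val.app (op Ω) s)
    rw [hφ₂ Ω h, koszulG_koszulF, map_zero, add_zero, smul_id_app]
    congr 1
    refine fn_ext fun x => ?_
    rw [hα', snd_koszulF, fn_mulZ, fn_smul]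
    have := secZ_mul_fnV c x (hV (h x.2))
    change _ = c * fn s x
    linear_combination (fn s x) * this
  · intro Ω h (e : koszulE.val.obj (op Ω))
    change S.g.val.app (op Ω) (φ.val.app (op Ω) e) = koszulG.val.app (op Ω) e
    rw [hφ₁ Ω h, map_add, hker, zero_add, σ.split]
  · intro Ω h (e : koszulE.val.obj (op Ω))
    change S.g.val.app (op Ω) (φ.val.app (op Ω) e) = koszulG.val.app (op Ω) e
    rw [hφ₂ Ω h, map_add, hker, zero_add, σ'.split]

lemma mem_or_mem {D D' : Opens PLine} (hD : IsNhdU D) (hD' : IsNhdV D') (x : OnePoint ℂ) :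
    x ∈ D ∨ x ∈ D' := by
  induction x using OnePoint.rec with
  | infty => exact Or.inr hD'.1
  | coe z =>
    by_cases h : z ∈ disk
    · exact Or.inl (hD.1 z h)
    · have h2 : 2 < ‖z‖ := not_le.1 h
      have h0 : z ≠ 0 := norm_pos_iff.1 (by linarith)
      refine Or.inr ?_
      have := hD'.2.1 z⁻¹ (inv_ne_zero h0) (by
        change ‖z⁻¹‖ ≤ 2
        rw [norm_inv]
        linarith [inv_lt_one_of_one_lt₀ (by linarith : 1 < ‖z‖)])
      rwa [inv_inv] at this

/-- The cocycle `c z` describes the multiple `c` of the Koszul extension only. -/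
lemma CechExt.eq_smul_koszul {τ : Hol annulus} {x : Abelian.Ext (lineSheaf 2) (lineSheaf 0) 1}
    (hx : CechExt 2 0 τ x) (c : ℂ) (hτ : τ.1 = c • zp 1) : x = c • koszul.cls := by
  obtain ⟨S, rfl, D, D', hD, hD', σ, σ', t, ht, htτ, hc⟩ := (cechExt_iff _ _).1 hx
  have h1 : ∀ᶠ z in 𝓝ˢ annulus, t z = c * z ^ (1 : ℤ) := germ_eq.1 (htτ.trans hτ)
  obtain ⟨N, hN, hsub, hNt⟩ := mem_nhdsSet_iff_exists.1 h1
  have hball : IsOpen (Metric.ball (0 : ℂ) (1 / 2)) := Metric.isOpen_ball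
  have hdisk : ∀ z ∈ disk, z ∈ Metric.ball (0 : ℂ) (1 / 2) ∨ z ∈ annulus := fun z hz => by
    by_cases h : ‖z‖ < 1 / 2
    · exact Or.inl (mem_ball_zero_iff.2 h)
    · exact Or.inr ⟨not_lt.1 h, hz⟩
  have hN' : IsOpen ({z : ℂ | z ≠ 0} ∩ (fun z => z⁻¹) ⁻¹' N) :=
    continuousOn_inv₀.isOpen_inter_preimage isOpen_ne hN
  -- The cocycle is known to be `c z` only on the neighbourhood `N` of the annulus. As `|z| < 1/2`
  -- and `|z⁻¹| < 1/2` exclude each other, the shrunken neighbourhoods meet inside `N`.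
  let D₁ := chartU.restrict D (Metric.ball (0 : ℂ) (1 / 2) ∪ N) (hball.union hN)
  let D₁' := chartV.restrict D' (Metric.ball (0 : ℂ) (1 / 2) ∪
    ({z : ℂ | z ≠ 0} ∩ (fun z => z⁻¹) ⁻¹' N)) (hball.union hN')
  have hD₁ : IsNhdU D₁ := isNhdU_restrict hD _ fun z hz => (hdisk z hz).imp_right fun h => hsub h
  have hD₁' : IsNhdV D₁' := isNhdV_restrict hD' _ fun z hz => (hdisk z hz).imp_right fun h =>
    ⟨ne_zero_of_mem h, hsub (norm_inv_mem h)⟩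
  have hle : D₁ ≤ D := inf_le_left
  have hle' : D₁' ≤ D' := inf_le_left
  refine cls_eq_smul_koszul S c (show D₁ ≤ domU from fun x hx => hx.2.1)
    (show D₁' ≤ domV from fun x hx => hx.2.1) (mem_or_mem hD₁ hD₁')
    (σ.restrict hle) (σ'.restrict hle')
    (fun Ω h h' s => hc Ω (h.trans hle) (h'.trans hle') s) fun z hz hz' => ?_
  have h0 : z ≠ 0 := fun h => hz'.2.1 (by rw [h]; rfl)
  have hzN : z ∈ N := by
    rcases hz.2.2 with h | h
    · rcases hz'.2.2 with h' | h'
      · have e1 : ‖z‖ < 1 / 2 := mem_ball_zero_iff.1 h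
        have e2 : ‖z⁻¹‖ < 1 / 2 := mem_ball_zero_iff.1 h'
        have e3 : ‖z‖ * ‖z⁻¹‖ = 1 := by rw [← norm_mul, mul_inv_cancel₀ h0, norm_one]
        nlinarith [norm_nonneg z, norm_nonneg z⁻¹]
      · have : (z⁻¹)⁻¹ ∈ N := h'.2
        rwa [inv_inv] at this
    · exact h
  change z ^ ((0 : ℤ) - 2) * t z = c * z⁻¹
  rw [show t z = c * z ^ (1 : ℤ) from hNt hzN, mul_left_comm, ← zpow_add₀ h0]
  norm_num

/-- A global splitting applied to the frame over `U` gives `(a, b)` with `z a - b = 1`; over `V` its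
second component is `z² b`. The coboundary of `-a` on `U` and of minus the second component on `V`
is then `z² a - z b = z`, contrary to `zp_one_ne_cechD`. -/
lemma koszul_cls_ne_zero : koszul.cls ≠ 0 := by
  intro h
  obtain ⟨s, hs⟩ : ∃ s : lineSheaf 2 ⟶ koszulE, s ≫ koszulG = 𝟙 _ :=
    koszul.exists_section_of_cls_eq_zero h
  have hs' : ∀ Ω m, koszulG.val.app (op Ω) (s.val.app (op Ω) m) = m := fun Ω m =>
    congrArg (fun φ => φ.val.app (op Ω) m) hs
  let eU : (lineSheaf 2).val.obj (op domU) := mkSec _ (isSec_one_U 2)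
  let eV : (lineSheaf 2).val.obj (op domV) := mkSec _ (isSec_fnV_one 2)
  let a := fst₁ (s.val.app (op domU) eU)
  let b := snd₁ (s.val.app (op domU) eU)
  let b' := snd₁ (s.val.app (op domV) eV)
  have hab : ∀ z : ℂ, z * extZero (fn a) (z : OnePoint ℂ) - extZero (fn b) (z : OnePoint ℂ) = 1 := fun z => by
    have hz : (z : OnePoint ℂ) ∈ domU := OnePoint.coe_ne_infty z
    have := congrArg (fun m => fn m ⟨z, hz⟩) (hs' domU eU)
    beta_reduce at this
    rw [fn_koszulG, secZ_coe, secOne_coe, one_mul] at this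
    rw [extZero_of_mem _ hz, extZero_of_mem _ hz]
    exact this
  have hbb : ∀ z : ℂ, z ≠ 0 → extZero (fn b') z = z ^ 2 * extZero (fn b) (z : OnePoint ℂ) := fun z hz => by
    let Ω := domU ⊓ domV
    have hzU : (z : OnePoint ℂ) ∈ domU := OnePoint.coe_ne_infty z
    have hzV : (z : OnePoint ℂ) ∈ domV := fun h => hz (OnePoint.coe_injective h)
    have hle : Ω ≤ domU := inf_le_left
    have hle' : Ω ≤ domV := inf_le_right
    -- The frames of `𝒪(2)` are related by `e_V = z² e_U`.
    let q : structSheaf.obj.obj (op Ω) := mkO _ (isSec_of_U (Ω := Ω) 0 hle (F := fun z => z ^ 2)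
      fun z _ => (analyticAt_id (𝕜 := ℂ) (z := z)).pow 2)
    have hq : res _ hle' eV = q • res _ hle eU := fn_ext fun ⟨x, hx⟩ => by
      induction x using OnePoint.rec with
      | infty => exact absurd rfl (hle hx)
      | coe w =>
        change w ^ (2 : ℤ) * 1 = w ^ 2 * 1
        rw [zpow_ofNat]
    have h1 : res _ hle' b' = q • res _ hle b := by
      change res _ hle' (((s ≫ (biprod.snd : koszulE ⟶ lineSheaf 1)).val.app (op domV)) eV) =
        q • res _ hle (((s ≫ (biprod.snd : koszulE ⟶ lineSheaf 1)).val.app (op domU)) eU)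
      rw [← app_res, ← app_res, hq, hom_app_smul]
    have h2 := congrArg (fun m => fn m (⟨z, hzU, hzV⟩ : Ω)) h1
    rw [extZero_of_mem _ hzV, extZero_of_mem _ hzU]
    exact h2
  have ha : ∀ z ∈ disk, AnalyticAt ℂ (fun z : ℂ => -extZero (fn a) (z : OnePoint ℂ)) z := fun z _ =>
    (analyticAt_extZero (isSec_fn a) (show (z : OnePoint ℂ) ∈ domU from OnePoint.coe_ne_infty z)).neg
  have hβ : ∀ ξ ∈ disk, AnalyticAt ℂ (fun ξ => -coordV 1 (extZero (fn b')) ξ) ξ := fun ξ _ =>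
    (analyticAt_coordV (isSec_fn b') (psiV_mem ξ)).neg
  refine zp_one_ne_cechD (⟨_, _, ha, rfl⟩, ⟨_, _, hβ, rfl⟩)
    (germ_eq.2 (eventually_ne_zero.mono fun z hz => ?_))
  change z ^ (1 : ℤ) = -coordV 1 (extZero (fn b')) z⁻¹ - z ^ (2 - 0 : ℤ) * -extZero (fn a) (z : OnePoint ℂ)
  rw [coordV, if_neg (inv_ne_zero hz), inv_inv, hbb z hz, sub_zero, zpow_one, zpow_one, zpow_ofNat]
  have := hab z
  linear_combination z * extZero (fn b) (z : OnePoint ℂ) * (inv_mul_cancel₀ hz) - z * this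

end KoszulClass

/-! ### The isomorphism of Čech cohomology with `Ext¹`. -/

section Comparison

/-- The coefficient of `z` of an element of `𝒪(W)`. -/
def coeff (τ : Hol annulus) : ℂ := (exists_cechD_eq τ).choose

lemma coeff_spec (τ : Hol annulus) : ∃ h, τ.1 = coeff τ • zp 1 + (cechD 2 0 h).1 :=
  (exists_cechD_eq τ).choose_spec

/-- Two different coefficients would, after rescaling the difference of the coboundaries, exhibit
`z` as a coboundary. So the choice in `coeff` is harmless. -/
lemma coeff_eq {τ : Hol annulus} {c : ℂ} {h : Hol disk × Hol disk}
    (e : τ.1 = c • zp 1 + (cechD 2 0 h).1) : coeff τ = c := by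
  obtain ⟨h', e'⟩ := coeff_spec τ
  by_contra hne
  refine zp_one_ne_cechD ((coeff τ - c)⁻¹ • (h - h')) ?_
  have h0 := sub_ne_zero.2 hne
  rw [_root_.map_smul, map_sub, Submodule.coe_smul, Submodule.coe_sub, eq_inv_smul_iff₀ h0,
    sub_smul, sub_eq_sub_iff_add_eq_add, ← e', add_comm]
  exact e

/-- The coefficient of `z` as a linear functional. -/
def coeffL : Hol annulus →ₗ[ℂ] ℂ where
  toFun := coeff
  map_add' τ τ' := by
    obtain ⟨h, e⟩ := coeff_spec τ
    obtain ⟨h', e'⟩ := coeff_spec τ'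
    refine coeff_eq (h := h + h') ?_
    rw [map_add, Submodule.coe_add, Submodule.coe_add, add_smul, add_add_add_comm, ← e, ← e']
  map_smul' c τ := by
    obtain ⟨h, e⟩ := coeff_spec τ
    refine coeff_eq (h := c • h) ?_
    rw [_root_.map_smul, Submodule.coe_smul, Submodule.coe_smul, RingHom.id_apply, smul_eq_mul,
      mul_smul, ← smul_add, ← e]

lemma coeff_eq_zero_iff (τ : Hol annulus) : coeffL τ = 0 ↔ ∃ h, cechD 2 0 h = τ := by
  constructor
  · intro h0
    obtain ⟨h, e⟩ := coeff_spec τ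
    rw [show coeff τ = 0 from h0, zero_smul, zero_add] at e
    exact ⟨h, Subtype.ext e.symm⟩
  · rintro ⟨h, rfl⟩
    exact coeff_eq (h := h) (by rw [zero_smul, zero_add])

lemma exists_coeff_eq_one : ∃ τ, coeffL τ = 1 :=
  ⟨⟨zp 1, _, fun _ hz => analyticAt_id.zpow (ne_zero_of_mem hz), rfl⟩, coeff_eq (h := 0) (by
    rw [one_smul, map_zero]
    exact (add_zero _).symm)⟩

/-- Removing the coboundary part of `τ` changes the splittings but not the class, and leaves a
multiple of `z`. -/
lemma CechExt.eq_coeff_smul {τ : Hol annulus} {x : Abelian.Ext (lineSheaf 2) (lineSheaf 0) 1}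
    (hx : CechExt 2 0 τ x) : x = coeffL τ • koszul.cls := by
  obtain ⟨h, e⟩ := coeff_spec τ
  refine (hx.add_cechD (-h)).eq_smul_koszul _ ?_
  rw [map_neg, Submodule.coe_add, Submodule.coe_neg, e, add_neg_cancel_right]
  rfl

/-- For the converse, the multiple of the Koszul class has some cocycle `τ'`. As the Koszul class is
nonzero, `τ` and `τ'` have the same coefficient, so they differ by a coboundary, which the
splittings absorb. -/
lemma cechExt_iff_eq (τ : Hol annulus) (x : Abelian.Ext (lineSheaf 2) (lineSheaf 0) 1) :
    CechExt 2 0 τ x ↔ x = coeffL τ • koszul.cls := by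
  refine ⟨CechExt.eq_coeff_smul, ?_⟩
  rintro rfl
  obtain ⟨τ', h'⟩ := exists_cechExt (coeffL τ • koszul.cls)
  have e : coeffL τ = coeffL τ' := smul_left_injective ℂ koszul_cls_ne_zero h'.eq_coeff_smul
  obtain ⟨h, hh⟩ := (coeff_eq_zero_iff (τ - τ')).1 (by rw [map_sub, e, sub_self])
  have := h'.add_cechD h
  rwa [hh, add_sub_cancel] at this

lemma exists_smul_koszul (x : Abelian.Ext (lineSheaf 2) (lineSheaf 0) 1) :
    ∃ c : ℂ, c • koszul.cls = x := by
  obtain ⟨τ, h⟩ := exists_cechExt x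
  exact ⟨_, h.eq_coeff_smul.symm⟩

lemma exists_class (τ : Hol annulus) : ∃ y, IsClass (cech 2 0) 1 (toCech τ) y :=
  IsClass.exists_of_closed (rfl : (1 : ℤ) + 1 = 2) _ (cech_eq_zero (by norm_num) (by norm_num) _)

lemma IsClass.eq_zero_iff_coeff {τ : Hol annulus} {y : (cech 2 0).homology 1}
    (h : IsClass (cech 2 0) 1 (toCech τ) y) : y = 0 ↔ coeffL τ = 0 := by
  rw [h.eq_zero_iff (zero_add 1), coeff_eq_zero_iff, cech_d]
  rfl

/-- The isomorphism of the first cohomology of the Čech complex with `Ext¹(𝒪(2), 𝒪)`. -/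
lemma exists_cechEquiv : ∃ c : (cech 2 0).homology 1 ≃ₗ[ℂ]
    Abelian.Ext (lineSheaf 2) (lineSheaf 0) 1, ∀ (τ : Hol annulus) (y : (cech 2 0).homology 1),
      IsClass (cech 2 0) 1 (toCech τ) y → c y = coeffL τ • koszul.cls := by
  have hrep : ∀ y : (cech 2 0).homology 1, ∃ τ : Hol annulus, IsClass (cech 2 0) 1 (toCech τ) y :=
    fun y => IsClass.exists_rep y
  choose r hr using hrep
  -- The coefficient depends on the cohomology class only, so the chosen representatives `r` give a
  -- linear map.
  have key : ∀ {τ τ' : Hol annulus} {y : (cech 2 0).homology 1},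
      IsClass (cech 2 0) 1 (toCech τ) y → IsClass (cech 2 0) 1 (toCech τ') y →
      coeffL τ = coeffL τ' := fun {τ τ' y} h h' => by
    have h1 : IsClass (cech 2 0) 1 (toCech (τ - τ')) 0 := by
      have := h.sub h'
      rwa [sub_self] at this
    have := h1.eq_zero_iff_coeff.1 rfl
    rwa [map_sub, sub_eq_zero] at this
  let F : (cech 2 0).homology 1 →ₗ[ℂ] Abelian.Ext (lineSheaf 2) (lineSheaf 0) 1 :=
    { toFun := fun y => coeffL (r y) • koszul.cls
      map_add' := fun y y' => by
        rw [key (hr (y + y')) (τ' := r y + r y') ((hr y).add (hr y')), map_add, add_smul]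
      map_smul' := fun a y => by
        rw [key (hr (a • y)) (τ' := a • r y) ((hr y).smul a), _root_.map_smul, RingHom.id_apply,
          smul_assoc] }
  refine ⟨LinearEquiv.ofBijective F ⟨?_, fun x => ?_⟩, fun τ y h => ?_⟩
  · refine (injective_iff_map_eq_zero F).2 fun y hy => ?_
    exact (hr y).eq_zero_iff_coeff.2 ((smul_eq_zero.1 hy).resolve_right koszul_cls_ne_zero)
  · obtain ⟨a, rfl⟩ := exists_smul_koszul x
    obtain ⟨τ, hτ⟩ := exists_coeff_eq_one
    obtain ⟨y, hy⟩ := exists_class (a • τ)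
    refine ⟨y, ?_⟩
    refine (congrArg (· • koszul.cls) (key (hr y) hy)).trans ?_
    beta_reduce
    rw [_root_.map_smul, hτ, smul_eq_mul, mul_one]
  · exact congrArg (· • koszul.cls) (key (hr y) h)

lemma finrank_ext : Module.finrank ℂ (Abelian.Ext (lineSheaf 2) (lineSheaf 0) 1) = 1 :=
  finrank_eq_one koszul.cls koszul_cls_ne_zero exists_smul_koszul

/-- The comparison uses one particular splitting of `τ`; for any other one the difference of the
triples is the coboundary from `d_eq_dbarTriple_sub`. -/
lemma isClass_dbarTriple (τ : Hol annulus) (μU μV : SmoothGerm disk) (h : IsSplit τ μU μV)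
    {y : (cech 2 0).homology 1} (hy : IsClass (cech 2 0) 1 (toCech τ) y) :
    IsClass QC 1 (toQC (dbarTriple μU μV)) ((HomologicalComplex.homologyMap compare 1).hom y) := by
  have h1 := hy.map compare
  have hd : (QC.d 1 2).hom (toQC (dbarTriple μU μV)) = 0 := by
    exact (congrArg (fun φ : QC.X 1 ⟶ QC.X 2 => φ.hom (toQC (dbarTriple μU μV)))
      (QC_d (rfl : (1 : ℤ) + 1 = 2))).trans (d_dbarTriple μU μV (h.symm ▸ τ.2))
  obtain ⟨y', hy'⟩ := IsClass.exists_of_closed (rfl : (1 : ℤ) + 1 = 2) _ hd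
  rwa [← (hy'.eq_iff (zero_add 1) h1).2 ⟨hom₀ (μU - splitU τ.1) (μV - splitV τ.1), ?_⟩]
  rw [QC_d (zero_add 1)]
  exact d_eq_dbarTriple_sub τ μU μV h

end Comparison

end Glue

end

/-! ### The theorem. -/

theorem mainTheorem5 :
    ∃ Φ : Glue.cech 2 0 ⟶ Glue.QC,
      QuasiIso Φ ∧
      (∀ τ : Glue.Hol Glue.annulus, ∃ μU μV : Glue.SmoothGerm Glue.disk,
        Glue.IsSplit τ μU μV ∧
          (Φ.f 1).hom (Glue.toCech τ) = Glue.toQC (Glue.dbarTriple μU μV)) ∧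
      (∀ (τ : Glue.Hol Glue.annulus) (μU μV : Glue.SmoothGerm Glue.disk), Glue.IsSplit τ μU μV →
        ∀ y, Glue.IsClass (Glue.cech 2 0) 1 (Glue.toCech τ) y →
          Glue.IsClass Glue.QC 1 (Glue.toQC (Glue.dbarTriple μU μV))
            ((HomologicalComplex.homologyMap Φ 1).hom y)) ∧
      ∃ (c : (Glue.cech 2 0).homology 1 ≃ₗ[ℂ]
            Abelian.Ext (Glue.lineSheaf 2) (Glue.lineSheaf 0) 1)
        (e : Abelian.Ext (Glue.lineSheaf 2) (Glue.lineSheaf 0) 1 ≃ₗ[ℂ] Glue.QC.homology 1),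
        (∀ (τ : Glue.Hol Glue.annulus) (y : (Glue.cech 2 0).homology 1),
          Glue.IsClass (Glue.cech 2 0) 1 (Glue.toCech τ) y →
            ∀ x, Glue.CechExt 2 0 τ x ↔ c y = x) ∧
        (∀ y, e (c y) = (HomologicalComplex.homologyMap Φ 1).hom y) ∧
        Module.finrank ℂ (Abelian.Ext (Glue.lineSheaf 2) (Glue.lineSheaf 0) 1) = 1 ∧
        (∀ S : Glue.Extn (Glue.lineSheaf 2) (Glue.lineSheaf 0),
          (∃ D, Glue.IsNhdU D ∧ Nonempty (Glue.LocalSplitting S.g D)) ∧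
            ∃ D, Glue.IsNhdV D ∧ Nonempty (Glue.LocalSplitting S.g D)) ∧
        ∀ f : Glue.Q.Hom (Glue.objA 2) (Glue.objA 0) 1, Glue.Q.d (rfl : (1 : ℤ) + 1 = 2) f = 0 →
          (∃ a, (Glue.cohCat Glue.AU).d (zero_add 1) a = f.1) ∧
            ∃ b, (Glue.cohCat Glue.AV).d (zero_add 1) b = f.2.1 := by
  have := Glue.quasiIso_compare
  obtain ⟨c, hc⟩ := Glue.exists_cechEquiv
  -- As `c` is invertible, `e` can only be `H¹(Φ) ∘ c⁻¹`; it is an isomorphism because `Φ` is a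
  -- quasi-isomorphism.
  let H := (asIso (HomologicalComplex.homologyMap Glue.compare 1)).toLinearEquiv
  refine ⟨Glue.compare, this, fun τ => ⟨Glue.splitU τ.1, Glue.splitV τ.1,
    Glue.zp_two_mul_splitU_sub τ.1, ?_⟩, fun τ μU μV h y hy => Glue.isClass_dbarTriple τ μU μV h hy,
    c, c.symm.trans H, fun τ y hy x => ?_, fun y => ?_, Glue.finrank_ext, fun S =>
      ⟨⟨_, Glue.isNhdU_ball, Glue.exists_splitting_U S⟩,
        ⟨_, Glue.isNhdV_ball, Glue.exists_splitting_V S⟩⟩,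
    fun f _ => Glue.exists_d_eq_components f⟩
  · rw [Glue.compare_f_one, Glue.compare₁_apply, Glue.dbarTriple_eq]
    rfl
  · rw [Glue.cechExt_iff_eq, hc τ y hy, eq_comm]
  · rw [LinearEquiv.trans_apply, LinearEquiv.symm_apply_apply]
    rfl
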